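/- Let $V$ be a finite-dimensional real vector space, let $N$ be a $\mathbb{Z}$-structure on $V$ (a free subgroup of rank $\dim V$ with $\langle N\rangle_{\mathbb{R}}=V$), and let $M=N^*\subseteq V^*$ be its dual. An $N$-polycone is the set of $\mathbb{R}_{\ge 0}$-linear combinations of a finite subset of $N$; it is sharp if it contains no line; a face of an $N$-polycone $\sigma$ is a set $\sigma\cap\ker(u)$ with $u\in M$ and $u(\sigma)\subseteq\mathbb{R}_{\ge 0}$. Let $\Sigma$ be an $N$-fan, i.e. a (possibly empty) finite set of sharp $N$-polycones that is closed under taking faces and such that the intersection of any two members of $\Sigma$ is a face of both. Let $R$ be a commutative ring. Let $\Sigma_1$ be the set of $1$-dimensional cones in $\Sigma$, let $\sigma_1$ be the set of $1$-dimensional faces of $\sigma\in\Sigma$, and for $\rho\in\Sigma_1$ let $\rho_N$ be its minimal $N$-generator, i.e. the unique $x\in N$ with $\rho=\mathbb{R}_{\ge 0}x$ and $rx\notin N$ for all $r\in\,]0,1[$. Let $a:\mathbb{Z}^{\Sigma_1}\to A$ be the cokernel of $c:M\to\mathbb{Z}^{\Sigma_1}$, $u\mapsto(u(\rho_N))_{\rho\in\Sigma_1}$,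 and let $S=R[(Z_\rho)_{\rho\in\Sigma_1}]$ be the polynomial algebra, $A$-graded by $\deg(Z_\rho)=a(\delta_\rho)$, where $(\delta_\rho)_{\rho}$ is the canonical basis of $\mathbb{Z}^{\Sigma_1}$. For $\sigma\in\Sigma$ put $\widehat{Z}_\sigma=\prod_{\rho\in\Sigma_1\setminus\sigma_1}Z_\rho$. Let $B\subseteq A$ be a big subgroup, i.e. a subgroup of finite index, let $S_B=\bigoplus_{\alpha\in B}S_\alpha$, and let $m=[A:B]\geq 1$, so that $\widehat{Z}_\sigma^m\in S_B$ for all $\sigma\in\Sigma$. Let $S_{(\sigma)}$ be the component of degree $0$ of the $B$-graded ring of fractions $(S_B)_{\widehat{Z}_\sigma^m}$, let $Y_\sigma(R)=\operatorname{Spec}(S_{(\sigma)})$, and let $Y_\Sigma(R)=\varinjlim_{\sigma\in\Sigma}Y_\sigma(R)$ be the Cox scheme, obtained by glueing $(Y_\sigma(R))_{\sigma\in\Sigma}$ along $(Y_{\sigma\cap\tau}(R))_{(\sigma,\tau)\in\Sigma^2}$. For a $B$-graded $S_B$-module $F$ let $F_{(\sigma)}$ be the component of degree $0$ of $F_{\widehat{Z}_\sigma^m}$,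 and let $\mathscr{S}_B(F)$ be the $\mathscr{O}_{Y_\Sigma(R)}$-module obtained by glueing the modules $\widetilde{F_{(\sigma)}}$ associated with $F_{(\sigma)}$ on $Y_\sigma(R)$, for $\sigma\in\Sigma$, along the canonical morphisms $F_{(\sigma)}\to F_{(\tau)}$ for faces $\tau$ of $\sigma$. **Theorem.** The $\mathscr{O}_{Y_\Sigma(R)}$-module $\mathscr{S}_B(F)$ is quasicoherent for every $B$-graded $S_B$-module $F$, and the resulting functor $\mathscr{S}_B$ from the category of $B$-graded $S_B$-modules (with morphisms of degree $0$) to the category of quasicoherent $\mathscr{O}_{Y_\Sigma(R)}$-modules is essentially surjective: every quasicoherent $\mathscr{O}_{Y_\Sigma(R)}$-module is isomorphic to $\mathscr{S}_B(F)$ for some $B$-graded $S_B$-module $F$. -/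

import Mathlib

universe u v w

set_option linter.unusedSectionVars false

namespace CoxScheme

open CategoryTheory AlgebraicGeometry DirectSum

section Fans

variable {V : Type v} [AddCommGroup V] [Module ℝ V]

/-- `N` is a `ℤ`-structure on the finite-dimensional real vector space `V`: a free subgroup of
`V` of rank `dim V` which spans `V` over `ℝ`. -/
class IsZStructure (N : AddSubgroup V) : Prop where
  free : Module.Free ℤ N
  finite : Module.Finite ℤ N
  finrank_eq : Module.finrank ℤ N = Module.finrank ℝ V
  span_eq_top : Submodule.span ℝ (N : Set V) = ⊤

/-- The dual `M = N^*`, as the subgroup of `V^*` of all linear forms with integral values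
on `N`. -/
def dualStructure (N : AddSubgroup V) : AddSubgroup (Module.Dual ℝ V) where
  carrier := {u | ∀ x ∈ N, ∃ k : ℤ, u x = k}
  zero_mem' := fun _ _ => ⟨0, by simp⟩
  add_mem' := by
    intro a b ha hb x hx
    obtain ⟨k, hk⟩ := ha x hx
    obtain ⟨l, hl⟩ := hb x hx
    exact ⟨k + l, by simp [hk, hl]⟩
  neg_mem' := by
    intro a ha x hx
    obtain ⟨k, hk⟩ := ha x hx
    exact ⟨-k, by simp [hk]⟩

/-- `N`-polycones: cones generated by a finite subset of `N`. -/
def IsPolycone (N : AddSubgroup V) (σ : PointedCone ℝ V) : Prop :=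
  ∃ s : Set V, s.Finite ∧ s ⊆ N ∧ σ = PointedCone.hull ℝ s

/-- A cone is sharp if it does not contain a line. -/
def IsSharp (σ : PointedCone ℝ V) : Prop :=
  ∀ x ∈ σ, -x ∈ σ → x = 0

/-- `τ` is a face of `σ`: `τ = σ ∩ ker u` for some `u ∈ σ^∨ ∩ M`. -/
def IsFace (N : AddSubgroup V) (τ σ : PointedCone ℝ V) : Prop :=
  ∃ u ∈ dualStructure N, (∀ x ∈ σ, 0 ≤ u x) ∧ ∀ x, x ∈ τ ↔ x ∈ σ ∧ u x = 0

/-- `N`-fans: finite sets of sharp `N`-polycones, closed under taking faces, such that the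
intersection of any two members is a common face of both of them. -/
structure Fan (N : AddSubgroup V) where
  cones : Set (PointedCone ℝ V)
  finite_cones : cones.Finite
  isPolycone : ∀ σ ∈ cones, IsPolycone N σ
  isSharp : ∀ σ ∈ cones, IsSharp σ
  face_mem : ∀ σ ∈ cones, ∀ τ, IsFace N τ σ → τ ∈ cones
  inf_isFace : ∀ σ ∈ cones, ∀ τ ∈ cones, IsFace N (σ ⊓ τ) σ ∧ IsFace N (σ ⊓ τ) τ

theorem IsFace.le {N : AddSubgroup V} {τ σ : PointedCone ℝ V} (h : IsFace N τ σ) : τ ≤ σ := by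
  obtain ⟨u, -, -, h⟩ := h
  exact fun x hx => ((h x).1 hx).1

/-- `x` is a minimal `N`-generator of `ρ`. -/
def IsMinimalGenerator (N : AddSubgroup V) (ρ : PointedCone ℝ V) (x : V) : Prop :=
  x ∈ N ∧ ρ = PointedCone.hull ℝ {x} ∧ ∀ r : ℝ, 0 < r → r < 1 → r • x ∉ N

theorem mem_hull_singleton {x y : V} :
    y ∈ PointedCone.hull ℝ {x} ↔ ∃ r : ℝ, 0 ≤ r ∧ y = r • x := by
  rw [PointedCone.hull, Submodule.mem_span_singleton]
  constructor
  · rintro ⟨a, rfl⟩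
    exact ⟨a, a.2, rfl⟩
  · rintro ⟨r, hr, rfl⟩
    exact ⟨⟨r, hr⟩, rfl⟩

/-- A linear form with integral values on `N` which does not vanish at a given nonzero vector. -/
theorem exists_dual_ne_zero [FiniteDimensional ℝ V] (N : AddSubgroup V) [hN : IsZStructure N]
    {x : V} (hx : x ≠ 0) : ∃ u ∈ dualStructure N, u x ≠ 0 := by
  have := hN.free
  have := hN.finite
  let b := Module.Free.chooseBasis ℤ N
  let c : Module.Free.ChooseBasisIndex ℤ N → V := fun i => (b i : V)
  have hspan : ⊤ ≤ Submodule.span ℝ (Set.range c) := by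
    rw [← hN.span_eq_top, Submodule.span_le]
    intro y hy
    have := b.sum_repr ⟨y, hy⟩
    have h2 : y = ∑ i, (b.repr ⟨y, hy⟩ i) • c i := by
      have := congrArg (N.subtype) this
      rw [map_sum] at this
      exact this.symm
    rw [h2]
    refine Submodule.sum_mem _ fun i _ => ?_
    exact zsmul_mem (Submodule.subset_span (Set.mem_range_self i)) _
  have hcard : Fintype.card (Module.Free.ChooseBasisIndex ℤ N) = Module.finrank ℝ V := by
    rw [← hN.finrank_eq, Module.finrank_eq_card_chooseBasisIndex]
  let e := basisOfTopLeSpanOfCardEqFinrank c hspan hcard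
  have he : ∀ i, e i = b i := fun i => by simp [e, c]
  obtain ⟨i, hi⟩ : ∃ i, e.repr x i ≠ 0 := by
    by_contra! h
    apply hx
    apply e.repr.injective
    ext i
    simpa using h i
  refine ⟨e.coord i, ?_, by simpa using hi⟩
  intro y hy
  refine ⟨b.repr ⟨y, hy⟩ i, ?_⟩
  have := b.sum_repr ⟨y, hy⟩
  have h2 : y = ∑ j, (b.repr ⟨y, hy⟩ j : ℝ) • e j := by
    have := congrArg (N.subtype) this
    rw [map_sum] at this
    simp only [he, Int.cast_smul_eq_zsmul]
    exact this.symm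
  conv_lhs => rw [h2]
  rw [Module.Basis.coord_apply, e.repr_sum_self]

theorem exists_minimalGenerator [FiniteDimensional ℝ V] (N : AddSubgroup V) [IsZStructure N]
    {ρ : PointedCone ℝ V} (h : IsPolycone N ρ) (hs : IsSharp ρ)
    (hd : Module.finrank ℝ (Submodule.span ℝ (ρ : Set V)) = 1) :
    ∃ x, IsMinimalGenerator N ρ x := by
  obtain ⟨s, -, hsN, rfl⟩ := h
  obtain ⟨x, hxs, hx0⟩ : ∃ x ∈ s, x ≠ 0 := by
    by_contra! h
    have : Submodule.span ℝ (PointedCone.hull ℝ s : Set V) = ⊥ := by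
      rw [eq_bot_iff, Submodule.span_le]
      have : PointedCone.hull ℝ s ≤ ⊥ := by
        refine Submodule.span_le.2 fun y hy => ?_
        simp [h y hy]
      intro y hy
      simpa using this hy
    rw [this] at hd
    simp at hd
  have hmem : ∀ y ∈ PointedCone.hull ℝ s, ∃ r : ℝ, 0 ≤ r ∧ y = r • x := by
    have hxh : x ∈ PointedCone.hull ℝ s := Submodule.subset_span hxs
    intro y hy
    obtain ⟨r, hr⟩ := exists_smul_eq_of_finrank_eq_one hd
      (x := (⟨x, Submodule.subset_span hxh⟩ : Submodule.span ℝ (PointedCone.hull ℝ s : Set V)))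
      (by simpa using hx0) ⟨y, Submodule.subset_span hy⟩
    have hr : r • x = y := congrArg Subtype.val hr
    refine ⟨r, ?_, hr.symm⟩
    by_contra! hneg
    apply hx0
    apply hs x hxh
    have h2 : -x = (-r)⁻¹ • y := by
      rw [← hr, smul_smul]
      have hr0 : r ≠ 0 := hneg.ne
      have : (-r)⁻¹ * r = -1 := by field_simp
      rw [this]; simp
    rw [h2]
    exact (PointedCone.hull ℝ s).smul_mem (by simpa using hneg.le) hy
  obtain ⟨u, hu, hux⟩ := exists_dual_ne_zero N hx0
  wlog hpos : 0 < u x generalizing u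
  · exact this (-u) (neg_mem hu) (by simpa using hux) (by
      rcases lt_or_gt_of_ne hux with h | h
      · simpa using h
      · exact absurd h hpos)
  have hex : ∃ n : ℕ, ∃ y ∈ N, u y = n ∧ 0 < n ∧ ∃ r : ℝ, 0 < r ∧ y = r • x := by
    obtain ⟨k, hk⟩ := hu x (hsN hxs)
    have hk0 : 0 < k := by
      rw [hk] at hpos; exact_mod_cast hpos
    exact ⟨k.toNat, x, hsN hxs, by rw [hk]; exact_mod_cast (Int.toNat_of_nonneg hk0.le).symm,
      by omega, 1, one_pos, by simp⟩
  classical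
  obtain ⟨y, hyN, huy, hn, r, hr, rfl⟩ := Nat.find_spec hex
  refine ⟨r • x, hyN, ?_, ?_⟩
  · apply le_antisymm
    · intro z hz
      obtain ⟨t, ht, rfl⟩ := hmem z hz
      exact mem_hull_singleton.2 ⟨t / r, by positivity, by rw [smul_smul]; field_simp⟩
    · intro z hz
      obtain ⟨t, ht, rfl⟩ := mem_hull_singleton.1 hz
      rw [smul_smul]
      exact (PointedCone.hull ℝ s).smul_mem (by positivity) (Submodule.subset_span hxs)
  · intro t ht0 ht1 htN
    obtain ⟨k, hk⟩ := hu _ htN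
    have hlt : (k : ℝ) < (Nat.find hex : ℕ) := by
      rw [← hk, map_smul, huy, smul_eq_mul]
      have : (0 : ℝ) < (Nat.find hex : ℕ) := by exact_mod_cast hn
      nlinarith
    have hk0 : (0 : ℝ) < k := by
      rw [← hk, map_smul, huy, smul_eq_mul]
      have : (0 : ℝ) < (Nat.find hex : ℕ) := by exact_mod_cast hn
      positivity
    have hk0' : 0 < k := by exact_mod_cast hk0
    have hlt' : k < (Nat.find hex : ℕ) := by exact_mod_cast hlt
    refine Nat.find_min hex (m := k.toNat) (by omega) ⟨t • r • x, htN, ?_, by omega, t * r,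
      by positivity, by rw [smul_smul]⟩
    rw [hk]
    exact_mod_cast (Int.toNat_of_nonneg hk0'.le).symm

end Fans

namespace Fan

variable {V : Type v} [AddCommGroup V] [Module ℝ V] {N : AddSubgroup V} (F : Fan N)

/-- The cones of the fan, ordered by the face relation. -/
def Cone : Type v := F.cones

instance : Finite F.Cone := F.finite_cones

variable {F} in
theorem isFace_of_le {σ τ : F.Cone} (h : τ.1 ≤ σ.1) : IsFace N τ.1 σ.1 := by
  have := (F.inf_isFace σ.1 σ.2 τ.1 τ.2).1
  rwa [inf_eq_right.2 h] at this

instance : PartialOrder F.Cone where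
  le τ σ := IsFace N τ.1 σ.1
  le_refl _ := isFace_of_le le_rfl
  le_trans _ _ _ h h' := isFace_of_le (h.le.trans h'.le)
  le_antisymm _ _ h h' := Subtype.ext (le_antisymm h.le h'.le)

/-- The set `Σ₁` of one-dimensional cones of the fan. -/
def Ray : Type v :=
  {ρ : F.Cone // Module.finrank ℝ (Submodule.span ℝ (ρ.1 : Set V)) = 1}

instance : Finite F.Ray := Subtype.finite

noncomputable instance : Fintype F.Ray := Fintype.ofFinite _

noncomputable instance : DecidableEq F.Ray := Classical.decEq _

variable [FiniteDimensional ℝ V] [IsZStructure N]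

/-- The minimal `N`-generator `ρ_N` of a one-dimensional cone `ρ`. -/
noncomputable def gen (ρ : F.Ray) : V :=
  (exists_minimalGenerator N (F.isPolycone _ ρ.1.2) (F.isSharp _ ρ.1.2) ρ.2).choose

theorem gen_spec (ρ : F.Ray) : IsMinimalGenerator N ρ.1.1 (F.gen ρ) :=
  (exists_minimalGenerator N (F.isPolycone _ ρ.1.2) (F.isSharp _ ρ.1.2) ρ.2).choose_spec

/-- The homomorphism `c : M → ℤ^{Σ₁}`, `u ↦ (u(ρ_N))_ρ`; the values `u(ρ_N)` are integers, so
taking floors does not change them. -/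
noncomputable def c : dualStructure N →+ (F.Ray → ℤ) where
  toFun u := fun ρ => ⌊u.1 (F.gen ρ)⌋
  map_zero' := by ext; simp
  map_add' := by
    intro a b
    ext ρ
    obtain ⟨k, hk⟩ := a.2 _ (F.gen_spec ρ).1
    simp [hk]

theorem c_apply (u : dualStructure N) (ρ : F.Ray) : (F.c u ρ : ℝ) = u.1 (F.gen ρ) := by
  obtain ⟨k, hk⟩ := u.2 _ (F.gen_spec ρ).1
  simp [c, hk]

/-- The group `A`, the cokernel of `c`. -/
def A : Type v := (F.Ray → ℤ) ⧸ F.c.range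

noncomputable instance : AddCommGroup F.A :=
  inferInstanceAs (AddCommGroup ((F.Ray → ℤ) ⧸ F.c.range))

noncomputable instance : DecidableEq F.A := Classical.decEq _

/-- The projection `a : ℤ^{Σ₁} → A`. -/
noncomputable def a : (F.Ray → ℤ) →+ F.A := QuotientAddGroup.mk' F.c.range

/-- The degrees `α_ρ = a(δ_ρ)`. -/
noncomputable def α (ρ : F.Ray) : F.A := F.a (Pi.single ρ 1)

theorem a_c (u : dualStructure N) : F.a (F.c u) = 0 :=
  (QuotientAddGroup.eq_zero_iff _).2 ⟨u, rfl⟩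

end Fan

section DegreeRestriction

variable {ι : Type v} {G : Type v} [AddCommGroup G] (R : Type u) [CommRing R]
variable (wt : ι → G) (B : AddSubgroup G)

/-- The degree restriction `⨁_{α ∈ B} S_α` to a subgroup `B` of `G` of the polynomial ring
`S = R[(Z_i)_i]`, graded by `G` via `deg Z_i = wt i`: the subalgebra of all polynomials whose
monomials all have degree in `B`. -/
noncomputable def restrictDegrees : Subalgebra R (MvPolynomial ι R) where
  carrier := {p | ∀ d, p.coeff d ≠ 0 → Finsupp.weight wt d ∈ B}
  mul_mem' := by
    intro p q hp hq d hd
    classical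
    rw [MvPolynomial.coeff_mul] at hd
    obtain ⟨⟨d₁, d₂⟩, hmem, hne⟩ := Finset.exists_ne_zero_of_sum_ne_zero hd
    rw [← Finset.HasAntidiagonal.mem_antidiagonal.1 hmem, map_add]
    exact B.add_mem (hp _ (left_ne_zero_of_mul hne)) (hq _ (right_ne_zero_of_mul hne))
  add_mem' := by
    intro p q hp hq d hd
    by_cases h : p.coeff d = 0
    · exact hq d (by simpa [h] using hd)
    · exact hp d h
  algebraMap_mem' := by
    intro r d hd
    have : d = 0 := by
      by_contra h
      exact hd (by
        classical
        rw [MvPolynomial.algebraMap_eq, MvPolynomial.coeff_C, if_neg (Ne.symm h)])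
    simp [this]

/-- The graded pieces of `⨁_{α ∈ B} S_α`. -/
noncomputable def restrictDegreesPiece (β : B) : Submodule R (restrictDegrees R wt B) :=
  (MvPolynomial.weightedHomogeneousSubmodule R wt (β : G)).comap
    (restrictDegrees R wt B).val.toLinearMap

variable {R wt B}

theorem mem_restrictDegrees {p : MvPolynomial ι R} :
    p ∈ restrictDegrees R wt B ↔ ∀ d, p.coeff d ≠ 0 → Finsupp.weight wt d ∈ B := Iff.rfl

theorem mem_restrictDegreesPiece {β : B} {p : restrictDegrees R wt B} :
    p ∈ restrictDegreesPiece R wt B β ↔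
      MvPolynomial.IsWeightedHomogeneous wt (p : MvPolynomial ι R) (β : G) := Iff.rfl

theorem mem_restrictDegrees_of_isWeightedHomogeneous {p : MvPolynomial ι R} {β : G}
    (hβ : β ∈ B) (hp : MvPolynomial.IsWeightedHomogeneous wt p β) :
    p ∈ restrictDegrees R wt B := by
  intro d hd
  rw [hp hd]
  exact hβ

/-- The monomial with exponent `d`, as an element of `⨁_{α ∈ B} S_α`. -/
noncomputable def restrictedMonomial (d : ι →₀ ℕ) (r : R) (hd : Finsupp.weight wt d ∈ B) :
    restrictDegrees R wt B :=
  ⟨MvPolynomial.monomial d r, mem_restrictDegrees_of_isWeightedHomogeneous hd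
    (MvPolynomial.isWeightedHomogeneous_monomial _ _ _ rfl)⟩

theorem restrictedMonomial_mem (d : ι →₀ ℕ) (r : R) (hd : Finsupp.weight wt d ∈ B) :
    restrictedMonomial d r hd ∈ restrictDegreesPiece R wt B ⟨Finsupp.weight wt d, hd⟩ :=
  MvPolynomial.isWeightedHomogeneous_monomial _ _ _ rfl

instance : SetLike.GradedMonoid (restrictDegreesPiece R wt B) where
  one_mem := MvPolynomial.isWeightedHomogeneous_one R wt
  mul_mem _ _ _ _ hp hq := MvPolynomial.IsWeightedHomogeneous.mul hp hq

variable [DecidableEq G]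

theorem restrictDegrees_isInternal : DirectSum.IsInternal (restrictDegreesPiece R wt B) := by
  have key : ∀ (x : ⨁ β : B, restrictDegreesPiece R wt B β) (β : B) (d : ι →₀ ℕ),
      Finsupp.weight wt d = β →
      (DirectSum.coeAddMonoidHom (restrictDegreesPiece R wt B) x : MvPolynomial ι R).coeff d =
        ((x β : restrictDegrees R wt B) : MvPolynomial ι R).coeff d := by
    intro x β d hd
    induction x using DirectSum.induction_on with
    | zero => simp
    | of γ y =>
      rw [DirectSum.coeAddMonoidHom_of]
      by_cases h : γ = β
      · subst h; rw [DirectSum.of_eq_same]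
      · rw [DirectSum.of_eq_of_ne _ _ _ (Ne.symm h)]
        by_contra hne
        exact h (Subtype.ext ((y.2 (by simpa using hne)).symm.trans hd))
    | add x y hx hy => simp [hx, hy]
  constructor
  · intro x y hxy
    ext β d
    by_cases h : Finsupp.weight wt d = β
    · rw [← key x β d h, ← key y β d h, hxy]
    · have hz : ∀ z : restrictDegreesPiece R wt B β,
          ((z : restrictDegrees R wt B) : MvPolynomial ι R).coeff d = 0 := by
        intro z
        by_contra hne
        exact h (z.2 hne)
      rw [hz, hz]
  · intro p
    have hp : p = ∑ d ∈ (p : MvPolynomial ι R).support.attach,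
        restrictedMonomial (R := R) d.1 ((p : MvPolynomial ι R).coeff d)
          (p.2 _ (MvPolynomial.mem_support_iff.1 d.2)) := by
      apply Subtype.ext
      rw [AddSubmonoidClass.coe_finsetSum]
      simp only [restrictedMonomial]
      rw [Finset.sum_attach
        (p : MvPolynomial ι R).support
        (fun d => MvPolynomial.monomial d ((p : MvPolynomial ι R).coeff d)),
        MvPolynomial.support_sum_monomial_coeff]
    rw [← AddMonoidHom.mem_mrange, hp]
    refine sum_mem fun d _ => ?_
    refine ⟨DirectSum.of (fun β : B => restrictDegreesPiece R wt B β) _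
      ⟨_, restrictedMonomial_mem d.1 ((p : MvPolynomial ι R).coeff d)
        (p.2 _ (MvPolynomial.mem_support_iff.1 d.2))⟩, ?_⟩
    rw [DirectSum.coeAddMonoidHom_of]

noncomputable instance : GradedAlgebra (restrictDegreesPiece R wt B) where
  toDecomposition := restrictDegrees_isInternal.chooseDecomposition

end DegreeRestriction
section HomogeneousLocalization

open _root_.HomogeneousLocalization

variable {ι A σ : Type*} [CommRing A] [SetLike σ A] [AddSubgroupClass σ A] [AddCommMonoid ι]
  [DecidableEq ι] {𝒜 : ι → σ} [GradedRing 𝒜]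

/-- The canonical map `A_f → A_x` for `f ∣ x`. -/
noncomputable def locMap {f x : A} (h : f ∣ x) : Localization.Away f →+* Localization.Away x :=
  Localization.awayLift (algebraMap A _) _
    (isUnit_of_dvd_unit (map_dvd _ h) (IsLocalization.Away.algebraMap_isUnit x))

theorem locMap_algebraMap {f x : A} (h : f ∣ x) (a : A) :
    locMap h (algebraMap A _ a) = algebraMap A _ a :=
  IsLocalization.Away.lift_eq f
    (isUnit_of_dvd_unit (map_dvd _ h) (IsLocalization.Away.algebraMap_isUnit x)) a

theorem locMap_refl {f : A} (h : f ∣ f) (z : Localization.Away f) : locMap h z = z := by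
  have : locMap h = RingHom.id _ :=
    IsLocalization.ringHom_ext (Submonoid.powers f) (by ext; simp [locMap_algebraMap])
  rw [this]; rfl

theorem locMap_locMap {f x y : A} (h : f ∣ x) (h' : x ∣ y) (h'' : f ∣ y)
    (z : Localization.Away f) : locMap h' (locMap h z) = locMap h'' z := by
  have : (locMap h').comp (locMap h) = locMap h'' :=
    IsLocalization.ringHom_ext (Submonoid.powers f) (by ext; simp [locMap_algebraMap])
  rw [← this]; rfl

theorem val_awayMap' {f g x : A} {e : ι} (hg : g ∈ 𝒜 e) (hx : x = f * g) (z : Away 𝒜 f) :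
    (awayMap 𝒜 hg hx z).val = locMap ⟨g, hx⟩ z.val :=
  val_awayMap 𝒜 hg hx z

/-- If `a` is a multiple of `g` and divides a power of `x = f g`, then `A_(x)` is the localization
of `A_(f)` at `a / f ^ n`. -/
theorem isLocalization_awayMap {d e dc db : ι} {f g x a b c : A} (hf : f ∈ 𝒜 d) (hg : g ∈ 𝒜 e)
    (hx : x = f * g) (n : ℕ) (ha : a ∈ 𝒜 (n • d)) (hc : c ∈ 𝒜 dc) (hdc : e + dc = n • d)
    (hgc : g * c = a) (l : ℕ) (hb : b ∈ 𝒜 db) (hdb : n • d + db = l • (d + e))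
    (hab : a * b = x ^ l) :
    letI := (awayMap 𝒜 hg hx).toAlgebra
    IsLocalization.Away (Away.mk 𝒜 hf n a ha) (Away 𝒜 x) := by
  let := (awayMap 𝒜 hg hx).toAlgebra
  have hxd : x ∈ 𝒜 (d + e) := hx ▸ SetLike.mul_mem_graded hf hg
  constructor; constructor
  · rintro ⟨r, N, rfl⟩
    rw [map_pow, RingHom.algebraMap_toAlgebra]
    let z : Away 𝒜 x := Away.mk 𝒜 hxd l (f ^ n * b) <| by
      rw [← hdb]
      exact SetLike.mul_mem_graded (SetLike.pow_mem_graded n hf) hb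
    refine (isUnit_iff_exists_inv.mpr ⟨z, ?_⟩).pow _
    ext
    simp only [val_mul, val_one, awayMap_mk, Away.val_mk, z, Localization.mk_mul]
    rw [← Localization.mk_one, Localization.mk_eq_mk_iff, Localization.r_iff_exists]
    use 1
    simp only [OneMemClass.coe_one, one_mul, Submonoid.coe_mul, mul_one]
    rw [← hab, hx]
    ring
  · intro z
    obtain ⟨N, s, hs, rfl⟩ := Away.mk_surjective 𝒜 hxd z
    let t : Away 𝒜 f := Away.mk 𝒜 hf (N * (1 + n)) (s * c ^ N) <| by
      convert! SetLike.mul_mem_graded hs (SetLike.pow_mem_graded N hc) using 2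
      rw [← smul_add, add_assoc, hdc, mul_smul, add_smul, one_smul]
    refine ⟨⟨t, ⟨_, ⟨N, rfl⟩⟩⟩, ?_⟩
    ext
    simp only [RingHom.algebraMap_toAlgebra, map_pow, awayMap_mk, val_mul, Away.val_mk, val_pow,
      Localization.mk_pow, Localization.mk_mul, t]
    rw [Localization.mk_eq_mk_iff, Localization.r_iff_exists]
    refine ⟨1, ?_⟩
    simp only [OneMemClass.coe_one, one_mul, Submonoid.coe_mul, SubmonoidClass.coe_pow, hx, ← hgc]
    ring
  · intro t₁ t₂ h
    obtain ⟨p, u₁, hu₁, rfl⟩ := Away.mk_surjective 𝒜 hf t₁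
    obtain ⟨q, u₂, hu₂, rfl⟩ := Away.mk_surjective 𝒜 hf t₂
    replace h := congr_arg val h
    simp only [RingHom.algebraMap_toAlgebra, awayMap_mk, Away.val_mk,
      Localization.mk_eq_mk_iff, Localization.r_iff_exists] at h
    obtain ⟨⟨_, j, rfl⟩, hj⟩ := h
    refine ⟨⟨_, j + p + q, rfl⟩, ?_⟩
    ext
    simp only [val_mul, val_pow, Away.val_mk, Localization.mk_pow,
      Localization.mk_eq_mk_iff, Localization.r_iff_exists, Submonoid.coe_mul, Localization.mk_mul,
      SubmonoidClass.coe_pow, Subtype.exists, exists_prop]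
    refine ⟨_, ⟨j, rfl⟩, ?_⟩
    subst hx hgc
    simp only at hj ⊢
    convert! congr(f ^ (n * (j + p + q)) * c ^ (j + p + q) * $hj) using 1 <;> ring

end HomogeneousLocalization
namespace Fan

variable {V : Type v} [AddCommGroup V] [Module ℝ V] {N : AddSubgroup V} (F : Fan N)
variable [FiniteDimensional ℝ V] [IsZStructure N] (R : Type u) [CommRing R] (B : AddSubgroup F.A)

/-- The `B`-restricted Cox ring `S_B = ⨁_{α ∈ B} S_α`, where `S = R[(Z_ρ)_{ρ ∈ Σ₁}]` is graded by
`A` via `deg Z_ρ = α_ρ`. -/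
abbrev coxRing : Type (max u v) := restrictDegrees R F.α B

/-- The `B`-graduation of `S_B`. -/
noncomputable abbrev coxPiece : B → Submodule R (F.coxRing R B) := restrictDegreesPiece R F.α B

open Classical in
/-- The monomial `Ẑ_σ`, the product of all `Z_ρ` where `ρ ∈ Σ₁` is not a face of `σ`. -/
noncomputable def zHat (σ : F.Cone) : MvPolynomial F.Ray R :=
  ∏ ρ with ¬ ρ.1 ≤ σ, MvPolynomial.X ρ

/-- The monomial with exponents `e`. -/
noncomputable def mono (e : F.Ray → ℕ) : MvPolynomial F.Ray R := ∏ ρ, MvPolynomial.X ρ ^ e ρ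

/-- The degree in `A` of the monomial with exponents `e`. -/
noncomputable def monoDeg (e : F.Ray → ℕ) : F.A := F.a fun ρ => (e ρ : ℤ)

theorem monoDeg_eq_sum (e : F.Ray → ℕ) : F.monoDeg e = ∑ ρ, e ρ • F.α ρ := by
  have : (fun ρ => (e ρ : ℤ)) = ∑ ρ, e ρ • (Pi.single ρ 1 : F.Ray → ℤ) := by
    ext ρ
    simp [Finset.sum_apply, Pi.single_apply]
  rw [monoDeg, this, map_sum]
  exact Finset.sum_congr rfl fun ρ _ => map_nsmul _ _ _

theorem mono_isWeightedHomogeneous (e : F.Ray → ℕ) :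
    (F.mono R e).IsWeightedHomogeneous F.α (F.monoDeg e) := by
  rw [monoDeg_eq_sum]
  exact MvPolynomial.IsWeightedHomogeneous.prod _ _ _ fun ρ _ =>
    (MvPolynomial.isWeightedHomogeneous_X R F.α ρ).pow _

theorem mono_add (e e' : F.Ray → ℕ) : F.mono R (e + e') = F.mono R e * F.mono R e' := by
  simp [mono, pow_add, Finset.prod_mul_distrib]

theorem monoDeg_add (e e' : F.Ray → ℕ) : F.monoDeg (e + e') = F.monoDeg e + F.monoDeg e' := by
  simp [monoDeg_eq_sum, add_smul, Finset.sum_add_distrib]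

theorem monoDeg_nsmul (n : ℕ) (e : F.Ray → ℕ) : F.monoDeg (n • e) = n • F.monoDeg e := by
  simp [monoDeg_eq_sum, mul_smul, Finset.smul_sum]

theorem mono_nsmul (n : ℕ) (e : F.Ray → ℕ) : F.mono R (n • e) = F.mono R e ^ n := by
  simp [mono, Finset.prod_pow, pow_mul']

variable {F B} in
/-- The monomial with exponents `e`, as an element of `S_B`. -/
noncomputable def monoB (e : F.Ray → ℕ) (h : F.monoDeg e ∈ B) : F.coxRing R B :=
  ⟨F.mono R e, mem_restrictDegrees_of_isWeightedHomogeneous h (F.mono_isWeightedHomogeneous R e)⟩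

variable {F B} in
theorem monoB_mem (e : F.Ray → ℕ) (h : F.monoDeg e ∈ B) :
    monoB R e h ∈ F.coxPiece R B ⟨F.monoDeg e, h⟩ :=
  F.mono_isWeightedHomogeneous R e

open Classical in
/-- The exponents of `Ẑ_σ`. -/
noncomputable def zExp (σ : F.Cone) : F.Ray → ℕ := fun ρ => if ρ.1 ≤ σ then 0 else 1

open Classical in
/-- The exponents of `Ẑ_τ / Ẑ_σ` for a face `τ` of `σ`. -/
noncomputable def qExp (τ σ : F.Cone) : F.Ray → ℕ :=
  fun ρ => if ρ.1 ≤ σ ∧ ¬ ρ.1 ≤ τ then 1 else 0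

variable {F} in
theorem zExp_add_qExp {τ σ : F.Cone} (h : τ ≤ σ) : F.zExp σ + F.qExp τ σ = F.zExp τ := by
  ext ρ
  by_cases h1 : ρ.1 ≤ τ
  · simp [zExp, qExp, h1, h1.trans h]
  · by_cases h2 : ρ.1 ≤ σ <;> simp [zExp, qExp, h1, h2]

theorem zHat_eq_mono (σ : F.Cone) : F.zHat R σ = F.mono R (F.zExp σ) := by
  classical
  rw [zHat, mono, Finset.prod_filter]
  refine Finset.prod_congr rfl fun ρ _ => ?_
  by_cases h : ρ.1 ≤ σ <;> simp [zExp, h]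

theorem index_nsmul_mem (e : F.Ray → ℕ) : F.monoDeg (B.index • e) ∈ B := by
  rw [monoDeg_nsmul]
  exact B.nsmul_index_mem _

/-- The power `Ẑ_σ ^ m` for `m = [A : B]`, as an element of `S_B`. If `B` is big, that is, of
finite index in `A`, then `m > 0`. -/
noncomputable def zPow (σ : F.Cone) : F.coxRing R B :=
  ⟨F.zHat R σ ^ B.index, by
    rw [zHat_eq_mono, ← mono_nsmul]
    exact (monoB R _ (F.index_nsmul_mem B _)).2⟩

theorem zPow_eq (σ : F.Cone) :
    F.zPow R B σ = monoB R (B.index • F.zExp σ) (F.index_nsmul_mem B _) :=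
  Subtype.ext (by simp only [zPow, monoB, zHat_eq_mono, mono_nsmul])

/-- The degree of `Ẑ_σ ^ m`. -/
noncomputable def zDeg (σ : F.Cone) : B := ⟨_, F.index_nsmul_mem B (F.zExp σ)⟩

theorem zPow_mem (σ : F.Cone) : F.zPow R B σ ∈ F.coxPiece R B (F.zDeg B σ) := by
  rw [zPow_eq]
  exact monoB_mem R _ _

/-- The quotient `(Ẑ_τ / Ẑ_σ) ^ m` for a face `τ` of `σ`. -/
noncomputable def qPow (τ σ : F.Cone) : F.coxRing R B :=
  monoB R (B.index • F.qExp τ σ) (F.index_nsmul_mem B _)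

/-- The degree of `(Ẑ_τ / Ẑ_σ) ^ m`. -/
noncomputable def qDeg (τ σ : F.Cone) : B := ⟨_, F.index_nsmul_mem B (F.qExp τ σ)⟩

theorem qPow_mem (τ σ : F.Cone) : F.qPow R B τ σ ∈ F.coxPiece R B (F.qDeg B τ σ) :=
  monoB_mem R _ _

variable {F} in
theorem zPow_eq_mul {τ σ : F.Cone} (h : τ ≤ σ) :
    F.zPow R B τ = F.zPow R B σ * F.qPow R B τ σ := by
  rw [zPow_eq, zPow_eq, qPow]
  apply Subtype.ext
  simp only [monoB, MulMemClass.mk_mul_mk]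
  rw [← mono_add, ← smul_add, zExp_add_qExp h]

variable {F} in
theorem zPow_dvd {τ σ : F.Cone} (h : τ ≤ σ) : F.zPow R B σ ∣ F.zPow R B τ :=
  ⟨_, zPow_eq_mul R B h⟩

/-- The ring `S_(σ)`, the component of degree `0` of the ring of fractions of `S_B` with
denominators the powers of `Ẑ_σ ^ m`. -/
abbrev coneRing (σ : F.Cone) : Type (max u v) :=
  HomogeneousLocalization.Away (F.coxPiece R B) (F.zPow R B σ)

variable {F} in
/-- The canonical morphism `S_(σ) → S_(τ)` for a face `τ` of `σ`. -/
noncomputable def coneRingMap {τ σ : F.Cone} (h : τ ≤ σ) : F.coneRing R B σ →+* F.coneRing R B τ :=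
  HomogeneousLocalization.awayMap (F.coxPiece R B) (F.qPow_mem R B τ σ) (zPow_eq_mul R B h)

variable {F} in
theorem val_coneRingMap {τ σ : F.Cone} (h : τ ≤ σ) (z : F.coneRing R B σ) :
    (coneRingMap R B h z).val = locMap (zPow_dvd R B h) z.val :=
  val_awayMap' _ _ z

variable {F} in
theorem coneRingMap_refl (σ : F.Cone) : coneRingMap R B (le_refl σ) = RingHom.id _ :=
  RingHom.ext fun z => HomogeneousLocalization.val_injective _
    ((val_coneRingMap R B le_rfl z).trans (locMap_refl _ _))

variable {F} in
theorem coneRingMap_comp {ρ τ σ : F.Cone} (h : ρ ≤ τ) (h' : τ ≤ σ) :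
    (coneRingMap R B h).comp (coneRingMap R B h') = coneRingMap R B (h.trans h') := by
  refine RingHom.ext fun z => HomogeneousLocalization.val_injective _ ?_
  rw [RingHom.comp_apply, val_coneRingMap, val_coneRingMap, val_coneRingMap, locMap_locMap]

/-- The inductive system `Y_σ(R) = Spec S_(σ)` of schemes over `Σ`. -/
noncomputable def coxDiagram : F.Cone ⥤ Scheme.{max u v} where
  obj σ := Spec (CommRingCat.of (F.coneRing R B σ))
  map h := Spec.map (CommRingCat.ofHom (coneRingMap R B h.le))
  map_id σ := by
    rw [coneRingMap_refl, CommRingCat.ofHom_id, Spec.map_id]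
  map_comp {ρ τ σ} h h' := by
    rw [← coneRingMap_comp R B h.le h'.le, CommRingCat.ofHom_comp, Spec.map_comp]

variable {F} in
theorem gen_mem (ρ : F.Ray) : F.gen ρ ∈ ρ.1.1 := by
  rw [(F.gen_spec ρ).2.1]
  exact mem_hull_singleton.2 ⟨1, zero_le_one, by simp⟩

variable {F} in
theorem ray_le_iff (ρ : F.Ray) (σ : F.Cone) : ρ.1 ≤ σ ↔ F.gen ρ ∈ σ.1 := by
  constructor
  · exact fun h => h.le (gen_mem ρ)
  · intro h
    refine isFace_of_le ?_
    rw [(F.gen_spec ρ).2.1]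
    intro y hy
    obtain ⟨r, hr, rfl⟩ := mem_hull_singleton.1 hy
    exact σ.1.smul_mem hr h

variable {F} in
/-- `u` takes nonnegative values on `σ`, and its values on all `ρ_N` are bounded by `K`. -/
def IsBounded (σ : F.Cone) (u : dualStructure N) (K : ℕ) : Prop :=
  (∀ x ∈ σ.1, 0 ≤ u.1 x) ∧ ∀ ρ, |F.c u ρ| ≤ K

variable {F} in
/-- The exponents of `Ẑ_σ ^ K * ∏ ρ, Z_ρ ^ u(ρ_N)`. -/
noncomputable def faceExp (σ : F.Cone) (u : dualStructure N) (K : ℕ) : F.Ray → ℕ :=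
  fun ρ => (F.c u ρ + K * F.zExp σ ρ).toNat

section FaceElem

variable {F} {σ : F.Cone} {u : dualStructure N} {K : ℕ}

theorem IsBounded.c_nonneg (H : IsBounded σ u K) {ρ : F.Ray} (hρ : ρ.1 ≤ σ) : 0 ≤ F.c u ρ := by
  have := H.1 _ ((ray_le_iff ρ σ).1 hρ)
  rw [← c_apply] at this
  exact_mod_cast this

theorem IsBounded.faceExp_eq (H : IsBounded σ u K) (ρ : F.Ray) :
    (faceExp σ u K ρ : ℤ) = F.c u ρ + K * F.zExp σ ρ := by
  apply Int.toNat_of_nonneg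
  by_cases hρ : ρ.1 ≤ σ
  · simpa [zExp, hρ] using H.c_nonneg hρ
  · have := H.2 ρ
    have := neg_abs_le (F.c u ρ)
    simp only [zExp, hρ, if_false]; push_cast; linarith

theorem IsBounded.monoDeg_faceExp (H : IsBounded σ u K) :
    F.monoDeg (faceExp σ u K) = K • F.monoDeg (F.zExp σ) := by
  have : (fun ρ => (faceExp σ u K ρ : ℤ)) = F.c u + K • fun ρ => (F.zExp σ ρ : ℤ) := by
    ext ρ; simp [H.faceExp_eq]
  rw [monoDeg, this, map_add, map_nsmul, a_c, zero_add]; rfl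

theorem IsBounded.deg_eq (H : IsBounded σ u K) :
    (⟨_, F.index_nsmul_mem B (faceExp σ u K)⟩ : B) = K • F.zDeg B σ := by
  apply Subtype.ext
  simp only [zDeg, AddSubgroup.coe_nsmul]
  rw [monoDeg_nsmul, H.monoDeg_faceExp, monoDeg_nsmul, smul_comm]

/-- The `m`-th power of `∏ ρ, Z_ρ ^ u(ρ_N)`, as an element of `S_(σ)`. -/
noncomputable def faceElem (H : IsBounded σ u K) : F.coneRing R B σ :=
  HomogeneousLocalization.Away.mk (F.coxPiece R B) (F.zPow_mem R B σ) K
    (monoB R (B.index • faceExp σ u K) (F.index_nsmul_mem B _))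
    (H.deg_eq B ▸ monoB_mem R _ _)

theorem faceElem_mul {u' : dualStructure N} {K' : ℕ} (H : IsBounded σ u K)
    (H' : IsBounded σ u' K') (H'' : IsBounded σ (u + u') (K + K')) :
    faceElem R B H'' = faceElem R B H * faceElem R B H' := by
  refine HomogeneousLocalization.val_injective _ ?_
  simp only [faceElem, HomogeneousLocalization.val_mul, HomogeneousLocalization.Away.val_mk,
    Localization.mk_mul]
  congr 1
  · apply Subtype.ext
    simp only [monoB, MulMemClass.mk_mul_mk]
    rw [← mono_add, ← smul_add]
    congr 2
    ext ρ
    have h1 := H.faceExp_eq ρ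
    have h2 := H'.faceExp_eq ρ
    have h3 := H''.faceExp_eq ρ
    rw [map_add] at h3
    push_cast [Pi.add_apply] at h3
    zify
    rw [Pi.add_apply]
    push_cast
    rw [h1, h2, h3]
    ring
  · apply Subtype.ext
    simp [pow_add]

/-- If `τ = σ ∩ ker u` with `u ∈ σ^∨ ∩ M`, then `S_(τ)` is the localization of `S_(σ)` at the
`m`-th power of `∏ ρ, Z_ρ ^ u(ρ_N)`. -/
theorem isLocalization_faceElem (H : IsBounded σ u K) {τ : F.Cone} (h : τ ≤ σ)
    (hker : ∀ x, x ∈ τ.1 ↔ x ∈ σ.1 ∧ u.1 x = 0) :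
    letI := (coneRingMap R B h).toAlgebra
    IsLocalization.Away (faceElem R B H) (F.coneRing R B τ) := by
  have hU1 : ∀ ρ : F.Ray, ρ.1 ≤ τ → F.c u ρ = 0 := fun ρ hρ => by
    have := ((hker _).1 ((ray_le_iff ρ τ).1 hρ)).2
    rw [← c_apply] at this; exact_mod_cast this
  have hU3 : ∀ ρ : F.Ray, ρ.1 ≤ σ → ¬ ρ.1 ≤ τ → 1 ≤ F.c u ρ := fun ρ hρ hρ' => by
    have h0 : F.c u ρ ≠ 0 := by
      intro h0
      apply hρ'
      rw [ray_le_iff, hker, ← c_apply, h0]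
      exact ⟨(ray_le_iff ρ σ).1 hρ, by simp⟩
    have := H.c_nonneg hρ
    omega
  obtain ⟨eC, heC⟩ : ∃ eC, F.qExp τ σ + eC = faceExp σ u K := by
    refine ⟨faceExp σ u K - F.qExp τ σ, add_tsub_cancel_of_le fun ρ => ?_⟩
    by_cases h1 : ρ.1 ≤ σ ∧ ¬ ρ.1 ≤ τ
    · have := H.faceExp_eq ρ
      simp only [zExp, h1.1, if_true] at this
      have := hU3 ρ h1.1 h1.2
      simp only [qExp, if_pos h1]; push_cast at *; omega
    · simp [qExp, h1]
  obtain ⟨eB, heB⟩ : ∃ eB, faceExp σ u K + eB = (2 * K) • F.zExp τ := by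
    refine ⟨(2 * K) • F.zExp τ - faceExp σ u K, add_tsub_cancel_of_le fun ρ => ?_⟩
    have h1 := H.faceExp_eq ρ
    have h2 := H.2 ρ
    have h3 := le_abs_self (F.c u ρ)
    by_cases hρ : ρ.1 ≤ τ
    · have hρ' := hρ.trans h
      simp only [zExp, hρ', if_true] at h1
      have := hU1 ρ hρ
      push_cast at h1; simp only [Pi.smul_apply]; omega
    · by_cases hρ' : ρ.1 ≤ σ <;>
        simp only [zExp, hρ', if_true, if_false, Pi.smul_apply, hρ, smul_eq_mul, mul_one] at h1 ⊢ <;>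
        push_cast at h1 <;> omega
  refine isLocalization_awayMap (d := F.zDeg B σ) (e := F.qDeg B τ σ)
    (F.zPow_mem R B σ) (F.qPow_mem R B τ σ) (zPow_eq_mul R B h)
    K _ (monoB_mem R (B.index • eC) (F.index_nsmul_mem B _)) ?_ ?_ (2 * K)
    (monoB_mem R (B.index • eB) (F.index_nsmul_mem B _)) ?_ ?_
  · rw [← H.deg_eq]
    apply Subtype.ext
    simp only [qDeg, AddSubgroup.coe_add]
    rw [← monoDeg_add, ← smul_add, heC]
  · apply Subtype.ext
    simp only [qPow, monoB, MulMemClass.mk_mul_mk]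
    rw [← mono_add, ← smul_add, heC]
  · rw [← H.deg_eq]
    apply Subtype.ext
    simp only [qDeg, zDeg, AddSubgroup.coe_add, AddSubgroup.coe_nsmul]
    rw [← monoDeg_add, ← monoDeg_add, ← smul_add, ← smul_add, zExp_add_qExp h, heB,
      ← monoDeg_nsmul, smul_comm]
  · rw [zPow_eq]
    apply Subtype.ext
    simp only [monoB, MulMemClass.mk_mul_mk, SubmonoidClass.mk_pow]
    rw [← mono_add, ← mono_nsmul, ← smul_add, heB, smul_comm]

theorem exists_isBounded (hu : ∀ x ∈ σ.1, 0 ≤ u.1 x) : ∃ K, IsBounded σ u K := by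
  refine ⟨∑ ρ, (F.c u ρ).natAbs, hu, fun ρ => ?_⟩
  rw [Int.abs_eq_natAbs]
  exact_mod_cast Finset.single_le_sum (f := fun ρ => (F.c u ρ).natAbs)
    (fun _ _ => Nat.zero_le _) (Finset.mem_univ ρ)

end FaceElem

variable {F} in
theorem exists_isBounded_of_le {τ σ : F.Cone} (h : τ ≤ σ) :
    ∃ (u : dualStructure N) (K : ℕ), IsBounded σ u K ∧
      ∀ x, x ∈ τ.1 ↔ x ∈ σ.1 ∧ u.1 x = 0 := by
  obtain ⟨u, hu, hpos, hker⟩ := id h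
  obtain ⟨K, hK⟩ := exists_isBounded (u := ⟨u, hu⟩) hpos
  exact ⟨⟨u, hu⟩, K, hK, hker⟩

instance {τ σ : F.Cone} (h : τ ⟶ σ) : IsOpenImmersion ((F.coxDiagram R B).map h) := by
  obtain ⟨u, K, H, hker⟩ := exists_isBounded_of_le h.le
  let := (coneRingMap R B h.le).toAlgebra
  have := isLocalization_faceElem R B H h.le hker
  exact IsOpenImmersion.of_isLocalization (S := F.coneRing R B τ) (faceElem R B H)

variable {F} in
theorem range_coxDiagram_map {τ σ : F.Cone} (h : τ ⟶ σ) {u : dualStructure N} {K : ℕ}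
    (H : IsBounded σ u K) (hker : ∀ x, x ∈ τ.1 ↔ x ∈ σ.1 ∧ u.1 x = 0) :
    Set.range ((F.coxDiagram R B).map h) =
      (PrimeSpectrum.basicOpen (faceElem R B H) : Set (PrimeSpectrum (F.coneRing R B σ))) := by
  let := (coneRingMap R B h.le).toAlgebra
  have := isLocalization_faceElem R B H h.le hker
  exact PrimeSpectrum.localization_away_comap_range (F.coneRing R B τ) (faceElem R B H)

variable {F} in
/-- The intersection of two cones of the fan. -/
def inter (σ τ : F.Cone) : F.Cone :=
  ⟨σ.1 ⊓ τ.1, F.face_mem σ.1 σ.2 _ (F.inf_isFace σ.1 σ.2 τ.1 τ.2).1⟩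

instance : (F.coxDiagram R B ⋙ Scheme.forget).IsLocallyDirected where
  cond {τ τ' σ} h h' x x' hxx' := by
    let κ := inter τ τ'
    have hκ : κ ≤ τ := (F.inf_isFace _ τ.2 _ τ'.2).1
    have hκ' : κ ≤ τ' := (F.inf_isFace _ τ.2 _ τ'.2).2
    have hκσ : κ ≤ σ := hκ.trans h.le
    have hxx : (F.coxDiagram R B).map h x = (F.coxDiagram R B).map h' x' := hxx'
    obtain ⟨u, K, H, hu⟩ := exists_isBounded_of_le h.le
    obtain ⟨u', K', H', hu'⟩ := exists_isBounded_of_le h'.le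
    have H'' : IsBounded σ (u + u') (K + K') := by
      refine ⟨fun y hy => add_nonneg (H.1 y hy) (H'.1 y hy), fun ρ => ?_⟩
      rw [map_add, Pi.add_apply]
      push_cast
      exact (abs_add_le _ _).trans (add_le_add (H.2 ρ) (H'.2 ρ))
    have hu'' : ∀ y, y ∈ κ.1 ↔ y ∈ σ.1 ∧ (u + u').1 y = 0 := by
      intro y
      have h1 : y ∈ κ.1 ↔ y ∈ τ.1 ∧ y ∈ τ'.1 := Iff.rfl
      rw [h1, hu, hu']
      have h2 : (u + u').1 y = u.1 y + u'.1 y := rfl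
      rw [h2]
      constructor
      · rintro ⟨⟨hy, h3⟩, -, h4⟩
        exact ⟨hy, by rw [h3, h4, add_zero]⟩
      · rintro ⟨hy, h3⟩
        have h4 := H.1 y hy
        have h5 := H'.1 y hy
        exact ⟨⟨hy, by linarith⟩, hy, by linarith⟩
    have hmem : (F.coxDiagram R B).map h x ∈ Set.range ((F.coxDiagram R B).map (homOfLE hκσ)) := by
      rw [range_coxDiagram_map R B (homOfLE hκσ) H'' hu'', faceElem_mul R B H H' H'',
        PrimeSpectrum.basicOpen_mul]
      refine ⟨?_, ?_⟩
      · have := Set.mem_range_self (f := (F.coxDiagram R B).map h) x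
        rwa [range_coxDiagram_map R B h H hu] at this
      · have := Set.mem_range_self (f := (F.coxDiagram R B).map h') x'
        rwa [range_coxDiagram_map R B h' H' hu', ← hxx] at this
    obtain ⟨y, hy⟩ := hmem
    refine ⟨κ, homOfLE hκ, homOfLE hκ', y, ?_, ?_⟩
    · apply ((F.coxDiagram R B).map h).injective
      change (F.coxDiagram R B).map h ((F.coxDiagram R B).map (homOfLE hκ) y) = _
      rw [← hy, ← Scheme.Hom.comp_apply, ← Functor.map_comp]
      rfl
    · apply ((F.coxDiagram R B).map h').injective
      change (F.coxDiagram R B).map h' ((F.coxDiagram R B).map (homOfLE hκ') y) = _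
      rw [← hxx, ← hy, ← Scheme.Hom.comp_apply, ← Functor.map_comp]
      rfl

/-- The Cox scheme `Y_Σ(R)`, the inductive limit of `(Y_σ(R))_σ`. -/
noncomputable def coxScheme : Scheme.{max u v} := Limits.colimit (F.coxDiagram R B)

/-- The open immersion `Y_σ(R) → Y_Σ(R)`. -/
noncomputable def coxι (σ : F.Cone) : Spec (CommRingCat.of (F.coneRing R B σ)) ⟶ F.coxScheme R B :=
  Limits.colimit.ι (F.coxDiagram R B) σ

instance (σ : F.Cone) : IsOpenImmersion (F.coxι R B σ) :=
  inferInstanceAs (IsOpenImmersion (Limits.colimit.ι (F.coxDiagram R B) σ))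

theorem map_coxι {τ σ : F.Cone} (h : τ ≤ σ) :
    Spec.map (CommRingCat.ofHom (coneRingMap R B h)) ≫ F.coxι R B σ = F.coxι R B τ :=
  Limits.colimit.w (F.coxDiagram R B) (homOfLE h)

end Fan
section GradedModules

variable {ι A σ : Type*} [CommRing A] [SetLike σ A] [AddSubgroupClass σ A] [AddCommMonoid ι]
  [DecidableEq ι]

/-- Graded modules over a graded ring. -/
structure GrMod (𝒜 : ι → σ) [GradedRing 𝒜] where
  carrier : Type w
  [addCommGroup : AddCommGroup carrier]
  [module : Module A carrier]
  piece : ι → AddSubgroup carrier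
  isInternal : DirectSum.IsInternal piece
  smul_mem : ∀ {i j : ι} {a : A} {x : carrier}, a ∈ 𝒜 i → x ∈ piece j → a • x ∈ piece (i + j)

namespace GrMod

variable {𝒜 : ι → σ} [GradedRing 𝒜]

attribute [instance] addCommGroup module

/-- Morphisms of graded modules: linear maps of degree `0`. -/
@[ext]
structure Hom (M M' : GrMod.{w} 𝒜) where
  toLinearMap : M.carrier →ₗ[A] M'.carrier
  map_mem : ∀ i, ∀ x ∈ M.piece i, toLinearMap x ∈ M'.piece i

instance : Category (GrMod.{w} 𝒜) where
  Hom := Hom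
  id M := ⟨LinearMap.id, fun _ _ hx => hx⟩
  comp f g := ⟨g.toLinearMap ∘ₗ f.toLinearMap, fun i x hx => g.map_mem i _ (f.map_mem i x hx)⟩

theorem id_toLinearMap (M : GrMod.{w} 𝒜) : Hom.toLinearMap (𝟙 M) = LinearMap.id := rfl

theorem comp_toLinearMap {M M' M'' : GrMod.{w} 𝒜} (f : M ⟶ M') (g : M' ⟶ M'') :
    Hom.toLinearMap (f ≫ g) = g.toLinearMap ∘ₗ f.toLinearMap := rfl

/-- The module of fractions `T⁻¹ M` is a module over the component of degree `0` of `T⁻¹ A`. -/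
noncomputable instance (M : GrMod.{w} 𝒜) (T : Submonoid A) :
    Module (HomogeneousLocalization 𝒜 T) (LocalizedModule T M.carrier) :=
  Module.compHom _ (algebraMap (HomogeneousLocalization 𝒜 T) (Localization T))

theorem smul_eq_val_smul (M : GrMod.{w} 𝒜) (T : Submonoid A) (z : HomogeneousLocalization 𝒜 T)
    (y : LocalizedModule T M.carrier) : z • y = z.val • y := rfl

/-- The component of degree `0` of the graded module of fractions `T⁻¹ M`, consisting of the
fractions `x / s` where `x` and `s` are homogeneous of the same degree. -/
noncomputable def degreeZero (M : GrMod.{w} 𝒜) (T : Submonoid A) :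
    Submodule (HomogeneousLocalization 𝒜 T) (LocalizedModule T M.carrier) where
  carrier := {y | ∃ i, ∃ x ∈ M.piece i, ∃ s : T, (s : A) ∈ 𝒜 i ∧ y = LocalizedModule.mk x s}
  zero_mem' := ⟨0, 0, zero_mem _, 1, SetLike.GradedOne.one_mem, by simp⟩
  add_mem' := by
    rintro _ _ ⟨i, x, hx, s, hs, rfl⟩ ⟨j, y, hy, t, ht, rfl⟩
    refine ⟨i + j, (t : A) • x + (s : A) • y, add_mem ?_ (M.smul_mem hs hy), s * t,
      SetLike.mul_mem_graded hs ht, LocalizedModule.mk_add_mk⟩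
    rw [add_comm i j]
    exact M.smul_mem ht hx
  smul_mem' := by
    rintro z _ ⟨i, x, hx, s, hs, rfl⟩
    obtain ⟨z, rfl⟩ := HomogeneousLocalization.mk_surjective z
    refine ⟨z.deg + i, (z.num : A) • x, M.smul_mem z.num.2 hx, ⟨z.den, z.den_mem⟩ * s,
      SetLike.mul_mem_graded z.den.2 hs, ?_⟩
    rw [smul_eq_val_smul, HomogeneousLocalization.val_mk, LocalizedModule.mk_smul_mk]

/-- A morphism of graded modules induces a morphism on components of degree `0` of modules of
fractions. -/
noncomputable def degreeZeroMap {M M' : GrMod.{w} 𝒜} (f : M ⟶ M') (T : Submonoid A) :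
    M.degreeZero T →ₗ[HomogeneousLocalization 𝒜 T] M'.degreeZero T where
  toFun y := ⟨LocalizedModule.map T f.toLinearMap y.1, by
    obtain ⟨_, i, x, hx, s, hs, rfl⟩ := y
    exact ⟨i, _, f.map_mem i x hx, s, hs, LocalizedModule.map_mk _ _ _ _⟩⟩
  map_add' x y := Subtype.ext (map_add _ _ _)
  map_smul' z y := Subtype.ext ((LocalizedModule.map T f.toLinearMap).map_smul z.val y.1)

/-- The functor taking a graded module `M` to the component of degree `0` of `T⁻¹ M`. -/
noncomputable def degreeZeroFunctor (𝒜 : ι → σ) [GradedRing 𝒜] (T : Submonoid A) :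
    GrMod.{w} 𝒜 ⥤ ModuleCat (HomogeneousLocalization 𝒜 T) where
  obj M := ModuleCat.of _ (M.degreeZero T)
  map f := ModuleCat.ofHom (degreeZeroMap f T)
  map_id M := by
    refine ModuleCat.hom_ext (LinearMap.ext fun y => Subtype.ext ?_)
    change LocalizedModule.map T LinearMap.id y.1 = y.1
    simp
  map_comp {M M' M''} f g := by
    refine ModuleCat.hom_ext (LinearMap.ext fun y => Subtype.ext ?_)
    change LocalizedModule.map T (g.toLinearMap ∘ₗ f.toLinearMap) y.1 =
      LocalizedModule.map T g.toLinearMap (LocalizedModule.map T f.toLinearMap y.1)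
    generalize y.1 = y
    induction y using LocalizedModule.induction_on with
    | h m s => simp

section Transition

variable {f g x : A}

/-- The canonical map `M_f → M_x` for `f ∣ x`. -/
noncomputable def locModMap (M : GrMod.{w} 𝒜) (h : f ∣ x) :
    LocalizedModule (Submonoid.powers f) M.carrier →ₗ[A]
      LocalizedModule (Submonoid.powers x) M.carrier :=
  LocalizedModule.lift (Submonoid.powers f)
    (LocalizedModule.mkLinearMap (Submonoid.powers x) M.carrier) (by
      rintro ⟨_, n, rfl⟩
      obtain ⟨g, rfl⟩ := h
      have h1 := IsLocalizedModule.map_units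
        (LocalizedModule.mkLinearMap (Submonoid.powers (f * g)) M.carrier)
        (⟨(f * g) ^ n, n, rfl⟩ : Submonoid.powers (f * g))
      have h2 : Commute (algebraMap A (Module.End A (LocalizedModule (Submonoid.powers (f * g))
          M.carrier)) (f ^ n)) (algebraMap A _ (g ^ n)) := Algebra.commutes _ _
      refine (h2.isUnit_mul_iff.1 ?_).1
      rwa [← map_mul, ← mul_pow])

theorem locModMap_mk (M : GrMod.{w} 𝒜) (hx : x = f * g) (m : M.carrier) (n : ℕ) :
    M.locModMap ⟨g, hx⟩ (LocalizedModule.mk m (⟨f ^ n, n, rfl⟩ : Submonoid.powers f)) =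
      LocalizedModule.mk (g ^ n • m) (⟨x ^ n, n, rfl⟩ : Submonoid.powers x) := by
  apply IsLocalizedModule.smul_injective
    (LocalizedModule.mkLinearMap (Submonoid.powers x) M.carrier)
    (⟨x ^ n, n, rfl⟩ : Submonoid.powers x)
  change x ^ n • M.locModMap ⟨g, hx⟩ _ =
    x ^ n • (LocalizedModule.mk (g ^ n • m) (⟨x ^ n, n, rfl⟩ : Submonoid.powers x))
  have h1 : x ^ n • (LocalizedModule.mk m (⟨f ^ n, n, rfl⟩ : Submonoid.powers f)) =
      LocalizedModule.mkLinearMap (Submonoid.powers f) M.carrier (g ^ n • m) := by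
    rw [LocalizedModule.smul'_mk, hx, mul_pow, mul_smul]
    exact LocalizedModule.mk_cancel (⟨f ^ n, n, rfl⟩ : Submonoid.powers f) (g ^ n • m)
  rw [← map_smul, h1, locModMap, ← LinearMap.comp_apply, LocalizedModule.lift_comp,
    LocalizedModule.smul'_mk]
  exact (LocalizedModule.mk_cancel (⟨x ^ n, n, rfl⟩ : Submonoid.powers x) (g ^ n • m)).symm

theorem locModMap_smul (M : GrMod.{w} 𝒜) (h : f ∣ x) (z : Localization.Away f)
    (y : LocalizedModule (Submonoid.powers f) M.carrier) :
    M.locModMap h (z • y) = locMap h z • M.locModMap h y := by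
  let : Module (Localization.Away f) (LocalizedModule (Submonoid.powers x) M.carrier) :=
    Module.compHom _ (locMap h)
  have : IsScalarTower A (Localization.Away f)
      (LocalizedModule (Submonoid.powers x) M.carrier) :=
    IsScalarTower.of_algebraMap_smul fun a y => by
      change locMap h (algebraMap A _ a) • y = a • y
      rw [locMap_algebraMap, algebraMap_smul]
  have := IsLocalization.linearMap_compatibleSMul (Submonoid.powers f) (Localization.Away f)
    (LocalizedModule (Submonoid.powers f) M.carrier)
    (LocalizedModule (Submonoid.powers x) M.carrier)
  exact LinearMap.CompatibleSMul.map_smul (M.locModMap h) z y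

theorem locModMap_naturality {M M' : GrMod.{w} 𝒜} (φ : M ⟶ M') (h : f ∣ x)
    (y : LocalizedModule (Submonoid.powers f) M.carrier) :
    M'.locModMap h (LocalizedModule.map _ φ.toLinearMap y) =
      LocalizedModule.map _ φ.toLinearMap (M.locModMap h y) := by
  obtain ⟨g, hx⟩ := id h
  induction y using LocalizedModule.induction_on with
  | h m s =>
    obtain ⟨_, n, rfl⟩ := s
    rw [LocalizedModule.map_mk]
    erw [M'.locModMap_mk hx, M.locModMap_mk hx]
    rw [LocalizedModule.map_mk, map_smul]

theorem locModMap_mem (M : GrMod.{w} 𝒜) {e : ι} (hg : g ∈ 𝒜 e) (hx : x = f * g)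
    {y : LocalizedModule (Submonoid.powers f) M.carrier}
    (hy : y ∈ M.degreeZero (Submonoid.powers f)) :
    M.locModMap ⟨g, hx⟩ y ∈ M.degreeZero (Submonoid.powers x) := by
  obtain ⟨i, m, hm, ⟨_, n, rfl⟩, hs, rfl⟩ := hy
  refine ⟨n • e + i, g ^ n • m, M.smul_mem (SetLike.pow_mem_graded n hg) hm,
    (⟨x ^ n, n, rfl⟩ : Submonoid.powers x), ?_, M.locModMap_mk hx m n⟩
  rw [add_comm, hx]
  simp only [mul_pow]
  exact SetLike.mul_mem_graded hs (SetLike.pow_mem_graded n hg)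

/-- The canonical map `M_(f) → M_(x)` for `x = f g`, semilinear over `A_(f) → A_(x)`, as a
morphism of functors. -/
noncomputable def degreeZeroTransition {e : ι} (hg : g ∈ 𝒜 e) (hx : x = f * g) :
    degreeZeroFunctor.{w} 𝒜 (Submonoid.powers f) ⟶
      degreeZeroFunctor.{w} 𝒜 (Submonoid.powers x) ⋙
        ModuleCat.restrictScalars (HomogeneousLocalization.awayMap 𝒜 hg hx) where
  app M := ModuleCat.ofHom
    (Y := (ModuleCat.restrictScalars (HomogeneousLocalization.awayMap 𝒜 hg hx)).obj
      (ModuleCat.of _ (M.degreeZero (Submonoid.powers x))))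
    { toFun := fun y => ⟨M.locModMap ⟨g, hx⟩ y.1, M.locModMap_mem hg hx y.2⟩
      map_add' := fun y z => Subtype.ext (map_add _ _ _)
      map_smul' := fun z y => Subtype.ext <| by
        change M.locModMap ⟨g, hx⟩ (z.val • y.1) =
          (HomogeneousLocalization.awayMap 𝒜 hg hx z).val • M.locModMap ⟨g, hx⟩ y.1
        rw [locModMap_smul, val_awayMap'] }
  naturality M M' φ := by
    refine ModuleCat.hom_ext (LinearMap.ext fun y => Subtype.ext ?_)
    exact locModMap_naturality φ ⟨g, hx⟩ y.1

end Transition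

end GrMod
end GradedModules
section Tilde

variable {R S : CommRingCat.{u}} (φ : R ⟶ S)

/-- Global sections of the direct image along `Spec S → Spec R` are obtained by scalar
restriction. -/
noncomputable def pushforwardΓIso :
    Scheme.Modules.pushforward (Spec.map φ) ⋙ moduleSpecΓFunctor (R := R) ≅
      moduleSpecΓFunctor (R := S) ⋙ ModuleCat.restrictScalars φ.hom :=
  Functor.isoWhiskerRight (pushforwardCompModulesSpecToSheafIso φ)
    (TopCat.Sheaf.forget _ _ ⋙ (evaluation _ _).obj (.op ⊤))

/-- The global sections of the direct image of the sheaf associated with an `S`-module `G` are the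
`R`-module `G`. -/
noncomputable def restrictScalarsIsoΓ :
    ModuleCat.restrictScalars φ.hom ≅
      (tilde.functor S ⋙ Scheme.Modules.pushforward (Spec.map φ)) ⋙ moduleSpecΓFunctor (R := R) :=
  (Functor.leftUnitor _).symm ≪≫
    Functor.isoWhiskerRight tilde.toTildeΓNatIso (ModuleCat.restrictScalars φ.hom) ≪≫
    Functor.associator _ _ _ ≪≫
    Functor.isoWhiskerLeft (tilde.functor S) (pushforwardΓIso φ).symm ≪≫
    (Functor.associator _ _ _).symm

/-- For an `S`-module `G`, the canonical morphism from the sheaf associated with the `R`-module `G`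
to the direct image of the sheaf associated with `G`; on global sections it is the identity of
`G`. -/
noncomputable def tildeRestrictScalars :
    ModuleCat.restrictScalars φ.hom ⋙ tilde.functor R ⟶
      tilde.functor S ⋙ Scheme.Modules.pushforward (Spec.map φ) :=
  Functor.whiskerRight (restrictScalarsIsoΓ φ).hom (tilde.functor R) ≫
    (Functor.associator _ _ _).hom ≫
    Functor.whiskerLeft _ Scheme.Modules.fromTildeΓNatTrans ≫ (Functor.rightUnitor _).hom
end Tilde

/-- The full subcategory of quasicoherent modules. -/
def isQuasicoherent (X : Scheme.{u}) : ObjectProperty X.Modules :=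
  fun M => SheafOfModules.IsQuasicoherent (R := X.ringCatSheaf) M

namespace Fan
variable {V : Type v} [AddCommGroup V] [Module ℝ V] {N : AddSubgroup V} (F : Fan N)
variable [FiniteDimensional ℝ V] [IsZStructure N] (R : Type u) [CommRing R] (B : AddSubgroup F.A)

/-- The functor taking a `B`-graded `S_B`-module `G` to `G_(σ)`, the component of degree `0` of the
module of fractions of `G` with denominators the powers of `Ẑ_σ ^ m`. -/
noncomputable def coneModule (σ : F.Cone) :
    GrMod.{max u v} (F.coxPiece R B) ⥤ ModuleCat.{max u v} (F.coneRing R B σ) :=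
  GrMod.degreeZeroFunctor (F.coxPiece R B) (Submonoid.powers (F.zPow R B σ))

variable {F} in
/-- The canonical morphism `G_(σ) → G_(τ)` for a face `τ` of `σ`. -/
noncomputable def coneModuleMap {τ σ : F.Cone} (h : τ ≤ σ) :
    F.coneModule R B σ ⟶ F.coneModule R B τ ⋙
      ModuleCat.restrictScalars (CommRingCat.ofHom (coneRingMap R B h)).hom :=
  GrMod.degreeZeroTransition (F.qPow_mem R B τ σ) (zPow_eq_mul R B h)

/-- The functor taking a `B`-graded `S_B`-module `G` to the `𝒪`-module on `Y_σ(R)` associated with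
`G_(σ)`. -/
noncomputable def coneSheaf (σ : F.Cone) :
    GrMod.{max u v} (F.coxPiece R B) ⥤
      (Spec (CommRingCat.of (F.coneRing R B σ))).Modules :=
  F.coneModule R B σ ⋙ tilde.functor (CommRingCat.of (F.coneRing R B σ))

variable {F} in
/-- For a face `τ` of `σ`, the canonical morphism from the module associated with `G_(σ)` to the
direct image of the module associated with `G_(τ)`. -/
noncomputable def coneSheafMap {τ σ : F.Cone} (h : τ ≤ σ) :
    F.coneSheaf R B σ ⟶
      F.coneSheaf R B τ ⋙ Scheme.Modules.pushforward
        (Spec.map (CommRingCat.ofHom (coneRingMap R B h))) :=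
  Functor.whiskerRight (coneModuleMap R B h) (tilde.functor (CommRingCat.of (F.coneRing R B σ))) ≫
    (Functor.associator _ _ _).hom ≫
    Functor.whiskerLeft _ (tildeRestrictScalars (CommRingCat.ofHom (coneRingMap R B h))) ≫
    (Functor.associator (F.coneModule R B τ) (tilde.functor (CommRingCat.of (F.coneRing R B τ))) _).inv

/-- The direct image on `Y_Σ(R)` of the module on `Y_σ(R)` associated with `G_(σ)`, as a functor
in `G`. -/
noncomputable def pushSheaf (σ : F.Cone) :
    GrMod.{max u v} (F.coxPiece R B) ⥤ (F.coxScheme R B).Modules :=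
  F.coneSheaf R B σ ⋙ Scheme.Modules.pushforward (F.coxι R B σ)

variable {F} in
/-- For a face `τ` of `σ`, the canonical morphism between direct images on `Y_Σ(R)`, given by
restricting sections from `Y_σ(R)` to `Y_τ(R)`. -/
noncomputable def pushSheafMap {τ σ : F.Cone} (h : τ ≤ σ) :
    F.pushSheaf R B σ ⟶ F.pushSheaf R B τ :=
  Functor.whiskerRight (coneSheafMap R B h) (Scheme.Modules.pushforward (F.coxι R B σ)) ≫
    (Functor.associator _ _ _).hom ≫
    Functor.whiskerLeft _ ((Scheme.Modules.pushforwardComp _ _).hom ≫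
      (Scheme.Modules.pushforwardCongr (F.map_coxι R B h)).hom)

/-- The functor `𝒮_B` taking a `B`-graded `S_B`-module `G` to the `𝒪`-module on `Y_Σ(R)` obtained by
glueing the modules on `Y_σ(R)` associated with `G_(σ)`: its sections are the families of sections
on all `Y_σ(R)` that are compatible with restriction to faces. -/
noncomputable def sheafFunctor :
    GrMod.{max u v} (F.coxPiece R B) ⥤ (F.coxScheme R B).Modules :=
  Limits.equalizer
    (Limits.Pi.lift fun p : {p : F.Cone × F.Cone // p.1 ≤ p.2} =>
      Limits.Pi.π (F.pushSheaf R B) p.1.2 ≫ pushSheafMap R B p.2)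
    (Limits.Pi.lift fun p : {p : F.Cone × F.Cone // p.1 ≤ p.2} =>
      Limits.Pi.π (F.pushSheaf R B) p.1.1)

end Fan

end CoxScheme

/-!
The sheaf `𝒮_B(G)` is the limit of the direct images of the sheaves associated with the modules
`G_(σ)` on the affine open subschemes `Y_σ(R)`. For a face `τ` of `σ` there is a monomial fraction
`r` in `S_(σ)` with `Y_τ(R) = D(r)`, and `G_(τ)` is the localization of `G_(σ)` at `r`
(`Fan.isLocalizedModule_coneModuleMap`). As the cones form a finite meet-semilattice, this is a
glueing datum, so the restriction of `𝒮_B(G)` to `Y_σ(R)` is the sheaf associated with `G_(σ)`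
(`IsGlueing.app_bijective`), and hence `𝒮_B(G)` is quasicoherent.

For essential surjectivity, let `Q` be quasicoherent and put `Q_σ = Γ(Y_σ(R), Q)`. The graded module
`T_σ = S_{Ẑ_σ^m} ⊗_{S_(σ)} Q_σ`, where `S_{Ẑ_σ^m}` stands for `(S_B)_{Ẑ_σ^m}`, has `Q_σ` as its
component of degree `0`, because `S_(σ)` is a direct summand of `S_{Ẑ_σ^m}` (`tensorDegreeZero`).
For a face `τ` of `σ` the module `T_τ` is the localization of `T_σ` at `Ẑ_τ^m`
(`tensorMap_localization`), so the `T_σ` define a quasicoherent sheaf on the union of the open sets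
`D(Ẑ_σ^m)` in the spectrum of `S_B`. Its module of global sections consists of the compatible
families in `∏ T_σ`, and its localization at `Ẑ_σ^m` is `T_σ`, as always for finite unions of
principal open sets (`LocSystem.families_exists_smul_eq_zero`, `LocSystem.families_exists_eq_smul`).
As finite limits preserve graduations, the compatible families form a graded module `F`
(`GradedSystem.grMod`) with `F_(σ) ≅ Q_σ` (`GradedSystem.degreeZeroMap_bijective`), compatibly with
the transition maps. As `Q` is glued from the sheaves associated with the `Q_σ` in the same way as
`𝒮_B(F)`, the two are isomorphic (`IsGlueing.nonempty_iso`).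
-/


namespace CoxScheme

open CategoryTheory AlgebraicGeometry DirectSum TopologicalSpace
open scoped TensorProduct

/-! ### Glueing modules over a finite meet-semilattice -/

section ModuleGlueing

variable {S : Type*} [CommRing S] {I : Type*} [SemilatticeInf I]

/-- A system of `S`-modules `T i` over a meet-semilattice in which, for `j ≤ i`, the module `T j` is
the localization of `T i` at the element `z j`. -/
structure LocSystem (S : Type*) [CommRing S] (I : Type*) [SemilatticeInf I] where
  /-- The elements that get inverted. -/
  z : I → S
  /-- The modules of the system. -/
  T : I → Type w
  [addCommGroup : ∀ i, AddCommGroup (T i)]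
  [module : ∀ i, Module S (T i)]
  /-- The transition maps. -/
  t : ∀ {j i : I}, j ≤ i → T i →ₗ[S] T j
  t_refl : ∀ i (x : T i), t (le_refl i) x = x
  t_comp : ∀ {k j i : I} (h : k ≤ j) (h' : j ≤ i) (x : T i), t h (t h' x) = t (h.trans h') x
  bij : ∀ i, Function.Bijective fun x : T i => z i • x
  exists_smul_eq_zero : ∀ {j i : I} (h : j ≤ i) (x : T i), t h x = 0 → ∃ n : ℕ, z j ^ n • x = 0
  exists_eq_smul : ∀ {j i : I} (h : j ≤ i) (y : T j), ∃ (n : ℕ) (x : T i), t h x = z j ^ n • y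
  dvd : ∀ {j i : I}, j ≤ i → z i ∣ z j
  /-- Where `z i` and `z j` are invertible, so is `z (i ⊓ j)`. -/
  inf_dvd : ∀ i j, z (i ⊓ j) ∣ z i * z j

namespace LocSystem

attribute [instance] addCommGroup module

variable (D : LocSystem.{w} S I)

/-- The module of compatible families of a system. -/
def families : Submodule S (∀ i, D.T i) where
  carrier := {x | ∀ ⦃j i : I⦄ (h : j ≤ i), D.t h (x i) = x j}
  zero_mem' := by simp
  add_mem' := by
    intro x y hx hy j i h
    simp [hx h, hy h]
  smul_mem' := by
    intro a x hx j i h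
    simp [hx h]

theorem pow_bij (i : I) (n : ℕ) : Function.Bijective fun x : D.T i => D.z i ^ n • x := by
  have : (fun x : D.T i => D.z i ^ n • x) = (fun x : D.T i => D.z i • x)^[n] := by
    induction n with
    | zero => ext x; simp
    | succ n ih => rw [Function.iterate_succ', ← ih]; ext x; simp [pow_succ', mul_smul]
  rw [this]
  exact (D.bij i).iterate n

/-- The element `z i` acts injectively on `T j` for `j ≤ i`, since it divides `z j`. -/
theorem pow_injective_of_le {j i : I} (h : j ≤ i) (n : ℕ) :
    Function.Injective fun x : D.T j => D.z i ^ n • x := by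
  obtain ⟨c, hc⟩ := D.dvd h
  intro x y hxy
  apply (D.pow_bij j n).1
  simp only at hxy ⊢
  rw [hc, mul_pow, mul_comm, mul_smul, mul_smul, hxy]

/-- The map `T k → T (i ⊓ k)` is a localization at `z i` and not only at `z (i ⊓ k)`: on `T k`,
where `z k` is invertible, `z (i ⊓ k)` divides `z i` up to a unit. -/
theorem exists_smul_eq_zero_of_inf (i : I) {k : I} (x : D.T k)
    (hx : D.t (inf_le_right : i ⊓ k ≤ k) x = 0) : ∃ n : ℕ, D.z i ^ n • x = 0 := by
  obtain ⟨n, hn⟩ := D.exists_smul_eq_zero _ x hx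
  obtain ⟨c, hc⟩ := D.inf_dvd i k
  refine ⟨n, (D.pow_bij k n).1 ?_⟩
  simp only
  rw [← mul_smul, ← mul_pow, mul_comm (D.z k), hc, mul_pow, mul_comm, mul_smul, hn, smul_zero,
    smul_zero]

theorem exists_map_inf_eq_smul (i : I) (k : I) (y : D.T (i ⊓ k)) :
    ∃ (n : ℕ) (x : D.T k), D.t (inf_le_right : i ⊓ k ≤ k) x = D.z i ^ n • y := by
  obtain ⟨n, x, hx⟩ := D.exists_eq_smul (inf_le_right : i ⊓ k ≤ k) y
  obtain ⟨c, hc⟩ := D.inf_dvd i k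
  obtain ⟨x', hx'⟩ := (D.pow_bij k n).2 (c ^ n • x)
  refine ⟨n, x', D.pow_injective_of_le (inf_le_right : i ⊓ k ≤ k) n ?_⟩
  simp only at hx' ⊢
  rw [← map_smul, hx', map_smul, hx, ← mul_smul, ← mul_smul, ← mul_pow, ← mul_pow, mul_comm c,
    ← hc, mul_comm]

variable [Finite I]

/-- A compatible family that vanishes at `i` is annihilated by a power of `z i`: it vanishes at `i ⊓
k` for each of the finitely many `k`. -/
theorem families_exists_smul_eq_zero (i : I) (x : D.families) (hx : x.1 i = 0) :
    ∃ n : ℕ, D.z i ^ n • x = 0 := by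
  have : ∀ k, ∃ n : ℕ, D.z i ^ n • x.1 k = 0 := fun k =>
    D.exists_smul_eq_zero_of_inf i _ <| by
      rw [x.2 inf_le_right, ← x.2 inf_le_left, hx, map_zero]
  choose n hn using this
  classical
  cases nonempty_fintype I
  refine ⟨∑ k, n k, Subtype.ext <| funext fun k => ?_⟩
  change D.z i ^ (∑ k, n k) • x.1 k = 0
  rw [← Finset.sum_erase_add _ _ (Finset.mem_univ k), pow_add, mul_smul, hn, smul_zero]

/-- Up to a power of `z i`, each element of `T i` extends to a compatible family. Together with the
previous lemma this says that the localization at `z i` of the module of compatible families is `T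
i`. -/
theorem families_exists_eq_smul (i : I) (y : D.T i) :
    ∃ (n : ℕ) (x : D.families), x.1 i = D.z i ^ n • y := by
  classical
  cases nonempty_fintype I
  obtain ⟨N, w, hw⟩ : ∃ (N : ℕ) (w : ∀ k, D.T k), ∀ k,
      D.t (inf_le_right : i ⊓ k ≤ k) (w k) =
        D.z i ^ N • D.t (inf_le_left : i ⊓ k ≤ i) y := by
    choose n w hw using fun k => D.exists_map_inf_eq_smul i k (D.t (inf_le_left : i ⊓ k ≤ i) y)
    refine ⟨∑ k, n k, fun k => D.z i ^ (∑ l ∈ Finset.univ.erase k, n l) • w k, fun k => ?_⟩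
    rw [map_smul, hw, ← mul_smul, ← pow_add, Finset.sum_erase_add _ _ (Finset.mem_univ k)]
  -- The families `w` are compatible up to a power of `z i`.
  have hδ : ∀ p : {p : I × I // p.1 ≤ p.2}, ∃ n : ℕ,
      D.z i ^ n • (D.t p.2 (w p.1.2) - w p.1.1) = 0 := by
    rintro ⟨⟨k', k⟩, h⟩
    refine D.exists_smul_eq_zero_of_inf i _ ?_
    rw [map_sub, hw, D.t_comp, sub_eq_zero,
      ← D.t_comp (inf_le_inf_left i h : i ⊓ k' ≤ i ⊓ k) inf_le_right, hw, map_smul, D.t_comp]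
  have := Fintype.ofFinite {p : I × I // p.1 ≤ p.2}
  choose m hm using hδ
  refine ⟨(∑ p, m p) + N, ⟨fun k => D.z i ^ (∑ p, m p) • w k, ?_⟩, ?_⟩
  · intro k' k h
    rw [map_smul, ← sub_eq_zero, ← smul_sub,
      ← Finset.sum_erase_add _ _ (Finset.mem_univ ⟨(k', k), h⟩), pow_add, mul_smul,
      hm ⟨(k', k), h⟩, smul_zero]
  · change D.z i ^ (∑ p, m p) • w i = _
    rw [pow_add, mul_smul]
    congr 1
    have h0 : D.t (inf_le_right : i ⊓ i ≤ i) (w i - D.z i ^ N • y) = 0 := by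
      rw [map_sub, hw, map_smul, sub_self]
    obtain ⟨n, hn⟩ := D.exists_smul_eq_zero_of_inf i _ h0
    rw [← sub_eq_zero]
    apply (D.pow_bij i n).1
    simp only
    rw [hn, smul_zero]

end LocSystem

end ModuleGlueing

/-! ### Morphisms between sheaves associated with modules -/

section TildeMaps

variable {R S : CommRingCat.{u}} (φ : R ⟶ S)

/-- The global section of the sheaf associated with `M` that is defined by an element of `M`. -/
noncomputable def tildeTop (M : ModuleCat.{u} R) : M →+ Γ(tilde M, ⊤) :=
  (tilde.toOpen M ⊤).hom.toAddMonoidHom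

/-- A morphism from the sheaf associated with `M` is determined by its effect on the global sections
defined by the elements of `M`. -/
theorem tilde_hom_ext {M : ModuleCat.{u} R} {Q : (Spec R).Modules} {f g : tilde M ⟶ Q}
    (h : ∀ m : M, f.app ⊤ (tildeTop M m) = g.app ⊤ (tildeTop M m)) : f = g := by
  apply (tilde.adjunction.homEquiv M Q).injective
  ext m
  exact h m

theorem tilde_map_app_tildeTop {M M' : ModuleCat.{u} R} (f : M ⟶ M') (m : M) :
    (tilde.map f).app ⊤ (tildeTop M m) = tildeTop M' (f m) :=
  congrArg (fun f => (ConcreteCategory.hom f) m) (tilde.toOpen_map_app f ⊤)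

theorem tildeRestrictScalars_app_eq (G : ModuleCat.{u} S) :
    (tildeRestrictScalars φ).app G =
      (tilde.adjunction.homEquiv _ _).symm ((restrictScalarsIsoΓ φ).hom.app G) := by
  rw [Adjunction.homEquiv_counit]
  simp [tildeRestrictScalars]
  rfl

theorem tildeRestrictScalars_app_tildeTop (G : ModuleCat.{u} S) (x : G) :
    ((tildeRestrictScalars φ).app G).app ⊤
      (tildeTop ((ModuleCat.restrictScalars φ.hom).obj G) x) = tildeTop G x := by
  have := congrArg (fun f => (ConcreteCategory.hom f) x)
    ((tilde.adjunction.homEquiv _ _).apply_symm_apply ((restrictScalarsIsoΓ φ).hom.app G))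
  rw [← tildeRestrictScalars_app_eq] at this
  exact this

variable {φ}

/-- The morphism from the sheaf associated with `M` to the direct image of the sheaf associated with
`M'` that is defined by a semilinear map `M → M'`. -/
noncomputable def semiTilde {M : ModuleCat.{u} R} {M' : ModuleCat.{u} S}
    (f : M ⟶ (ModuleCat.restrictScalars φ.hom).obj M') :
    tilde M ⟶ (Scheme.Modules.pushforward (Spec.map φ)).obj (tilde M') :=
  tilde.map f ≫ (tildeRestrictScalars φ).app M'

theorem semiTilde_app_tildeTop {M : ModuleCat.{u} R} {M' : ModuleCat.{u} S}
    (f : M ⟶ (ModuleCat.restrictScalars φ.hom).obj M') (m : M) :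
    (semiTilde f).app ⊤ (tildeTop M m) = tildeTop M' (f m) :=
  (congrArg (fun x => ((tildeRestrictScalars φ).app M').app ⊤ x) (tilde_map_app_tildeTop f m)).trans
    (tildeRestrictScalars_app_tildeTop φ M' (f m))

variable {X : Scheme.{u}} {ι : Spec R ⟶ X} {ι' : Spec S ⟶ X}

/-- The direct image along a composition, in terms of the direct images along its factors. -/
noncomputable def pushComp (h : Spec.map φ ≫ ι = ι') (Q : (Spec S).Modules) :
    (Scheme.Modules.pushforward ι).obj ((Scheme.Modules.pushforward (Spec.map φ)).obj Q) ≅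
      (Scheme.Modules.pushforward ι').obj Q :=
  (Scheme.Modules.pushforwardComp (Spec.map φ) ι).app Q ≪≫
    (Scheme.Modules.pushforwardCongr h).app Q

theorem pushComp_hom_app (h : Spec.map φ ≫ ι = ι') (Q : (Spec S).Modules) (W : X.Opens) :
    (pushComp h Q).hom.app W = Q.presheaf.map (eqToHom (h ▸ rfl)).op :=
  (Category.id_comp (((Scheme.Modules.pushforwardCongr h).hom.app Q).app W)).trans
    (Scheme.Modules.pushforwardCongr_hom_app_app h W)

theorem pushComp_hom_app_top (h : Spec.map φ ≫ ι = ι') (Q : (Spec S).Modules) :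
    (pushComp h Q).hom.app ⊤ = 𝟙 _ := by
  rw [pushComp_hom_app]
  exact Q.presheaf.map_id _

/-- The morphism on `X` from the direct image of the sheaf associated with `M` to the direct image
of the sheaf associated with `M'` that is defined by a semilinear map `M → M'`. -/
noncomputable def pushTilde (h : Spec.map φ ≫ ι = ι') {M : ModuleCat.{u} R} {M' : ModuleCat.{u} S}
    (f : M ⟶ (ModuleCat.restrictScalars φ.hom).obj M') :
    (Scheme.Modules.pushforward ι).obj (tilde M) ⟶
      (Scheme.Modules.pushforward ι').obj (tilde M') :=
  (Scheme.Modules.pushforward ι).map (semiTilde f) ≫ (pushComp h (tilde M')).hom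

theorem pushTilde_app_tildeTop (h : Spec.map φ ≫ ι = ι') {M : ModuleCat.{u} R}
    {M' : ModuleCat.{u} S} (f : M ⟶ (ModuleCat.restrictScalars φ.hom).obj M') (m : M) :
    (pushTilde h f).app ⊤ (tildeTop M m) = tildeTop M' (f m) := by
  rw [← semiTilde_app_tildeTop, pushTilde, Scheme.Modules.Hom.comp_app, pushComp_hom_app_top]
  rfl

/-- A morphism from the direct image of the sheaf associated with `M` to a sheaf supported on a
smaller open subscheme is determined by its effect on the global sections defined by `M`. -/
theorem pushforward_tilde_hom_ext [IsOpenImmersion ι] (h : Spec.map φ ≫ ι = ι')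
    {M : ModuleCat.{u} R} {Q : (Spec S).Modules}
    {f g : (Scheme.Modules.pushforward ι).obj (tilde M) ⟶ (Scheme.Modules.pushforward ι').obj Q}
    (H : ∀ m : M, f.app ⊤ (tildeTop M m) = g.app ⊤ (tildeTop M m)) : f = g := by
  obtain ⟨f', hf⟩ := (Scheme.Modules.pushforward ι).map_surjective (f ≫ (pushComp h Q).inv)
  obtain ⟨g', hg⟩ := (Scheme.Modules.pushforward ι).map_surjective (g ≫ (pushComp h Q).inv)
  have : f' = g' := by
    apply tilde_hom_ext
    intro m
    have h1 := congrArg (fun k => Scheme.Modules.Hom.app k ⊤) hf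
    have h2 := congrArg (fun k => Scheme.Modules.Hom.app k ⊤) hg
    have h3 : ∀ x, ((pushComp h Q).inv.app ⊤) (f.app ⊤ (tildeTop M m)) = x →
        ((pushComp h Q).inv.app ⊤) (g.app ⊤ (tildeTop M m)) = x := by
      rw [H]; exact fun _ h => h
    exact ((congrArg (fun k => k (tildeTop M m)) h2).trans
      (h3 _ (congrArg (fun k => k (tildeTop M m)) h1).symm)).symm
  rw [← cancel_mono (pushComp h Q).inv, ← hf, ← hg, this]

end TildeMaps

section TildeLocalization

variable {R S : CommRingCat.{u}} {φ : R ⟶ S}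

/-- A morphism of quasicoherent modules on an affine scheme is an isomorphism if it is bijective on
global sections. -/
theorem isIso_of_isIso_app_top {M N : (Spec R).Modules} [IsIso M.fromTildeΓ] [IsIso N.fromTildeΓ]
    (f : M ⟶ N) (h : Function.Bijective (f.app ⊤)) : IsIso f := by
  have h1 : IsIso (moduleSpecΓFunctor.map f) := by
    rw [ConcreteCategory.isIso_iff_bijective]
    exact h
  have h2 := Scheme.Modules.fromTildeΓNatTrans.naturality f
  have h3 : IsIso (Scheme.Modules.fromTildeΓNatTrans.app M) :=
    inferInstanceAs (IsIso M.fromTildeΓ)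
  have h4 : IsIso (Scheme.Modules.fromTildeΓNatTrans.app N) :=
    inferInstanceAs (IsIso N.fromTildeΓ)
  have h5 : IsIso ((tilde.functor R).map (moduleSpecΓFunctor.map f)) := inferInstance
  have h6 : f = inv (Scheme.Modules.fromTildeΓNatTrans.app M) ≫
      (moduleSpecΓFunctor ⋙ tilde.functor R).map f ≫ Scheme.Modules.fromTildeΓNatTrans.app N := by
    rw [IsIso.eq_inv_comp]; exact h2.symm
  rw [h6]
  have h7 : IsIso ((moduleSpecΓFunctor ⋙ tilde.functor R).map f) := h5
  infer_instance

theorem presheaf_map_bijective_of_eq {X : Scheme.{u}} (M : X.Modules) {U W : X.Opens}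
    (h : U ≤ W) (h' : U = W) : Function.Bijective (M.presheaf.map (homOfLE h).op) := by
  subst h'
  have : IsIso (M.presheaf.map (homOfLE h).op) := by
    rw [Subsingleton.elim (homOfLE h) (𝟙 U), op_id, CategoryTheory.Functor.map_id]
    infer_instance
  exact ConcreteCategory.bijective_of_isIso _

/-- If `M → M'` is the localization at `r`, then the sheaves associated with `M` and `M'` have the
same sections over `D(r)`. -/
theorem semiTilde_app_basicOpen_bijective {M : ModuleCat.{u} R} {M' : ModuleCat.{u} S}
    (f : M ⟶ (ModuleCat.restrictScalars φ.hom).obj M') (r : R)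
    (hr : Spec.map φ ⁻¹ᵁ (PrimeSpectrum.basicOpen r) = ⊤)
    (hf : IsLocalizedModule (.powers r) f.hom) :
    Function.Bijective ((semiTilde f).app (PrimeSpectrum.basicOpen r)) := by
  let Q := (Scheme.Modules.pushforward (Spec.map φ)).obj (tilde M')
  let f₂ := (modulesSpecToSheaf.map (semiTilde f)).hom.app (.op (PrimeSpectrum.basicOpen r))
  let res : (modulesSpecToSheaf.obj Q).obj.obj (.op ⊤) ⟶
      (modulesSpecToSheaf.obj Q).obj.obj (.op (PrimeSpectrum.basicOpen r)) :=
    (modulesSpecToSheaf.obj Q).obj.map (homOfLE le_top).op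
  let e : (ModuleCat.restrictScalars φ.hom).obj M' ⟶
      (modulesSpecToSheaf.obj Q).obj.obj (.op (PrimeSpectrum.basicOpen r)) :=
    (restrictScalarsIsoΓ φ).hom.app M' ≫ res
  have hres : Function.Bijective res :=
    presheaf_map_bijective_of_eq (tilde M')
      (U := Spec.map φ ⁻¹ᵁ (PrimeSpectrum.basicOpen r)) le_top hr
  have he : Function.Bijective e := by
    have : Function.Bijective ((restrictScalarsIsoΓ φ).hom.app M') :=
      ConcreteCategory.bijective_of_isIso _
    exact hres.comp this
  have key : tilde.toOpen M (PrimeSpectrum.basicOpen r) ≫ f₂ = f ≫ e := by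
    ext m
    have h1 : res ((semiTilde f).app ⊤ (tildeTop M m)) = res (tildeTop M' (f m)) :=
      congrArg res (semiTilde_app_tildeTop f m)
    refine Eq.trans ?_ h1
    have h2 := (modulesSpecToSheaf.map (semiTilde f)).hom.naturality
      (homOfLE (le_top : PrimeSpectrum.basicOpen r ≤ (⊤ : (Spec R).Opens))).op
    exact LinearMap.congr_fun (congrArg ModuleCat.Hom.hom h2) (tildeTop M m)
  have h2 : IsLocalizedModule (.powers r)
      (tilde.toOpen M (PrimeSpectrum.basicOpen r) ≫ f₂).hom := by
    rw [key]
    exact IsLocalizedModule.of_linearEquiv (.powers r) f.hom (LinearEquiv.ofBijective e.hom he)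
  have h3 : IsIso f₂ := ModuleCat.isIso_of_isLocalizedModule_comp
    (inferInstanceAs (IsLocalizedModule.Away r (tilde.toOpen M (PrimeSpectrum.basicOpen r)).hom)) h2
  exact ConcreteCategory.bijective_of_isIso f₂

variable [IsOpenImmersion (Spec.map φ)]

/-- If `M → M'` is the localization at `r`, then the restriction to `D(r)` of the sheaf associated
with `M` is the sheaf associated with `M'`. -/
theorem isIso_restrict_semiTilde {M : ModuleCat.{u} R} {M' : ModuleCat.{u} S}
    (f : M ⟶ (ModuleCat.restrictScalars φ.hom).obj M') (r : R)
    (hr : (Spec.map φ).opensRange = PrimeSpectrum.basicOpen r)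
    (hf : IsLocalizedModule (.powers r) f.hom) :
    IsIso ((Scheme.Modules.restrictFunctor (Spec.map φ)).map (semiTilde f)) := by
  have h1 : ((tilde M).restrict (Spec.map φ)).IsQuasicoherent :=
    Scheme.Modules.isQuasicoherent_restrictFunctor (Spec.map φ) (tilde M)
  let c := (Scheme.Modules.restrictFunctorAdjCounitIso (Spec.map φ)).app (tilde M')
  let ψ : (tilde M).restrict (Spec.map φ) ⟶ tilde M' :=
    (Scheme.Modules.restrictFunctor (Spec.map φ)).map (semiTilde f) ≫ c.hom
  have h2 : IsIso ψ := by
    have : IsIso ((tilde M).restrict (Spec.map φ)).fromTildeΓ := inferInstance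
    have : IsIso (tilde M').fromTildeΓ := inferInstance
    apply isIso_of_isIso_app_top
    have h3 : Function.Bijective (c.hom.app ⊤) := ConcreteCategory.bijective_of_isIso _
    refine h3.comp ?_
    change Function.Bijective ((semiTilde f).app (Spec.map φ ''ᵁ ⊤))
    rw [Scheme.Hom.image_top_eq_opensRange, hr]
    refine semiTilde_app_basicOpen_bijective f r ?_ hf
    rw [← hr]
    exact Scheme.Hom.preimage_opensRange _
  have h4 : (Scheme.Modules.restrictFunctor (Spec.map φ)).map (semiTilde f) = ψ ≫ c.inv := by
    simp [ψ]
  rw [h4]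
  infer_instance

theorem semiTilde_app_bijective {M : ModuleCat.{u} R} {M' : ModuleCat.{u} S}
    (f : M ⟶ (ModuleCat.restrictScalars φ.hom).obj M') (r : R)
    (hr : (Spec.map φ).opensRange = PrimeSpectrum.basicOpen r)
    (hf : IsLocalizedModule (.powers r) f.hom) {W : (Spec R).Opens}
    (hW : W ≤ (Spec.map φ).opensRange) :
    Function.Bijective ((semiTilde f).app W) := by
  have := isIso_restrict_semiTilde f r hr hf
  have h1 : Function.Bijective (((Scheme.Modules.restrictFunctor (Spec.map φ)).map
      (semiTilde f)).app (Spec.map φ ⁻¹ᵁ W)) := ConcreteCategory.bijective_of_isIso _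
  have h2 : Spec.map φ ''ᵁ (Spec.map φ ⁻¹ᵁ W) = W := by
    rw [Scheme.Hom.image_preimage_eq_opensRange_inf, inf_eq_right]
    exact hW
  change Function.Bijective ((semiTilde f).app (Spec.map φ ''ᵁ (Spec.map φ ⁻¹ᵁ W))) at h1
  rwa [h2] at h1

variable {X : Scheme.{u}} {ι : Spec R ⟶ X} {ι' : Spec S ⟶ X} [IsOpenImmersion ι]
  [IsOpenImmersion ι']

/-- If `M → M'` is the localization at `r`, then the direct images on `X` of the sheaves associated
with `M` and `M'` have the same sections over all open sets whose intersection with the larger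
affine open set lies in the smaller one. -/
theorem pushTilde_app_bijective (h : Spec.map φ ≫ ι = ι') {M : ModuleCat.{u} R}
    {M' : ModuleCat.{u} S} (f : M ⟶ (ModuleCat.restrictScalars φ.hom).obj M') (r : R)
    (hr : (Spec.map φ).opensRange = PrimeSpectrum.basicOpen r)
    (hf : IsLocalizedModule (.powers r) f.hom) {W : X.Opens}
    (hW : W ⊓ ι.opensRange ≤ ι'.opensRange) :
    Function.Bijective ((pushTilde h f).app W) := by
  have h1 : Function.Bijective ((pushComp h (tilde M')).hom.app W) :=
    ConcreteCategory.bijective_of_isIso _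
  refine h1.comp ?_
  refine semiTilde_app_bijective f r hr hf (W := ι ⁻¹ᵁ W) ?_
  subst h
  intro x hx
  obtain ⟨y, hy⟩ := hW ⟨hx, Set.mem_range_self x⟩
  exact ⟨y, ι.injective (by simpa using hy)⟩

end TildeLocalization

/-! ### Compatible families and equalizers of products -/

section Equalizer

universe w₁ w₂ w₃

variable {C : Type w₁} [Category.{w₂} C] {I K : Type v} {X : I → C} {s t : K → I}
  (m : ∀ k, X (s k) ⟶ X (t k)) [Limits.HasProduct X] [Limits.HasProduct fun k => X (t k)]
  [Limits.HasEqualizer (Limits.Pi.lift fun k => Limits.Pi.π X (s k) ≫ m k)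
    (Limits.Pi.lift fun k => Limits.Pi.π X (t k))]

/-- A limit-preserving functor with values in sets takes the equalizer that encodes compatibility of
families to the set of compatible families. -/
theorem existsUnique_equalizer (E : C ⥤ Type w₃)
    [Limits.PreservesLimitsOfShape (Discrete I) E] [Limits.PreservesLimitsOfShape (Discrete K) E]
    [Limits.PreservesLimitsOfShape Limits.WalkingParallelPair E] (x : ∀ i, E.obj (X i))
    (hx : ∀ k, E.map (m k) (x (s k)) = x (t k)) :
    ∃! z : E.obj (Limits.equalizer (Limits.Pi.lift fun k => Limits.Pi.π X (s k) ≫ m k)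
      (Limits.Pi.lift fun k => Limits.Pi.π X (t k))),
      ∀ i, E.map (Limits.equalizer.ι _ _ ≫ Limits.Pi.π X i) z = x i := by
  have hprod : ∀ {J : Type v} (X : J → C) [Limits.HasProduct X]
      [Limits.PreservesLimitsOfShape (Discrete J) E] (x : ∀ i, E.obj (X i)),
      ∃! y : E.obj (∏ᶜ X), ∀ i, E.map (Limits.Pi.π X i) y = x i := by
    intro J X _ _ x
    have h := (Limits.Types.isLimit_iff _).1
      ⟨Limits.isLimitOfPreserves E (Limits.productIsProduct X)⟩ (fun j => x j.as) (by
        rintro ⟨i⟩ ⟨j⟩ ⟨⟨h⟩⟩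
        simp only at h
        subst h
        exact congrArg (fun k => k (x i)) (E.map_id (X i)))
    obtain ⟨y, hy, hy'⟩ := h
    exact ⟨y, fun i => hy ⟨i⟩, fun y' h => hy' y' fun j => h j.as⟩
  have heq := (Limits.Types.type_equalizer_iff_unique _ _).1
    ⟨Limits.isLimitForkMapOfIsLimit E _ (Limits.equalizerIsEqualizer
      (Limits.Pi.lift fun k => Limits.Pi.π X (s k) ≫ m k)
      (Limits.Pi.lift fun k => Limits.Pi.π X (t k)))⟩
  obtain ⟨y, hy, hy'⟩ := hprod X x
  obtain ⟨z, hz, hz'⟩ := heq y (by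
    obtain ⟨_, _, h⟩ := hprod (fun k => X (t k)) fun k => x (t k)
    refine (h _ fun k => ?_).trans (h _ fun k => ?_).symm
    · rw [← ConcreteCategory.comp_apply, ← E.map_comp, Limits.Pi.lift_π, E.map_comp,
        ConcreteCategory.comp_apply, hy, hx]
    · rw [← ConcreteCategory.comp_apply, ← E.map_comp, Limits.Pi.lift_π, hy])
  refine ⟨z, fun i => ?_, fun z' h => hz' z' (hy' _ fun i => ?_)⟩
  · rw [E.map_comp, ConcreteCategory.comp_apply, hz, hy]
  · rw [← ConcreteCategory.comp_apply, ← E.map_comp, h]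

end Equalizer

section SheafSections
variable (X : Scheme.{u}) (W : X.Opens)

/-- Sections over an open set, as a functor to sets. -/
noncomputable def sectionsFunctor : X.Modules ⥤ Type u :=
  Scheme.Modules.toPresheaf X ⋙ (evaluation _ _).obj (.op W) ⋙ forget Ab

noncomputable instance : Limits.PreservesLimits (sectionsFunctor X W) := by
  have : Limits.PreservesLimits ((evaluation (TopologicalSpace.Opens X)ᵒᵖ Ab).obj (.op W)) :=
    inferInstance
  unfold sectionsFunctor
  infer_instance

end SheafSections

/-! ### Quasicoherence is local -/

section Quasicoherence

variable {X : Scheme.{u}}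

/-- A module is quasicoherent if its restrictions to the members of an open cover have
presentations. -/
theorem isQuasicoherent_of_presentation {I : Type v} (M : X.Modules) (U : I → X.Opens)
    (hU : ∀ x, ∃ i, x ∈ U i)
    (P : ∀ i, Nonempty ((M.restrict (U i).ι).Presentation)) : isQuasicoherent X M := by
  let q : SheafOfModules.QuasicoherentData.{v} (R := X.ringCatSheaf) M :=
    { I := I
      X := U
      coversTop := by
        rw [Opens.coversTop_iff]
        ext x
        simpa using hU x
      presentation := fun i => by
        let e := Scheme.Modules.overEquiv (U i)
        let N : SheafOfModules (X.ringCatSheaf.over (U i)) :=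
          (SheafOfModules.overFunctor X.ringCatSheaf (U i)).obj M
        let b : e.functor.obj N ≅ M.restrict (U i).ι :=
          (Scheme.Modules.overFunctorEquiv (U i)).app M
        let a : e.inverse.obj (M.restrict (U i).ι) ≅ N :=
          e.inverse.mapIso b.symm ≪≫ (e.unitIso.app N).symm
        let E : SheafOfModules (U i).toScheme.ringCatSheaf ⥤
          SheafOfModules (X.ringCatSheaf.over (U i)) := e.inverse
        have : Limits.PreservesColimitsOfSize.{u, u} E :=
          e.symm.toAdjunction.leftAdjoint_preservesColimits
        exact SheafOfModules.Presentation.ofIsIso a.hom ((P i).some.map E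
          (TopologicalSpace.Opens.sheafOfModulesEquivOverInverseUnit (U i) X.ringCatSheaf).symm) }
  exact q.isQuasicoherent

/-- A module whose restrictions to the members of an affine open cover are associated with modules
is quasicoherent. -/
theorem isQuasicoherent_of_isIso_restrict {I : Type v} {A : I → CommRingCat.{u}}
    (ι : ∀ i, Spec (A i) ⟶ X) [∀ i, IsOpenImmersion (ι i)]
    (hU : ∀ x, ∃ i, x ∈ (ι i).opensRange) (M : X.Modules) (Q : ∀ i, ModuleCat.{u} (A i))
    (e : ∀ i, M.restrict (ι i) ≅ tilde (Q i)) : isQuasicoherent X M := by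
  refine isQuasicoherent_of_presentation M (fun i => (ι i).opensRange) hU fun i => ?_
  let P : (tilde (Q i)).Presentation :=
    presentationTilde (Q i) Set.univ (by simp) _ (Submodule.span_eq _)
  let P' : (M.restrict (ι i)).Presentation :=
    have : IsIso (C := SheafOfModules (Spec (A i)).ringCatSheaf) (e i).inv :=
      inferInstanceAs (IsIso (e i).inv)
    SheafOfModules.Presentation.ofIsIso (e i).inv P
  let g := (ι i).isoOpensRange.inv
  let a : (M.restrict (ι i)).restrict g ≅ M.restrict (ι i).opensRange.ι :=
    (Scheme.Modules.restrictFunctorComp g (ι i)).symm.app M ≪≫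
      (Scheme.Modules.restrictFunctorCongr (by simp [g])).app M
  have : IsIso (C := SheafOfModules (ι i).opensRange.toScheme.ringCatSheaf) a.hom :=
    inferInstanceAs (IsIso a.hom)
  exact ⟨SheafOfModules.Presentation.ofIsIso a.hom (Scheme.Modules.presentationRestrict g P')⟩

end Quasicoherence

/-! ### Affine covers closed under intersections -/

/-- A morphism of modules is an isomorphism if it is bijective on the sections over all open sets
contained in a member of a given open cover. -/
theorem isIso_of_bijective_app_of_cover {X : Scheme.{u}} {I : Type v} (U : I → X.Opens)
    (hU : ∀ x, ∃ i, x ∈ U i) {M M' : X.Modules} (f : M ⟶ M')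
    (h : ∀ i, ∀ W ≤ U i, Function.Bijective (f.app W)) : IsIso f := by
  let Fs : TopCat.Sheaf Ab X := ⟨M.presheaf, M.isSheaf⟩
  let Fs' : TopCat.Sheaf Ab X := ⟨M'.presheaf, M'.isSheaf⟩
  let φ : Fs ⟶ Fs' := ⟨f.mapPresheaf⟩
  have hB : Opens.IsBasis (Set.range fun W : {W : X.Opens // ∃ i, W ≤ U i} => W.1) := by
    rw [Opens.isBasis_iff_nbhd]
    intro W x hx
    obtain ⟨i, hi⟩ := hU x
    exact ⟨W ⊓ U i, ⟨⟨W ⊓ U i, i, inf_le_right⟩, rfl⟩, ⟨hx, hi⟩, inf_le_left⟩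
  have h1 : IsIso φ := TopCat.Sheaf.isIso_iff_isIso_basis hB fun W => by
    obtain ⟨W, i, hW⟩ := W
    exact (ConcreteCategory.isIso_iff_bijective (f.app W)).2 (h i W hW)
  have h2 : IsIso ((Scheme.Modules.toPresheaf X).map f) :=
    inferInstanceAs (IsIso ((TopCat.Sheaf.forget Ab X).map φ))
  exact isIso_of_reflects_iso f (Scheme.Modules.toPresheaf X)

/-- An affine open cover of a scheme, indexed by a meet-semilattice in such a way that meets
correspond to intersections and each smaller member is a basic open set of the larger one. -/
structure AffineSystem (X : Scheme.{u}) (I : Type v) [SemilatticeInf I] where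
  /-- The coordinate rings. -/
  A : I → CommRingCat.{u}
  /-- The open immersions. -/
  ι : ∀ i, Spec (A i) ⟶ X
  [isOpenImmersion : ∀ i, IsOpenImmersion (ι i)]
  /-- The restriction maps between coordinate rings. -/
  φ : ∀ {j i : I}, j ≤ i → (A i ⟶ A j)
  comp_eq : ∀ {j i : I} (h : j ≤ i), Spec.map (φ h) ≫ ι i = ι j
  exists_mem : ∀ x, ∃ i, x ∈ (ι i).opensRange
  inf_le : ∀ i j, (ι i).opensRange ⊓ (ι j).opensRange ≤ (ι (i ⊓ j)).opensRange
  /-- The functions that cut out the smaller members. -/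
  r : ∀ {j i : I}, j ≤ i → A i
  range_eq : ∀ {j i : I} (h : j ≤ i),
    Set.range (Spec.map (φ h)) = (PrimeSpectrum.basicOpen (r h) : Set (PrimeSpectrum (A i)))

namespace AffineSystem

attribute [instance] isOpenImmersion

variable {X : Scheme.{u}} {I : Type v} [SemilatticeInf I] (Y : AffineSystem X I)

instance {j i : I} (h : j ≤ i) : IsOpenImmersion (Spec.map (Y.φ h)) := by
  have : IsOpenImmersion (Spec.map (Y.φ h) ≫ Y.ι i) := by
    rw [Y.comp_eq]; infer_instance
  exact IsOpenImmersion.of_comp _ (Y.ι i)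

theorem opensRange_eq {j i : I} (h : j ≤ i) :
    (Spec.map (Y.φ h)).opensRange = PrimeSpectrum.basicOpen (Y.r h) :=
  Opens.ext (Y.range_eq h)

/-- Compatible modules over the members of an affine cover: restriction to a smaller member is
localization. -/
structure ModuleSystem where
  /-- The modules. -/
  M : ∀ i, ModuleCat.{u} (Y.A i)
  /-- The restriction maps. -/
  f : ∀ {j i : I} (h : j ≤ i), M i ⟶ (ModuleCat.restrictScalars (Y.φ h).hom).obj (M j)
  f_refl : ∀ i (m : M i), f (le_refl i) m = m
  f_comp : ∀ {k j i : I} (h : k ≤ j) (h' : j ≤ i) (m : M i),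
    f h (show M j from f h' m) = f (h.trans h') m
  isLocalizedModule : ∀ {j i : I} (h : j ≤ i), IsLocalizedModule (.powers (Y.r h)) (f h).hom

namespace ModuleSystem

variable {Y} (D : Y.ModuleSystem)

/-- The direct image of the sheaf on a member of the cover. -/
noncomputable abbrev P (i : I) : X.Modules :=
  (Scheme.Modules.pushforward (Y.ι i)).obj (tilde (D.M i))

/-- The restriction morphisms between direct images. -/
noncomputable def p {j i : I} (h : j ≤ i) : D.P i ⟶ D.P j := pushTilde (Y.comp_eq h) (D.f h)

theorem p_comp {k j i : I} (h : k ≤ j) (h' : j ≤ i) : D.p h' ≫ D.p h = D.p (h.trans h') := by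
  apply pushforward_tilde_hom_ext (Y.comp_eq (h.trans h'))
  intro m
  refine (congrArg ((D.p h).app ⊤)
    (pushTilde_app_tildeTop (Y.comp_eq h') (D.f h') m)).trans ?_
  refine (pushTilde_app_tildeTop (Y.comp_eq h) (D.f h) (D.f h' m)).trans ?_
  refine Eq.trans ?_ (pushTilde_app_tildeTop (Y.comp_eq (h.trans h')) (D.f (h.trans h')) m).symm
  exact congrArg (tildeTop (D.M k)) (D.f_comp h h' m)

/-- Over open sets meeting the larger member of the cover inside the smaller one, the restriction
morphism does not lose anything. -/
theorem p_app_bijective {j i : I} (h : j ≤ i) {W : X.Opens}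
    (hW : W ⊓ (Y.ι i).opensRange ≤ (Y.ι j).opensRange) :
    Function.Bijective ((D.p h).app W) :=
  pushTilde_app_bijective (Y.comp_eq h) (D.f h) (Y.r h) (Y.opensRange_eq h)
    (D.isLocalizedModule h) hW

/-- A limit of the direct images of the sheaves on the members of the cover, described by its
sections and by the morphisms into it. -/
structure IsGlueing (Z : X.Modules) (π : ∀ i, Z ⟶ D.P i) : Prop where
  π_p : ∀ {j i : I} (h : j ≤ i), π i ≫ D.p h = π j
  sections : ∀ (W : X.Opens) (x : ∀ i, Γ(D.P i, W)),
    (∀ {j i : I} (h : j ≤ i), (D.p h).app W (x i) = x j) → ∃! z : Γ(Z, W), ∀ i, (π i).app W z = x i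
  homs : ∀ (Q : X.Modules) (θ : ∀ i, Q ⟶ D.P i), (∀ {j i : I} (h : j ≤ i), θ i ≫ D.p h = θ j) →
    ∃ t : Q ⟶ Z, ∀ i, t ≫ π i = θ i

variable {D} {Z : X.Modules} {π : ∀ i, Z ⟶ D.P i}

/-- Over an open subset of `Y_i`, sections of the glueing are sections of the given sheaf on `Y_i`:
a section at `i` determines those at all `i ⊓ k`, and over this open set sections at `i ⊓ k` and at
`k` are the same. -/
theorem IsGlueing.app_bijective (hZ : D.IsGlueing Z π) {i : I} {W : X.Opens}
    (hW : W ≤ (Y.ι i).opensRange) :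
    Function.Bijective ((π i).app W) := by
  have hb : ∀ k, Function.Bijective ((D.p (inf_le_right : i ⊓ k ≤ k)).app W) := fun k =>
    D.p_app_bijective _ ((inf_le_inf_right _ hW).trans (Y.inf_le i k))
  have hπ : ∀ {j k : I} (h : j ≤ k) (z : Γ(Z, W)), (D.p h).app W ((π k).app W z) = (π j).app W z :=
    fun h z => congrArg (fun t => (Scheme.Modules.Hom.app t W) z) (hZ.π_p h)
  have hc : ∀ {k j l : I} (h : k ≤ j) (h' : j ≤ l) (x : Γ(D.P l, W)),
      (D.p h).app W ((D.p h').app W x) = (D.p (h.trans h')).app W x :=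
    fun h h' x => congrArg (fun t => (Scheme.Modules.Hom.app t W) x) (D.p_comp h h')
  constructor
  · intro z z' hzz
    obtain ⟨_, _, h⟩ := hZ.sections W (fun k => (π k).app W z) fun h => hπ h z
    refine (h z fun _ => rfl).trans (h z' fun k => (hb k).1 ?_).symm
    rw [hπ, hπ, ← hπ inf_le_left z, ← hπ inf_le_left z', hzz]
  · intro y
    choose x hx using fun k => (hb k).2 ((D.p (inf_le_left : i ⊓ k ≤ i)).app W y)
    obtain ⟨z, hz, -⟩ := hZ.sections W x fun {j k} h => by
      apply (hb j).1
      rw [hc, hx, ← hc (inf_le_inf_left i h : i ⊓ j ≤ i ⊓ k) inf_le_right, hx, hc]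
    refine ⟨z, (hz i).trans ((hb i).1 ?_)⟩
    rw [hx]

/-- The glueing restricts to the given sheaves on the members of the cover. -/
theorem IsGlueing.isIso_restrict (hZ : D.IsGlueing Z π) (i : I) :
    IsIso ((Scheme.Modules.restrictFunctor (Y.ι i)).map (π i)) := by
  rw [Scheme.Modules.Hom.isIso_iff_isIso_app]
  intro W
  rw [ConcreteCategory.isIso_iff_bijective]
  exact hZ.app_bijective (W := Y.ι i ''ᵁ W) (Scheme.Hom.image_le_opensRange _ _)

theorem IsGlueing.isQuasicoherent (hZ : D.IsGlueing Z π) : isQuasicoherent X Z :=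
  isQuasicoherent_of_isIso_restrict Y.ι Y.exists_mem Z D.M fun i =>
    have := hZ.isIso_restrict i
    asIso ((Scheme.Modules.restrictFunctor (Y.ι i)).map (π i)) ≪≫
      (Scheme.Modules.restrictFunctorAdjCounitIso (Y.ι i)).app (tilde (D.M i))

end ModuleSystem

end AffineSystem

/-! ### Quasicoherent modules on affine covers closed under intersections -/

section Restriction

variable {X : Scheme.{u}} {R S : CommRingCat.{u}} {φ : R ⟶ S} {ι : Spec R ⟶ X} {ι' : Spec S ⟶ X}
  [IsOpenImmersion ι] [IsOpenImmersion ι'] [IsOpenImmersion (Spec.map φ)]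

/-- The restriction of sections from an affine open set to a smaller one. -/
noncomputable def restrictMap (h : Spec.map φ ≫ ι = ι') (Q : X.Modules) :
    Q.restrict ι ⟶ (Scheme.Modules.pushforward (Spec.map φ)).obj (Q.restrict ι') :=
  (Scheme.Modules.restrictAdjunction (Spec.map φ)).unit.app (Q.restrict ι) ≫
    (Scheme.Modules.pushforward (Spec.map φ)).map
      ((Scheme.Modules.restrictFunctorComp (Spec.map φ) ι).inv.app Q ≫
        (Scheme.Modules.restrictFunctorCongr h).hom.app Q)

theorem image_preimage_le (h : Spec.map φ ≫ ι = ι') (W : (Spec R).Opens) :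
    ι' ''ᵁ (Spec.map φ ⁻¹ᵁ W) ≤ ι ''ᵁ W := by
  subst h
  rw [Scheme.Hom.comp_image]
  exact Scheme.Hom.image_mono _ (Scheme.Hom.image_preimage_le _ _)

theorem restrictMap_app (h : Spec.map φ ≫ ι = ι') (Q : X.Modules) (W : (Spec R).Opens) :
    (restrictMap h Q).app W = Q.presheaf.map (homOfLE (image_preimage_le h W)).op := by
  have h1 : ∀ {U₁ U₂ U₃ U₄ : X.Opens} (a : U₂ ⟶ U₁) (b : U₃ ⟶ U₂) (c : U₄ ⟶ U₃) (d : U₄ ⟶ U₁),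
      Q.presheaf.map a.op ≫ Q.presheaf.map b.op ≫ Q.presheaf.map c.op = Q.presheaf.map d.op := by
    intro U₁ U₂ U₃ U₄ a b c d
    rw [← Functor.map_comp, ← Functor.map_comp, ← op_comp, ← op_comp]
    rfl
  exact h1 _ _ _ _

/-- The direct images on `X` of the restrictions of a module to an affine open set and to a smaller
one. -/
noncomputable def pushRestrictMap (h : Spec.map φ ≫ ι = ι') (Q : X.Modules) :
    (Scheme.Modules.pushforward ι).obj (Q.restrict ι) ⟶
      (Scheme.Modules.pushforward ι').obj (Q.restrict ι') :=
  (Scheme.Modules.pushforward ι).map (restrictMap h Q) ≫ (pushComp h (Q.restrict ι')).hom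

theorem pushRestrictMap_app_le (h : Spec.map φ ≫ ι = ι') (W : X.Opens) :
    ι' ''ᵁ ι' ⁻¹ᵁ W ≤ ι ''ᵁ ι ⁻¹ᵁ W := by
  subst h
  exact image_preimage_le rfl (ι ⁻¹ᵁ W)

theorem presheaf_map_map (Q : X.Modules) {U₁ U₂ U₃ : X.Opens} (a : U₂ ⟶ U₁) (b : U₃ ⟶ U₂)
    (c : U₃ ⟶ U₁) : Q.presheaf.map a.op ≫ Q.presheaf.map b.op = Q.presheaf.map c.op := by
  rw [← Functor.map_comp, ← op_comp]
  rfl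

theorem pushRestrictMap_app (h : Spec.map φ ≫ ι = ι') (Q : X.Modules) (W : X.Opens) :
    (pushRestrictMap h Q).app W = Q.presheaf.map (homOfLE (pushRestrictMap_app_le h W)).op := by
  refine Eq.trans ?_ ((congrArg (fun k => k ≫ (Q.restrict ι').presheaf.map
    (eqToHom (by subst h; rfl)).op) (restrictMap_app h Q (ι ⁻¹ᵁ W))).trans ?_)
  · exact congrArg (fun k => (restrictMap h Q).app (ι ⁻¹ᵁ W) ≫ k)
      (pushComp_hom_app h (Q.restrict ι') W)
  · exact presheaf_map_map Q _ _ _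

theorem unit_pushRestrictMap (h : Spec.map φ ≫ ι = ι') (Q : X.Modules) :
    (Scheme.Modules.restrictAdjunction ι).unit.app Q ≫ pushRestrictMap h Q =
      (Scheme.Modules.restrictAdjunction ι').unit.app Q := by
  ext W : 1
  refine (congrArg (fun k => ((Scheme.Modules.restrictAdjunction ι).unit.app Q).app W ≫ k)
    (pushRestrictMap_app h Q W)).trans ?_
  exact presheaf_map_map Q (homOfLE (ι.image_preimage_le W)) _ (homOfLE (ι'.image_preimage_le W))

/-- The sections of a module on an affine open set. -/
noncomputable def affineSections (ι : Spec R ⟶ X) [IsOpenImmersion ι] (Q : X.Modules) :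
    ModuleCat.{u} R :=
  moduleSpecΓFunctor.obj (Q.restrict ι)

/-- Restriction of sections of a module to a smaller affine open set, as a semilinear map. -/
noncomputable def affineSectionsMap (h : Spec.map φ ≫ ι = ι') (Q : X.Modules) :
    affineSections ι Q ⟶ (ModuleCat.restrictScalars φ.hom).obj (affineSections ι' Q) :=
  moduleSpecΓFunctor.map (restrictMap h Q) ≫ (pushforwardΓIso φ).hom.app (Q.restrict ι')

theorem affineSectionsMap_apply (h : Spec.map φ ≫ ι = ι') (Q : X.Modules)
    (x : Γ(Q, ι ''ᵁ ⊤)) :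
    affineSectionsMap h Q x =
      (Q.presheaf.map (homOfLE (image_preimage_le h ⊤)).op x : Γ(Q, ι' ''ᵁ ⊤)) := by
  rw [← restrictMap_app h]
  rfl

theorem affineSectionsMap_refl {φ : R ⟶ R} [IsOpenImmersion (Spec.map φ)]
    (h : Spec.map φ ≫ ι = ι) (Q : X.Modules) (x : affineSections ι Q) :
    (affineSectionsMap h Q).hom x = x :=
  (affineSectionsMap_apply h Q x).trans
    (congrArg (fun k : Γ(Q, ι ''ᵁ ⊤) ⟶ Γ(Q, ι ''ᵁ ⊤) => k x)
      (Q.presheaf.map_id (.op (ι ''ᵁ ⊤))))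

theorem affineSectionsMap_comp {S' : CommRingCat.{u}} {φ' : S ⟶ S'} {φ'' : R ⟶ S'}
    {ι'' : Spec S' ⟶ X} [IsOpenImmersion ι''] [IsOpenImmersion (Spec.map φ')]
    [IsOpenImmersion (Spec.map φ'')] (h : Spec.map φ ≫ ι = ι') (h' : Spec.map φ' ≫ ι' = ι'')
    (h'' : Spec.map φ'' ≫ ι = ι'') (Q : X.Modules) (x : affineSections ι Q) :
    (affineSectionsMap h' Q).hom ((affineSectionsMap h Q).hom x) =
      (affineSectionsMap h'' Q).hom x := by
  refine (congrArg (affineSectionsMap h' Q).hom (affineSectionsMap_apply h Q x)).trans ?_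
  refine (affineSectionsMap_apply h' Q _).trans ?_
  refine Eq.trans ?_ (affineSectionsMap_apply h'' Q x).symm
  exact congrArg (fun k : Γ(Q, ι ''ᵁ ⊤) ⟶ Γ(Q, ι'' ''ᵁ ⊤) => k x) (presheaf_map_map Q
    (homOfLE (image_preimage_le h ⊤)) (homOfLE (image_preimage_le h' ⊤)) _)

/-- The restriction of sections of a quasicoherent module to a basic open subset of an affine open
set is a localization. -/
theorem isLocalizedModule_affineSectionsMap (h : Spec.map φ ≫ ι = ι') (Q : X.Modules)
    (hQ : isQuasicoherent X Q) (r : R)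
    (hr : (Spec.map φ).opensRange = PrimeSpectrum.basicOpen r) :
    IsLocalizedModule (.powers r) (affineSectionsMap h Q).hom := by
  let G := Q.restrict ι
  let G' := Q.restrict ι'
  let D : (Spec R).Opens := PrimeSpectrum.basicOpen r
  have hq : (Q.restrict ι).IsQuasicoherent := by
    have : SheafOfModules.IsQuasicoherent (R := X.ringCatSheaf) Q := hQ
    exact Scheme.Modules.isQuasicoherent_restrictFunctor ι Q
  have h1 : IsLocalizing (modulesSpecToSheaf.obj G) :=
    (isIso_fromTildeΓ_iff_isLocalizing G).1 inferInstance
  have h2 : IsLocalizedModule (.powers r) ((modulesSpecToSheaf.obj G).obj.map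
    (homOfLE (le_top : D ≤ ⊤)).op).hom := h1 r
  let a := (modulesSpecToSheaf.map (restrictMap h Q)).hom.app (.op D)
  let e := (pushforwardΓIso φ).inv.app G'
  let res := (modulesSpecToSheaf.obj ((Scheme.Modules.pushforward (Spec.map φ)).obj G')).obj.map
    (homOfLE (le_top : D ≤ ⊤)).op
  have he : Function.Bijective e := ConcreteCategory.bijective_of_isIso _
  have hres : Function.Bijective res :=
    presheaf_map_bijective_of_eq G' (U := Spec.map φ ⁻¹ᵁ D) le_top (by
      have hD : (Spec.map φ).opensRange = D := hr
      rw [← hD]; exact Scheme.Hom.preimage_opensRange _)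
  have ha : Function.Bijective a := by
    have h3 : Function.Bijective ((restrictMap h Q).app D) := by
      rw [restrictMap_app]
      refine presheaf_map_bijective_of_eq Q _ ?_
      subst h
      have hD : (Spec.map φ).opensRange = D := hr
      rw [Scheme.Hom.comp_image, Scheme.Hom.image_preimage_eq_opensRange_inf, hD, inf_idem]
    exact h3
  have key : (modulesSpecToSheaf.obj G).obj.map (homOfLE (le_top : D ≤ ⊤)).op ≫ a =
      affineSectionsMap h Q ≫ e ≫ res := by
    have h4 := (modulesSpecToSheaf.map (restrictMap h Q)).hom.naturality
      (homOfLE (le_top : D ≤ ⊤)).op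
    refine h4.trans ?_
    rfl
  have h5 : IsLocalizedModule (.powers r) ((modulesSpecToSheaf.obj G).obj.map
      (homOfLE (le_top : D ≤ ⊤)).op ≫ a).hom :=
    IsLocalizedModule.of_linearEquiv (.powers r) _ (LinearEquiv.ofBijective a.hom ha)
  rw [key] at h5
  have h6 : Function.Bijective (e ≫ res).hom := hres.comp he
  exact (IsLocalizedModule.comp_iff_of_bijective_left _ _ h6).1 h5

/-- The sheaf associated with the sections of a module on an affine open set, compared with the
module itself. -/
noncomputable def fromTildeSections (ι : Spec R ⟶ X) [IsOpenImmersion ι] (Q : X.Modules) :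
    tilde (affineSections ι Q) ⟶ Q.restrict ι :=
  (Q.restrict ι).fromTildeΓ

theorem fromTildeSections_app (ι : Spec R ⟶ X) [IsOpenImmersion ι] (Q : X.Modules)
    (x : affineSections ι Q) :
    (fromTildeSections ι Q).app ⊤ (tildeTop (affineSections ι Q) x) = x := by
  have h := Scheme.Modules.toOpen_fromTildeΓ_app (Q.restrict ι) ⊤
  refine (LinearMap.congr_fun (congrArg ModuleCat.Hom.hom h) x).trans ?_
  exact congrArg (fun k => (ModuleCat.Hom.hom k) x)
    ((modulesSpecToSheaf.obj (Q.restrict ι)).obj.map_id (.op ⊤))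

theorem isIso_fromTildeSections (ι : Spec R ⟶ X) [IsOpenImmersion ι] {Q : X.Modules}
    (hQ : isQuasicoherent X Q) : IsIso (fromTildeSections ι Q) := by
  have : SheafOfModules.IsQuasicoherent (R := X.ringCatSheaf) Q := hQ
  have : (Q.restrict ι).IsQuasicoherent := Scheme.Modules.isQuasicoherent_restrictFunctor ι Q
  exact inferInstanceAs (IsIso (Q.restrict ι).fromTildeΓ)

/-- The comparison of the previous definition is compatible with restriction to smaller affine open
sets. -/
theorem pushTilde_fromTildeSections (h : Spec.map φ ≫ ι = ι') (Q : X.Modules)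
    {M : ModuleCat.{u} R} {M' : ModuleCat.{u} S}
    (f : M ⟶ (ModuleCat.restrictScalars φ.hom).obj M')
    (e : M ⟶ affineSections ι Q) (e' : M' ⟶ affineSections ι' Q)
    (he : ∀ m, e' (f m) = affineSectionsMap h Q (e m)) :
    pushTilde h f ≫
      (Scheme.Modules.pushforward ι').map (tilde.map e' ≫ fromTildeSections ι' Q) =
    (Scheme.Modules.pushforward ι).map (tilde.map e ≫ fromTildeSections ι Q) ≫
      pushRestrictMap h Q := by
  apply pushforward_tilde_hom_ext h
  intro m
  have h1 : ∀ m, (tilde.map e ≫ fromTildeSections ι Q).app ⊤ (tildeTop M m) = e m := fun m =>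
    (congrArg (fun x => (fromTildeSections ι Q).app ⊤ x) (tilde_map_app_tildeTop e m)).trans
      (fromTildeSections_app ι Q (e m))
  have h2 : ∀ m, (tilde.map e' ≫ fromTildeSections ι' Q).app ⊤ (tildeTop M' m) = e' m := fun m =>
    (congrArg (fun x => (fromTildeSections ι' Q).app ⊤ x) (tilde_map_app_tildeTop e' m)).trans
      (fromTildeSections_app ι' Q (e' m))
  have h3 : (pushTilde h f).app ⊤ (tildeTop M m) = tildeTop M' (f m) :=
    pushTilde_app_tildeTop h f m
  refine (congrArg (fun x => (tilde.map e' ≫ fromTildeSections ι' Q).app ⊤ x) h3).trans ?_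
  refine (h2 (f m)).trans ((he m).trans ?_)
  refine Eq.trans ?_ (congrArg (fun x => (pushRestrictMap h Q).app ⊤ x) (h1 m)).symm
  rw [pushRestrictMap, Scheme.Modules.Hom.comp_app, pushComp_hom_app_top]
  rfl

end Restriction

namespace AffineSystem.ModuleSystem

variable {X : Scheme.{u}} {I : Type v} [SemilatticeInf I] {Y : AffineSystem X I}

/-- A quasicoherent module is isomorphic to the glueing of a system of modules that is isomorphic to
the system of its sections. -/
theorem IsGlueing.nonempty_iso {D : Y.ModuleSystem} {Z : X.Modules} {π : ∀ i, Z ⟶ D.P i}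
    (hZ : D.IsGlueing Z π) (Q : X.Modules) (hQ : CoxScheme.isQuasicoherent X Q)
    (e : ∀ i, D.M i ≅ affineSections (Y.ι i) Q)
    (he : ∀ {j i : I} (h : j ≤ i) (m : D.M i),
      (e j).hom (D.f h m) = affineSectionsMap (Y.comp_eq h) Q ((e i).hom m)) :
    Nonempty (Z ≅ Q) := by
  have hs : ∀ i, IsIso (fromTildeSections (Y.ι i) Q) := fun i =>
    isIso_fromTildeSections (Y.ι i) hQ
  have ht : ∀ i, IsIso (tilde.map (e i).hom) := fun i =>
    inferInstanceAs (IsIso ((tilde.functor (Y.A i)).map (e i).hom))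
  let β : ∀ i, D.P i ≅ (Scheme.Modules.pushforward (Y.ι i)).obj (Q.restrict (Y.ι i)) := fun i =>
    (Scheme.Modules.pushforward (Y.ι i)).mapIso
      (asIso (tilde.map (e i).hom ≫ fromTildeSections (Y.ι i) Q))
  have hβ : ∀ {j i : I} (h : j ≤ i),
      D.p h ≫ (β j).hom = (β i).hom ≫ pushRestrictMap (Y.comp_eq h) Q := fun {j i} h =>
    pushTilde_fromTildeSections (Y.comp_eq h) Q (D.f h) (e i).hom (e j).hom (he h)
  let η := fun i => (Scheme.Modules.restrictAdjunction (Y.ι i)).unit.app Q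
  obtain ⟨t, ht⟩ := hZ.homs Q (fun i => η i ≫ (β i).inv) fun {j i} h => by
    rw [Iso.eq_comp_inv]
    have h1 : (β i).inv ≫ D.p h ≫ (β j).hom = pushRestrictMap (Y.comp_eq h) Q := by
      rw [hβ h, Iso.inv_hom_id_assoc]
    refine Eq.trans ?_ (unit_pushRestrictMap (Y.comp_eq h) Q)
    rw [← h1]
    simp only [Category.assoc]
    rfl
  have : IsIso t := by
    apply isIso_of_bijective_app_of_cover (fun i => (Y.ι i).opensRange) Y.exists_mem
    intro i W hW
    have h1 := congrArg (fun k => Scheme.Modules.Hom.app k W) (ht i)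
    have h2 : Function.Bijective ((η i ≫ (β i).inv).app W) := by
      have h3 : Function.Bijective ((β i).inv.app W) := ConcreteCategory.bijective_of_isIso _
      refine h3.comp ?_
      refine presheaf_map_bijective_of_eq Q ((Y.ι i).image_preimage_le W) ?_
      rw [Scheme.Hom.image_preimage_eq_opensRange_inf, inf_eq_right]
      exact hW
    rw [← ht i] at h2
    exact (Function.Bijective.of_comp_iff' (hZ.app_bijective hW) _).1 h2
  exact ⟨(asIso t).symm⟩

end AffineSystem.ModuleSystem

/-! ### The graduation of a localization of a graded ring -/

section GradedLocalization

variable {ι A σ : Type*} [CommRing A] [SetLike σ A] [AddSubgroupClass σ A] [AddCommGroup ι]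
  [DecidableEq ι] (𝒜 : ι → σ) [GradedRing 𝒜] {z x : A} {d d' : ι}

/-- The coaction `A → A[ι]` of a graded ring, taking a homogeneous element `a` of degree `i` to the
monomial `a` of exponent `i`. -/
noncomputable def coactionAux : A →+* AddMonoidAlgebra A ι :=
  (DirectSum.toSemiring (fun i =>
      (AddMonoidAlgebra.singleAddHom i).comp (AddSubmonoidClass.subtype (𝒜 i))) rfl
    (fun _ _ => (AddMonoidAlgebra.single_mul_single ..).symm)).comp
    (DirectSum.decomposeRingEquiv 𝒜 : A →+* ⨁ i, 𝒜 i)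

theorem coactionAux_of_mem {i : ι} {a : A} (ha : a ∈ 𝒜 i) :
    coactionAux 𝒜 a = AddMonoidAlgebra.single i a := by
  rw [coactionAux, RingHom.comp_apply]
  refine (congrArg _ (DirectSum.decompose_of_mem 𝒜 ha)).trans ?_
  exact DirectSum.toSemiring_of (A := fun i => 𝒜 i) _ _ _ i ⟨a, ha⟩

theorem coeff_coactionAux (a : A) (i : ι) :
    (coactionAux 𝒜 a).coeff i = DirectSum.decompose 𝒜 a i := by
  induction a using DirectSum.Decomposition.inductionOn 𝒜 with
  | zero => simp
  | @homogeneous j a =>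
    rw [coactionAux_of_mem 𝒜 a.2, DirectSum.decompose_coe, AddMonoidAlgebra.coeff_single]
    by_cases h : j = i
    · subst h; simp
    · rw [DirectSum.of_eq_of_ne _ _ _ (Ne.symm h), Finsupp.single_eq_of_ne (Ne.symm h)]; simp
  | add a b ha hb => simp [ha, hb]

/-- The coaction of the localization of a graded ring at a homogeneous element. -/
noncomputable def coaction (hz : z ∈ 𝒜 d) :
    Localization.Away z →+* AddMonoidAlgebra (Localization.Away z) ι :=
  Localization.awayLift
    ((AddMonoidAlgebra.mapRingHom ι (algebraMap A (Localization.Away z))).comp (coactionAux 𝒜)) z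
    (by
      rw [RingHom.comp_apply, coactionAux_of_mem 𝒜 hz, AddMonoidAlgebra.mapRingHom_single]
      obtain ⟨y, hy⟩ := (IsLocalization.Away.algebraMap_isUnit z
        (S := Localization.Away z)).exists_right_inv
      refine IsUnit.of_mul_eq_one (AddMonoidAlgebra.single (-d) y) ?_
      rw [AddMonoidAlgebra.single_mul_single, hy, add_neg_cancel]
      rfl)

theorem coaction_algebraMap (hz : z ∈ 𝒜 d) (a : A) :
    coaction 𝒜 hz (algebraMap A _ a) =
      AddMonoidAlgebra.mapRingHom ι (algebraMap A (Localization.Away z)) (coactionAux 𝒜 a) :=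
  IsLocalization.lift_eq _ a

/-- The homogeneous component of degree `i` of an element of the localization of a graded ring at a
homogeneous element. -/
noncomputable def locComponent (hz : z ∈ 𝒜 d) (i : ι) :
    Localization.Away z →+ Localization.Away z where
  toFun l := (coaction 𝒜 hz l).coeff i
  map_zero' := by simp
  map_add' := by simp

/-- The component of degree `i` of `a / z ^ n` is the quotient by `z ^ n` of the component of `a` of
degree `i + n d`. -/
theorem locComponent_mk (hz : z ∈ 𝒜 d) (i : ι) (a : A) (n : ℕ) :
    locComponent 𝒜 hz i (Localization.mk a (⟨z ^ n, n, rfl⟩ : Submonoid.powers z)) =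
      Localization.mk (DirectSum.decompose 𝒜 a (i + n • d) : A)
        (⟨z ^ n, n, rfl⟩ : Submonoid.powers z) := by
  have h1 : Localization.mk a (⟨z ^ n, n, rfl⟩ : Submonoid.powers z) *
      algebraMap A (Localization.Away z) (z ^ n) = algebraMap A _ a := by
    rw [← Localization.mk_one_eq_algebraMap, ← Localization.mk_one_eq_algebraMap,
      Localization.mk_mul, Localization.mk_eq_mk_iff, Localization.r_iff_exists]
    exact ⟨1, by simp; ring⟩
  have h2 := congrArg (fun q => (coaction 𝒜 hz q).coeff (i + n • d)) h1
  simp only [map_mul, coaction_algebraMap, coactionAux_of_mem 𝒜 (SetLike.pow_mem_graded n hz),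
    AddMonoidAlgebra.mapRingHom_single] at h2
  rw [AddMonoidAlgebra.coeff_mul_single_eq_coeff_mul i (by simp),
    AddMonoidAlgebra.coeff_mapRingHom] at h2
  simp only [coeff_coactionAux] at h2
  have h3 : IsUnit (algebraMap A (Localization.Away z) (z ^ n)) := by
    rw [map_pow]; exact (IsLocalization.Away.algebraMap_isUnit z).pow n
  apply h3.mul_left_injective
  refine h2.trans ?_
  simp only
  rw [← Localization.mk_one_eq_algebraMap, ← Localization.mk_one_eq_algebraMap,
      Localization.mk_mul, Localization.mk_eq_mk_iff, Localization.r_iff_exists]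
  exact ⟨1, by simp; ring⟩

theorem exists_eq_mk (l : Localization.Away z) :
    ∃ (a : A) (n : ℕ), l = Localization.mk a (⟨z ^ n, n, rfl⟩ : Submonoid.powers z) := by
  induction l using Localization.induction_on with
  | H y => obtain ⟨a, ⟨_, n, rfl⟩⟩ := y; exact ⟨a, n, rfl⟩

theorem locComponent_locComponent (hz : z ∈ 𝒜 d) (i j : ι) (l : Localization.Away z) :
    locComponent 𝒜 hz j (locComponent 𝒜 hz i l) =
      if i = j then locComponent 𝒜 hz i l else 0 := by
  obtain ⟨a, n, rfl⟩ := exists_eq_mk l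
  rw [locComponent_mk, locComponent_mk, DirectSum.decompose_coe]
  by_cases h : i = j
  · subst h; simp
  · rw [if_neg h, DirectSum.of_eq_of_ne _ _ _ fun h' => h (add_right_cancel h').symm]
    simp [Localization.mk_zero]

theorem exists_sum_locComponent (hz : z ∈ 𝒜 d) (l : Localization.Away z) :
    ∃ t : Finset ι, ∑ i ∈ t, locComponent 𝒜 hz i l = l := by
  classical
  obtain ⟨a, n, rfl⟩ := exists_eq_mk l
  refine ⟨(DirectSum.decompose 𝒜 a).support.image fun i => i - n • d, ?_⟩
  rw [Finset.sum_image fun i _ j _ h => sub_left_injective h]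
  simp only [locComponent_mk]
  rw [← Localization.mk_sum]
  refine congrArg (fun b => Localization.mk b _)
    (Eq.trans ?_ (DirectSum.sum_support_decompose 𝒜 a))
  exact Finset.sum_congr rfl fun i _ => by rw [sub_add_cancel]

theorem locComponent_smul (hz : z ∈ 𝒜 d) {i : ι} {a : A} (ha : a ∈ 𝒜 i) (j : ι)
    (l : Localization.Away z) :
    locComponent 𝒜 hz (i + j) (a • l) = a • locComponent 𝒜 hz j l := by
  obtain ⟨b, n, rfl⟩ := exists_eq_mk l
  rw [Localization.smul_mk, locComponent_mk, locComponent_mk, Localization.smul_mk, smul_eq_mul,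
    add_assoc, DirectSum.coe_decompose_mul_add_of_left_mem 𝒜 ha, smul_eq_mul]

theorem locComponent_locMap (hz : z ∈ 𝒜 d) (hx : x ∈ 𝒜 d') (h : z ∣ x) (i : ι)
    (l : Localization.Away z) :
    locComponent 𝒜 hx i (locMap h l) = locMap h (locComponent 𝒜 hz i l) := by
  have h1 : (coaction 𝒜 hx).comp (locMap h) =
      (AddMonoidAlgebra.mapRingHom ι (locMap h)).comp (coaction 𝒜 hz) := by
    refine IsLocalization.ringHom_ext (Submonoid.powers z) (RingHom.ext fun a => ?_)
    simp only [RingHom.comp_apply, locMap_algebraMap, coaction_algebraMap]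
    induction a using DirectSum.Decomposition.inductionOn 𝒜 with
    | zero => simp
    | homogeneous a =>
      simp [coactionAux_of_mem 𝒜 a.2, AddMonoidAlgebra.mapRingHom_single, locMap_algebraMap]
    | add a b ha hb => simp only [map_add, ha, hb]
  have h2 := congrArg (fun q => (q l).coeff i) h1
  simp only [RingHom.comp_apply, AddMonoidAlgebra.coeff_mapRingHom] at h2
  exact h2

open HomogeneousLocalization in
theorem locComponent_val_smul (hz : z ∈ 𝒜 d) (i : ι) (c : Away 𝒜 z) (l : Localization.Away z) :
    locComponent 𝒜 hz i (c • l) = c • locComponent 𝒜 hz i l := by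
  obtain ⟨b, n, rfl⟩ := exists_eq_mk l
  obtain ⟨k, a, ha, rfl⟩ := Away.mk_surjective 𝒜 hz c
  have h1 : ∀ b : A, Away.mk 𝒜 hz k a ha •
      (Localization.mk b (⟨z ^ n, n, rfl⟩ : Submonoid.powers z) : Localization.Away z) =
      Localization.mk (a * b) (⟨z ^ (k + n), k + n, rfl⟩ : Submonoid.powers z) := by
    intro b
    rw [Algebra.smul_def, HomogeneousLocalization.algebraMap_apply, Away.val_mk,
      Localization.mk_mul]
    congr 1
    exact Subtype.ext (pow_add z k n).symm
  rw [h1, locComponent_mk, locComponent_mk, h1]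
  congr 2
  rw [show i + (k + n) • d = k • d + (i + n • d) by rw [add_smul]; abel,
    DirectSum.coe_decompose_mul_add_of_left_mem 𝒜 ha]

open HomogeneousLocalization in
/-- The component of degree `0` takes values in the ring `A_(z)`. -/
theorem exists_val_eq_locComponent_zero (hz : z ∈ 𝒜 d) (l : Localization.Away z) :
    ∃ c : Away 𝒜 z, c.val = locComponent 𝒜 hz 0 l := by
  obtain ⟨b, n, rfl⟩ := exists_eq_mk l
  refine ⟨Away.mk 𝒜 hz n (DirectSum.decompose 𝒜 b (n • d) : A) (SetLike.coe_mem _), ?_⟩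
  rw [locComponent_mk, Away.val_mk, zero_add]

open HomogeneousLocalization in
theorem locComponent_zero_val (hz : z ∈ 𝒜 d) (c : Away 𝒜 z) :
    locComponent 𝒜 hz 0 c.val = c.val := by
  obtain ⟨k, a, ha, rfl⟩ := Away.mk_surjective 𝒜 hz c
  rw [Away.val_mk, locComponent_mk, zero_add, DirectSum.decompose_of_mem_same 𝒜 ha]

end GradedLocalization

/-! ### Graduations given by projections -/

section Projections

variable {ι : Type*} [DecidableEq ι] {T : Type*} [AddCommGroup T]

/-- A graduation of an abelian group, given by the projections to its homogeneous components. -/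
structure Projections (ι : Type*) [DecidableEq ι] (T : Type*) [AddCommGroup T] where
  /-- The projections. -/
  p : ι → T →+ T
  p_p : ∀ i j x, p j (p i x) = if i = j then p i x else 0
  exists_sum : ∀ x, ∃ t : Finset ι, ∑ i ∈ t, p i x = x

namespace Projections

variable (D : Projections ι T)

theorem exists_forall_sum (x : T) : ∃ t : Finset ι, ∀ t', t ⊆ t' → ∑ i ∈ t', D.p i x = x := by
  obtain ⟨t, ht⟩ := D.exists_sum x
  refine ⟨t, fun t' h => ?_⟩
  rw [← Finset.sum_subset h, ht]
  intro j _ hj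
  rw [← ht, map_sum]
  refine Finset.sum_eq_zero fun i hi => ?_
  rw [D.p_p, if_neg]
  rintro rfl
  exact hj hi

/-- The homogeneous elements of degree `i`. -/
def piece (i : ι) : AddSubgroup T := (D.p i).range

theorem mem_piece {i : ι} {x : T} : x ∈ D.piece i ↔ D.p i x = x := by
  constructor
  · rintro ⟨y, rfl⟩
    rw [D.p_p, if_pos rfl]
  · exact fun h => ⟨x, h⟩

theorem isInternal : DirectSum.IsInternal D.piece := by
  have key : ∀ (x : ⨁ i, D.piece i) (i : ι),
      D.p i (DirectSum.coeAddMonoidHom D.piece x) = x i := by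
    intro x i
    induction x using DirectSum.induction_on with
    | zero => simp
    | of j y =>
      rw [DirectSum.coeAddMonoidHom_of]
      obtain ⟨_, y, rfl⟩ := y
      by_cases h : j = i
      · subst h
        rw [D.p_p, if_pos rfl, DirectSum.of_eq_same]
      · rw [D.p_p, if_neg h, DirectSum.of_eq_of_ne _ _ _ (Ne.symm h)]
        rfl
    | add x y hx hy => simp [hx, hy]
  constructor
  · intro x y hxy
    ext i
    rw [← key x i, ← key y i, hxy]
  · intro x
    obtain ⟨t, ht⟩ := D.exists_sum x
    rw [← AddMonoidHom.mem_mrange, ← ht]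
    refine sum_mem fun i _ => ⟨DirectSum.of (fun i => D.piece i) i ⟨D.p i x, x, rfl⟩, ?_⟩
    rw [DirectSum.coeAddMonoidHom_of]

end Projections

end Projections

/-! ### Extension of scalars from the component of degree zero -/

section BaseChange

/-- A map between modules obtained by extension of scalars to `L` and `L'` is an extension of
scalars if it comes from an extension of scalars. -/
theorem isBaseChange_of_tensor {A₀ A₁ L L' G G' : Type*} [CommRing A₀] [CommRing A₁] [CommRing L]
    [CommRing L'] [Algebra A₀ A₁] [Algebra A₀ L] [Algebra A₁ L'] [Algebra A₀ L'] [Algebra L L']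
    [IsScalarTower A₀ A₁ L'] [IsScalarTower A₀ L L'] [AddCommGroup G] [AddCommGroup G']
    [Module A₀ G] [Module A₁ G'] [Module A₀ G'] [IsScalarTower A₀ A₁ G'] {f : G →ₗ[A₀] G'}
    (hf : IsBaseChange A₁ f) (t : L ⊗[A₀] G →ₗ[L] L' ⊗[A₁] G')
    (ht : ∀ g, t (1 ⊗ₜ g) = 1 ⊗ₜ f g) : IsBaseChange L' t := by
  have h1 : IsBaseChange L' (((TensorProduct.mk A₁ L' G' 1).restrictScalars A₀).comp f) :=
    hf.comp (TensorProduct.isBaseChange A₁ G' L')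
  refine IsBaseChange.of_comp (TensorProduct.isBaseChange A₀ G L) ?_
  convert h1 using 1
  ext g
  exact ht g

variable {A : Type*} [CommRing A]

/-- The ring `A_x` is the localization of `A_z` at `x` for `z ∣ x`. -/
theorem isLocalization_locMap {z x : A} (h : z ∣ x) :
    letI := (locMap h).toAlgebra
    IsLocalization.Away (algebraMap A (Localization.Away z) x) (Localization.Away x) := by
  let := (locMap h).toAlgebra
  have h0 : ∀ a, algebraMap (Localization.Away z) (Localization.Away x) (algebraMap A _ a) =
    algebraMap A _ a := locMap_algebraMap h
  have hu : IsUnit (algebraMap A (Localization.Away x) x) := IsLocalization.Away.algebraMap_isUnit x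
  have key : ∀ l, locMap h l = 0 → ∃ n : ℕ, algebraMap A (Localization.Away z) x ^ n * l = 0 := by
    intro l hl
    obtain ⟨⟨a, _, n, rfl⟩, hs⟩ := IsLocalization.surj (Submonoid.powers z) l
    have h1 := congrArg (locMap h) hs
    rw [map_mul, hl, zero_mul, locMap_algebraMap, eq_comm,
      IsLocalization.map_eq_zero_iff (Submonoid.powers x)] at h1
    obtain ⟨⟨_, m, rfl⟩, hm⟩ := h1
    refine ⟨m, ?_⟩
    have h2 : IsUnit (algebraMap A (Localization.Away z) (z ^ n)) := by
      rw [map_pow]; exact (IsLocalization.Away.algebraMap_isUnit z).pow n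
    apply h2.mul_left_injective
    simp only at hs hm ⊢
    rw [mul_assoc, hs, ← map_pow, ← map_mul, hm, map_zero, zero_mul]
  constructor; constructor
  · rintro ⟨_, n, rfl⟩
    simp only [map_pow, h0]
    exact hu.pow n
  · intro y
    obtain ⟨⟨a, _, n, rfl⟩, hs⟩ := IsLocalization.surj (Submonoid.powers x) y
    refine ⟨⟨algebraMap A _ a, ⟨_, n, rfl⟩⟩, ?_⟩
    simp only [map_pow, h0] at hs ⊢
    exact hs
  · intro l₁ l₂ h1
    obtain ⟨n, hn⟩ := key (l₁ - l₂) (by rw [map_sub]; exact sub_eq_zero.2 h1)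
    exact ⟨⟨_, n, rfl⟩, by simpa [mul_sub, sub_eq_zero] using hn⟩

end BaseChange

section DegreeZeroTensor

open HomogeneousLocalization

variable {ι A σ : Type*} [CommRing A] [SetLike σ A] [AddSubgroupClass σ A] [AddCommGroup ι]
  [DecidableEq ι] {𝒜 : ι → σ} [GradedRing 𝒜] {z x y : A} {d d' : ι}

instance smulCommClass_away : SMulCommClass A (Away 𝒜 z) (Localization.Away z) :=
  ⟨fun a c l => by rw [Algebra.smul_def c, Algebra.smul_def c, mul_smul_comm]⟩

instance smulCommClass_away_symm : SMulCommClass (Away 𝒜 z) A (Localization.Away z) :=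
  SMulCommClass.symm _ _ _

/-- The homogeneous components of the localization of a graded ring, as linear maps over the
component of degree zero. -/
noncomputable def locComponentLinear (hz : z ∈ 𝒜 d) (i : ι) :
    Localization.Away z →ₗ[Away 𝒜 z] Localization.Away z where
  __ := locComponent 𝒜 hz i
  map_smul' := locComponent_val_smul 𝒜 hz i

/-- The graduation of the localization of a graded ring at a homogeneous element. -/
noncomputable def locProjections (hz : z ∈ 𝒜 d) : Projections ι (Localization.Away z) where
  p := locComponent 𝒜 hz
  p_p := locComponent_locComponent 𝒜 hz
  exists_sum := exists_sum_locComponent 𝒜 hz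

variable (G : Type*) [AddCommGroup G] [Module (Away 𝒜 z) G]

/-- The graduation of the extension of scalars of a module over the component of degree zero of the
localization of a graded ring. -/
noncomputable def tensorProjections (hz : z ∈ 𝒜 d) :
    Projections ι (Localization.Away z ⊗[Away 𝒜 z] G) where
  p i := ((locComponentLinear hz i).rTensor G).toAddMonoidHom
  p_p i j x := by
    induction x using TensorProduct.induction_on with
    | zero => simp
    | tmul l g =>
      have h := locComponent_locComponent 𝒜 hz i j l
      change (locComponent 𝒜 hz j (locComponent 𝒜 hz i l)) ⊗ₜ[Away 𝒜 z] g =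
        if i = j then (locComponent 𝒜 hz i l) ⊗ₜ[Away 𝒜 z] g else 0
      rw [h]
      split_ifs <;> simp
    | add x y hx hy =>
      rw [map_add, map_add, hx, hy]
      split_ifs <;> simp
  exists_sum x := by
    have key : ∃ t : Finset ι, ∀ t', t ⊆ t' →
        ∑ i ∈ t', (locComponentLinear hz i).rTensor G x = x := by
      induction x using TensorProduct.induction_on with
      | zero => exact ⟨∅, by simp⟩
      | tmul l g =>
        obtain ⟨t, ht⟩ := (locProjections hz).exists_forall_sum l
        refine ⟨t, fun t' h => ?_⟩
        simp only [LinearMap.rTensor_tmul]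
        rw [← TensorProduct.sum_tmul]
        exact congrArg (fun l => l ⊗ₜ[Away 𝒜 z] g) (ht t' h)
      | add x y hx hy =>
        obtain ⟨t, ht⟩ := hx
        obtain ⟨s, hs⟩ := hy
        refine ⟨t ∪ s, fun t' h => ?_⟩
        simp only [map_add, Finset.sum_add_distrib]
        rw [ht _ (Finset.union_subset_left h), hs _ (Finset.union_subset_right h)]
    obtain ⟨t, ht⟩ := key
    exact ⟨t, ht t le_rfl⟩

theorem tensorProjections_p_tmul (hz : z ∈ 𝒜 d) (i : ι) (l : Localization.Away z) (g : G) :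
    (tensorProjections G hz).p i (l ⊗ₜ g) = locComponent 𝒜 hz i l ⊗ₜ g := rfl

theorem tensorProjections_p_smul (hz : z ∈ 𝒜 d) {i : ι} {a : A} (ha : a ∈ 𝒜 i) (j : ι)
    (x : Localization.Away z ⊗[Away 𝒜 z] G) :
    (tensorProjections G hz).p (i + j) (a • x) = a • (tensorProjections G hz).p j x := by
  induction x using TensorProduct.induction_on with
  | zero => simp
  | tmul l g =>
    rw [TensorProduct.smul_tmul', tensorProjections_p_tmul, tensorProjections_p_tmul,
      TensorProduct.smul_tmul', locComponent_smul 𝒜 hz ha]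
  | add x y hx hy => simp only [smul_add, map_add, hx, hy]

/-- The projection of the localization of a graded ring to its component of degree zero. -/
noncomputable def locRetraction (hz : z ∈ 𝒜 d) : Localization.Away z →ₗ[Away 𝒜 z] Away 𝒜 z where
  toFun l := (exists_val_eq_locComponent_zero 𝒜 hz l).choose
  map_add' l l' := by
    apply val_injective
    rw [val_add, (exists_val_eq_locComponent_zero 𝒜 hz l).choose_spec,
      (exists_val_eq_locComponent_zero 𝒜 hz l').choose_spec,
      (exists_val_eq_locComponent_zero 𝒜 hz (l + l')).choose_spec, map_add]
  map_smul' c l := by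
    apply val_injective
    rw [smul_eq_mul, val_mul, (exists_val_eq_locComponent_zero 𝒜 hz (c • l)).choose_spec]
    refine (locComponent_val_smul 𝒜 hz 0 c l).trans ?_
    rw [Algebra.smul_def]
    exact congrArg (c.val * ·) (exists_val_eq_locComponent_zero 𝒜 hz l).choose_spec.symm

theorem val_locRetraction (hz : z ∈ 𝒜 d) (l : Localization.Away z) :
    (locRetraction hz l).val = locComponent 𝒜 hz 0 l :=
  (exists_val_eq_locComponent_zero 𝒜 hz l).choose_spec

theorem locRetraction_one (hz : z ∈ 𝒜 d) : locRetraction hz (1 : Localization.Away z) = 1 := by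
  apply val_injective
  rw [val_locRetraction, ← val_one (𝒜 := 𝒜), locComponent_zero_val]

/-- The component of degree zero of the extension of scalars of a module `G` is `G`. -/
noncomputable def tensorDegreeZero (hz : z ∈ 𝒜 d) :
    Localization.Away z ⊗[Away 𝒜 z] G →ₗ[Away 𝒜 z] G :=
  TensorProduct.lid (Away 𝒜 z) G ∘ₗ (locRetraction hz).rTensor G

theorem tensorDegreeZero_one_tmul (hz : z ∈ 𝒜 d) (g : G) :
    tensorDegreeZero G hz (1 ⊗ₜ g) = g := by
  simp [tensorDegreeZero, locRetraction_one]

theorem one_tmul_tensorDegreeZero (hz : z ∈ 𝒜 d) (x : Localization.Away z ⊗[Away 𝒜 z] G) :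
    (1 : Localization.Away z) ⊗ₜ[Away 𝒜 z] tensorDegreeZero G hz x =
      (tensorProjections G hz).p 0 x := by
  induction x using TensorProduct.induction_on with
  | zero => simp
  | tmul l g =>
    rw [tensorProjections_p_tmul, ← val_locRetraction]
    simp only [tensorDegreeZero, LinearMap.comp_apply, LinearMap.rTensor_tmul,
      LinearEquiv.coe_coe, TensorProduct.lid_tmul]
    rw [TensorProduct.tmul_smul, TensorProduct.smul_tmul', Algebra.smul_def, mul_one]
    rfl
  | add x y hx hy => simp only [map_add, TensorProduct.tmul_add, hx, hy]

variable {G} {G' : Type*} [AddCommGroup G'] [Module (Away 𝒜 x) G'] {G'' : Type*} [AddCommGroup G'']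
  [Module (Away 𝒜 y) G'']

theorem locMap_smul (h : z ∣ x) {ψ : Away 𝒜 z →+* Away 𝒜 x}
    (hψ : ∀ c, (ψ c).val = locMap h c.val) (c : Away 𝒜 z) (l : Localization.Away z) :
    locMap h (c • l) = ψ c • locMap h l := by
  rw [Algebra.smul_def, Algebra.smul_def, map_mul]
  exact congrArg (· * locMap h l) (hψ c).symm

/-- The additive map between extensions of scalars defined by a semilinear map. -/
noncomputable def tensorAddMap (h : z ∣ x) {ψ : Away 𝒜 z →+* Away 𝒜 x}
    (hψ : ∀ c, (ψ c).val = locMap h c.val) (f : G →ₛₗ[ψ] G') :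
    Localization.Away z ⊗[Away 𝒜 z] G →+ Localization.Away x ⊗[Away 𝒜 x] G' :=
  TensorProduct.liftAddHom
    { toFun := fun l =>
        { toFun := fun g => locMap h l ⊗ₜ f g
          map_zero' := by rw [map_zero, TensorProduct.tmul_zero]
          map_add' := fun g g' => by rw [map_add, TensorProduct.tmul_add] }
      map_zero' := AddMonoidHom.ext fun g => by
        change locMap h 0 ⊗ₜ f g = 0
        rw [map_zero, TensorProduct.zero_tmul]
      map_add' := fun l l' => AddMonoidHom.ext fun g => by
        change locMap h (l + l') ⊗ₜ f g = locMap h l ⊗ₜ f g + locMap h l' ⊗ₜ f g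
        rw [map_add, TensorProduct.add_tmul] }
    (fun c l g => by
      change locMap h (c • l) ⊗ₜ f g = locMap h l ⊗ₜ f (c • g)
      have h1 : f (c • g) = ψ c • f g := map_smulₛₗ f c g
      rw [h1, locMap_smul h hψ, TensorProduct.smul_tmul])

theorem tensorAddMap_tmul (h : z ∣ x) {ψ : Away 𝒜 z →+* Away 𝒜 x}
    (hψ : ∀ c, (ψ c).val = locMap h c.val) (f : G →ₛₗ[ψ] G') (l : Localization.Away z) (g : G) :
    tensorAddMap h hψ f (l ⊗ₜ g) = locMap h l ⊗ₜ f g := rfl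

/-- The map between extensions of scalars defined by a semilinear map. -/
noncomputable def tensorMap (h : z ∣ x) {ψ : Away 𝒜 z →+* Away 𝒜 x}
    (hψ : ∀ c, (ψ c).val = locMap h c.val) (f : G →ₛₗ[ψ] G') :
    Localization.Away z ⊗[Away 𝒜 z] G →ₗ[A] Localization.Away x ⊗[Away 𝒜 x] G' where
  __ := tensorAddMap h hψ f
  map_smul' a w := by
    change tensorAddMap h hψ f (a • w) = a • tensorAddMap h hψ f w
    induction w using TensorProduct.induction_on with
    | zero => rw [smul_zero, map_zero, smul_zero]
    | tmul l g =>
      rw [TensorProduct.smul_tmul', tensorAddMap_tmul, tensorAddMap_tmul,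
        TensorProduct.smul_tmul', Algebra.smul_def, Algebra.smul_def, map_mul, locMap_algebraMap]
    | add x y hx hy => rw [smul_add, map_add, map_add, hx, hy, smul_add]

section

variable (h : z ∣ x) {ψ : Away 𝒜 z →+* Away 𝒜 x} (hψ : ∀ c, (ψ c).val = locMap h c.val)
  (f : G →ₛₗ[ψ] G')

theorem tensorMap_tmul (l : Localization.Away z) (g : G) :
    tensorMap h hψ f (l ⊗ₜ g) = locMap h l ⊗ₜ f g := rfl

theorem tensorMap_p (hz : z ∈ 𝒜 d) (hx : x ∈ 𝒜 d') (i : ι)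
    (w : Localization.Away z ⊗[Away 𝒜 z] G) :
    (tensorProjections G' hx).p i (tensorMap h hψ f w) =
      tensorMap h hψ f ((tensorProjections G hz).p i w) := by
  induction w using TensorProduct.induction_on with
  | zero => simp
  | tmul l g =>
    rw [tensorMap_tmul, tensorProjections_p_tmul, tensorProjections_p_tmul, tensorMap_tmul,
      locComponent_locMap 𝒜 hz hx h]
  | add x y hx hy => simp only [map_add, hx, hy]

theorem tensorMap_refl (h : z ∣ z) {ψ : Away 𝒜 z →+* Away 𝒜 z}
    (hψ : ∀ c, (ψ c).val = locMap h c.val) (f : G →ₛₗ[ψ] G) (hf : ∀ g, f g = g)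
    (w : Localization.Away z ⊗[Away 𝒜 z] G) : tensorMap h hψ f w = w := by
  induction w using TensorProduct.induction_on with
  | zero => simp
  | tmul l g => rw [tensorMap_tmul, hf, locMap_refl]
  | add x y hx hy => simp only [map_add, hx, hy]

theorem tensorMap_tensorMap (h' : x ∣ y) {ψ' : Away 𝒜 x →+* Away 𝒜 y}
    (hψ' : ∀ c, (ψ' c).val = locMap h' c.val) (f' : G' →ₛₗ[ψ'] G'') (h'' : z ∣ y)
    {ψ'' : Away 𝒜 z →+* Away 𝒜 y} (hψ'' : ∀ c, (ψ'' c).val = locMap h'' c.val)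
    (f'' : G →ₛₗ[ψ''] G'') (hf : ∀ g, f' (f g) = f'' g) (w : Localization.Away z ⊗[Away 𝒜 z] G) :
    tensorMap h' hψ' f' (tensorMap h hψ f w) = tensorMap h'' hψ'' f'' w := by
  induction w using TensorProduct.induction_on with
  | zero => simp
  | tmul l g => rw [tensorMap_tmul, tensorMap_tmul, tensorMap_tmul, hf, locMap_locMap h h' h'']
  | add x y hx hy => simp only [map_add, hx, hy]

end

end DegreeZeroTensor

section TensorLocalization

open HomogeneousLocalization

variable {ι A σ : Type*} [CommRing A] [SetLike σ A] [AddSubgroupClass σ A] [AddCommGroup ι]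
  [DecidableEq ι] {𝒜 : ι → σ} [GradedRing 𝒜] {z x : A}
  {G : Type*} [AddCommGroup G] [Module (Away 𝒜 z) G]
  {G' : Type*} [AddCommGroup G'] [Module (Away 𝒜 x) G']

/-- If a semilinear map `G → G'` is a localization at an element `r`, then the map it defines
between extensions of scalars is the localization at `x`. -/
theorem tensorMap_localization (h : z ∣ x) {ψ : Away 𝒜 z →+* Away 𝒜 x}
    (hψ : ∀ c, (ψ c).val = locMap h c.val) (f : G →ₛₗ[ψ] G') (r : Away 𝒜 z)
    (hr : letI := ψ.toAlgebra; IsLocalization.Away r (Away 𝒜 x))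
    (hf₀ : ∀ g, f g = 0 → ∃ n : ℕ, r ^ n • g = 0)
    (hf₁ : ∀ g', ∃ (n : ℕ) (g : G), f g = ψ r ^ n • g') :
    (∀ w, tensorMap h hψ f w = 0 → ∃ n : ℕ, x ^ n • w = 0) ∧
      ∀ w', ∃ (n : ℕ) (w : _), tensorMap h hψ f w = x ^ n • w' := by
  let := ψ.toAlgebra
  let := (locMap h).toAlgebra
  let : Algebra (Away 𝒜 z) (Localization.Away x) :=
    ((algebraMap (Away 𝒜 x) (Localization.Away x)).comp ψ).toAlgebra
  let : Module (Away 𝒜 z) G' := Module.compHom G' ψ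
  have : IsScalarTower (Away 𝒜 z) (Away 𝒜 x) G' := IsScalarTower.of_algebraMap_smul fun _ _ => rfl
  have : IsScalarTower (Away 𝒜 z) (Away 𝒜 x) (Localization.Away x) :=
    IsScalarTower.of_algebraMap_eq fun _ => rfl
  have : IsScalarTower (Away 𝒜 z) (Localization.Away z) (Localization.Away x) :=
    IsScalarTower.of_algebraMap_eq hψ
  let f' : G →ₗ[Away 𝒜 z] G' :=
    { toFun := f, map_add' := map_add f, map_smul' := fun c g => map_smulₛₗ f c g }
  have hloc : IsLocalizedModule (.powers r) f' := by
    constructor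
    · rintro ⟨_, n, rfl⟩
      have h1 : IsUnit (algebraMap (Away 𝒜 x) (Module.End (Away 𝒜 x) G') (ψ (r ^ n))) := by
        refine IsUnit.map _ ?_
        rw [map_pow]
        exact (IsLocalization.Away.algebraMap_isUnit r).pow n
      rw [Module.End.isUnit_iff] at h1 ⊢
      exact h1
    · intro g'
      obtain ⟨n, g, hg⟩ := hf₁ g'
      refine ⟨⟨g, ⟨_, n, rfl⟩⟩, ?_⟩
      change ψ (r ^ n) • g' = f g
      rw [hg, map_pow]
    · intro g₁ g₂ h1
      obtain ⟨n, hn⟩ := hf₀ (g₁ - g₂) (by rw [map_sub]; exact sub_eq_zero.2 h1)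
      exact ⟨⟨_, n, rfl⟩, sub_eq_zero.1 ((smul_sub (r ^ n) g₁ g₂).symm.trans hn)⟩
  have hbc : IsBaseChange (Away 𝒜 x) f' :=
    (isLocalizedModule_iff_isBaseChange (.powers r) (Away 𝒜 x) f').1 hloc
  let t : Localization.Away z ⊗[Away 𝒜 z] G →ₗ[Localization.Away z]
      Localization.Away x ⊗[Away 𝒜 x] G' :=
    { tensorMap h hψ f with
      map_smul' := fun l w => by
        change tensorMap h hψ f (l • w) = locMap h l • tensorMap h hψ f w
        induction w using TensorProduct.induction_on with
        | zero => rw [smul_zero, map_zero, smul_zero]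
        | tmul l' g =>
          rw [TensorProduct.smul_tmul', tensorMap_tmul, tensorMap_tmul, TensorProduct.smul_tmul',
            smul_eq_mul, map_mul, smul_eq_mul]
        | add x y hx hy => rw [smul_add, map_add, map_add, hx, hy, smul_add] }
  have ht : IsBaseChange (Localization.Away x) t := isBaseChange_of_tensor hbc t fun g => by
    change locMap h 1 ⊗ₜ f g = 1 ⊗ₜ f g
    rw [map_one]
  have := isLocalization_locMap h
  have hl : IsLocalizedModule (.powers (algebraMap A (Localization.Away z) x)) t :=
    (isLocalizedModule_iff_isBaseChange _ (Localization.Away x) t).2 ht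
  have hs : ∀ (n : ℕ) (w : Localization.Away z ⊗[Away 𝒜 z] G),
      algebraMap A (Localization.Away z) x ^ n • w = x ^ n • w := by
    intro n w
    rw [← map_pow]
    exact algebraMap_smul _ _ _
  have hs' : ∀ (n : ℕ) (w : Localization.Away x ⊗[Away 𝒜 x] G'),
      algebraMap A (Localization.Away z) x ^ n • w = x ^ n • w := by
    intro n w
    change locMap h (algebraMap A (Localization.Away z) x ^ n) • w = _
    rw [← map_pow, locMap_algebraMap]
    exact algebraMap_smul _ _ _
  constructor
  · intro w hw
    obtain ⟨⟨_, n, rfl⟩, hn⟩ := (IsLocalizedModule.eq_zero_iff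
      (.powers (algebraMap A (Localization.Away z) x)) t).1 hw
    exact ⟨n, (hs n w).symm.trans hn⟩
  · intro w'
    obtain ⟨⟨w, _, n, rfl⟩, hn⟩ := IsLocalizedModule.surj
      (.powers (algebraMap A (Localization.Away z) x)) t w'
    exact ⟨n, w, hn.symm.trans (hs' n w')⟩

end TensorLocalization

/-! ### Graded modules with given components of degree zero -/

section GradedSystem

open HomogeneousLocalization

variable {ι A σ : Type*} [CommRing A] [SetLike σ A] [AddSubgroupClass σ A] [AddCommGroup ι]
  [DecidableEq ι]

/-- A system of modules `G i` over the components of degree zero of the localizations of a graded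
ring `A` at homogeneous elements `z i`, such that for `j ≤ i` the ring and the module with index `j`
are the localizations of those with index `i` at an element `r`. -/
structure GradedSystem (𝒜 : ι → σ) [GradedRing 𝒜] (I : Type*) [SemilatticeInf I] where
  /-- The homogeneous elements that get inverted. -/
  z : I → A
  /-- The degrees of these elements. -/
  d : I → ι
  z_mem : ∀ i, z i ∈ 𝒜 (d i)
  dvd : ∀ {j i}, j ≤ i → z i ∣ z j
  inf_dvd : ∀ i j, z (i ⊓ j) ∣ z i * z j
  /-- The transition maps between the rings. -/
  ψ : ∀ {j i}, j ≤ i → Away 𝒜 (z i) →+* Away 𝒜 (z j)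
  val_ψ : ∀ {j i} (h : j ≤ i) (c : Away 𝒜 (z i)), (ψ h c).val = locMap (dvd h) c.val
  /-- The modules of the system. -/
  G : I → Type w
  [addCommGroup : ∀ i, AddCommGroup (G i)]
  [module : ∀ i, Module (Away 𝒜 (z i)) (G i)]
  /-- The transition maps between the modules. -/
  f : ∀ {j i} (h : j ≤ i), G i →ₛₗ[ψ h] G j
  f_refl : ∀ i (g : G i), f (le_refl i) g = g
  f_f : ∀ {k j i} (h : k ≤ j) (h' : j ≤ i) (g : G i), f h (f h' g) = f (h.trans h') g
  /-- The elements at which the transition maps are localizations. -/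
  r : ∀ {j i}, j ≤ i → Away 𝒜 (z i)
  isLocalization : ∀ {j i} (h : j ≤ i),
    letI := (ψ h).toAlgebra; IsLocalization.Away (r h) (Away 𝒜 (z j))
  exists_smul_eq_zero : ∀ {j i} (h : j ≤ i) (g : G i), f h g = 0 → ∃ n : ℕ, r h ^ n • g = 0
  exists_eq_smul : ∀ {j i} (h : j ≤ i) (g' : G j), ∃ (n : ℕ) (g : G i), f h g = ψ h (r h) ^ n • g'

namespace GradedSystem

attribute [instance] addCommGroup module

variable {𝒜 : ι → σ} [GradedRing 𝒜] {I : Type*} [SemilatticeInf I] (D : GradedSystem.{w} 𝒜 I)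

/-- The system of `A`-modules obtained by extension of scalars to the localizations of `A`. -/
noncomputable def locSystem : LocSystem A I where
  z := D.z
  T i := Localization.Away (D.z i) ⊗[Away 𝒜 (D.z i)] D.G i
  t h := tensorMap (D.dvd h) (D.val_ψ h) (D.f h)
  t_refl i x := tensorMap_refl _ _ _ (D.f_refl i) x
  t_comp h h' x := tensorMap_tensorMap _ _ _ _ _ _ _ _ _ (D.f_f h h') x
  bij i := by
    have h1 : (fun x : Localization.Away (D.z i) ⊗[Away 𝒜 (D.z i)] D.G i => D.z i • x) =
        fun x => algebraMap A (Localization.Away (D.z i)) (D.z i) • x := by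
      ext x
      exact (algebraMap_smul _ _ _).symm
    rw [h1]
    obtain ⟨c, hc⟩ := IsLocalization.Away.algebraMap_isUnit (S := Localization.Away (D.z i)) (D.z i)
    rw [← hc]
    exact MulAction.bijective c
  exists_smul_eq_zero h := (tensorMap_localization (D.dvd h) (D.val_ψ h) (D.f h) (D.r h)
    (D.isLocalization h) (D.exists_smul_eq_zero h) (D.exists_eq_smul h)).1
  exists_eq_smul h := (tensorMap_localization (D.dvd h) (D.val_ψ h) (D.f h) (D.r h)
    (D.isLocalization h) (D.exists_smul_eq_zero h) (D.exists_eq_smul h)).2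
  dvd := D.dvd
  inf_dvd := D.inf_dvd

/-- The projections of the modules of the system to their homogeneous components. -/
noncomputable def tProj (i : I) : Projections ι (D.locSystem.T i) :=
  tensorProjections (D.G i) (D.z_mem i)

theorem tProj_t {j i : I} (h : j ≤ i) (e : ι) (w : D.locSystem.T i) :
    (D.tProj j).p e (D.locSystem.t h w) = D.locSystem.t h ((D.tProj i).p e w) :=
  tensorMap_p (D.dvd h) (D.val_ψ h) (D.f h) (D.z_mem i) (D.z_mem j) e w

theorem tProj_smul (i : I) {e : ι} {a : A} (ha : a ∈ 𝒜 e) (e' : ι) (w : D.locSystem.T i) :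
    (D.tProj i).p (e + e') (a • w) = a • (D.tProj i).p e' w :=
  tensorProjections_p_smul (D.G i) (D.z_mem i) ha e' w

/-- The graduation of the module of compatible families. -/
noncomputable def proj [Finite I] : Projections ι D.locSystem.families where
  p e :=
    { toFun := fun x => ⟨fun i => (D.tProj i).p e (x.1 i), fun j i h => by
        rw [← tProj_t, x.2 h]⟩
      map_zero' := Subtype.ext <| funext fun i => map_zero ((D.tProj i).p e)
      map_add' := fun x y => Subtype.ext <| funext fun i =>
        map_add ((D.tProj i).p e) (x.1 i) (y.1 i) }
  p_p e e' x := by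
    refine Subtype.ext <| funext fun i => ?_
    refine ((D.tProj i).p_p e e' (x.1 i)).trans ?_
    by_cases h : e = e'
    · rw [if_pos h, if_pos h]; rfl
    · rw [if_neg h, if_neg h]; rfl
  exists_sum x := by
    cases nonempty_fintype I
    choose t ht using fun i => (D.tProj i).exists_forall_sum (x.1 i)
    refine ⟨Finset.univ.biUnion t, Subtype.ext <| funext fun i => ?_⟩
    rw [AddSubmonoidClass.coe_finsetSum, Finset.sum_apply]
    exact ht i _ (Finset.subset_biUnion_of_mem t (Finset.mem_univ i))

theorem proj_apply [Finite I] (e : ι) (x : D.locSystem.families) (i : I) :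
    ((D.proj).p e x).1 i = (D.tProj i).p e (x.1 i) := rfl

/-- The graded module of compatible families. -/
noncomputable def grMod [Finite I] : GrMod 𝒜 where
  carrier := D.locSystem.families
  piece := D.proj.piece
  isInternal := D.proj.isInternal
  smul_mem {e e' a x} ha hx := by
    rw [Projections.mem_piece] at hx ⊢
    refine Subtype.ext <| funext fun i => ?_
    refine (D.tProj_smul i ha e' (x.1 i)).trans ?_
    rw [← proj_apply, hx]
    rfl

theorem smul_injective {j i : I} (h : j ≤ i) (s : Submonoid.powers (D.z i)) :
    Function.Injective fun w : D.locSystem.T j => (s : A) • w := by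
  obtain ⟨_, n, rfl⟩ := s
  exact D.locSystem.pow_injective_of_le h n

variable [Finite I]

/-- The projection from the compatible families to the module with index `i`. -/
noncomputable def ev (i : I) : D.grMod.carrier →ₗ[A] D.locSystem.T i :=
  (LinearMap.proj i : (∀ i, D.locSystem.T i) →ₗ[A] D.locSystem.T i).comp
    D.locSystem.families.subtype

theorem isLocalizedModule_ev (i : I) :
    IsLocalizedModule (Submonoid.powers (D.z i)) (D.ev i) := by
  constructor
  · rintro ⟨_, n, rfl⟩
    rw [Module.End.isUnit_iff]
    exact D.locSystem.pow_bij i n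
  · intro y
    obtain ⟨n, x, hx⟩ := D.locSystem.families_exists_eq_smul i y
    exact ⟨⟨x, ⟨_, n, rfl⟩⟩, hx.symm⟩
  · intro x y h
    obtain ⟨n, hn⟩ := D.locSystem.families_exists_smul_eq_zero i (x - y) (sub_eq_zero.2 h)
    exact ⟨⟨_, n, rfl⟩, sub_eq_zero.1 ((smul_sub (D.z i ^ n) x y).symm.trans hn)⟩

/-- The localization of the module of compatible families at `z i` is the module with index `i`. -/
noncomputable def evEquiv (i : I) :
    LocalizedModule (Submonoid.powers (D.z i)) D.grMod.carrier ≃ₗ[A] D.locSystem.T i :=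
  haveI := D.isLocalizedModule_ev i
  IsLocalizedModule.iso (Submonoid.powers (D.z i)) (D.ev i)

theorem smul_evEquiv_mk (i : I) (x : D.grMod.carrier) (s : Submonoid.powers (D.z i)) :
    (s : A) • D.evEquiv i (LocalizedModule.mk x s) = D.ev i x := by
  have := D.isLocalizedModule_ev i
  rw [evEquiv, IsLocalizedModule.iso_apply_mk]
  exact IsLocalizedModule.mk'_cancel' (D.ev i) x s

/-- The isomorphism between the localization of the module of compatible families and `T i` takes
elements of degree `0` to elements of degree `0`. -/
theorem proj_evEquiv (i : I) {y : LocalizedModule (Submonoid.powers (D.z i)) D.grMod.carrier}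
    (hy : y ∈ D.grMod.degreeZero (Submonoid.powers (D.z i))) :
    (D.tProj i).p 0 (D.evEquiv i y) = D.evEquiv i y := by
  obtain ⟨e, x, hx, s, hs, rfl⟩ := hy
  apply D.smul_injective le_rfl s
  simp only
  rw [← D.tProj_smul i hs, add_zero, smul_evEquiv_mk]
  have h1 : D.proj.p e x = x := D.proj.mem_piece.1 hx
  exact congrArg (fun x => D.ev i x) h1

theorem evEquiv_smul (i : I) (c : Away 𝒜 (D.z i))
    (y : LocalizedModule (Submonoid.powers (D.z i)) D.grMod.carrier) :
    letI w : Localization.Away (D.z i) ⊗[Away 𝒜 (D.z i)] D.G i := D.evEquiv i y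
    D.evEquiv i (c • y) = c • w := by
  have h1 : ∀ w : Localization.Away (D.z i) ⊗[Away 𝒜 (D.z i)] D.G i, c • w = c.val • w := by
    intro w
    induction w using TensorProduct.induction_on with
    | zero => rw [smul_zero, smul_zero]
    | tmul l g => rw [TensorProduct.smul_tmul', TensorProduct.smul_tmul', Algebra.smul_def]; rfl
    | add x y hx hy => rw [smul_add, smul_add, hx, hy]
  refine Eq.trans ?_ (h1 (D.evEquiv i y)).symm
  rw [GrMod.smul_eq_val_smul]
  let v : LocalizedModule (Submonoid.powers (D.z i)) D.grMod.carrier →ₗ[A]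
    Localization.Away (D.z i) ⊗[Away 𝒜 (D.z i)] D.G i := (D.evEquiv i).toLinearMap
  have := IsLocalization.linearMap_compatibleSMul (Submonoid.powers (D.z i))
    (Localization.Away (D.z i))
    (LocalizedModule (Submonoid.powers (D.z i)) D.grMod.carrier)
    (Localization.Away (D.z i) ⊗[Away 𝒜 (D.z i)] D.G i)
  exact LinearMap.CompatibleSMul.map_smul v c.val y

/-- The component of degree zero of the localization at `z i` of the module of compatible families,
mapped to the given module. -/
noncomputable def degreeZeroMap (i : I) :
    D.grMod.degreeZero (Submonoid.powers (D.z i)) →ₗ[Away 𝒜 (D.z i)] D.G i where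
  toFun y := tensorDegreeZero (D.G i) (D.z_mem i) (D.evEquiv i y.1)
  map_add' x y := by
    rw [Submodule.coe_add, map_add]
    exact map_add (tensorDegreeZero (D.G i) (D.z_mem i)) _ _
  map_smul' c y := by
    refine (congrArg (tensorDegreeZero (D.G i) (D.z_mem i)) (D.evEquiv_smul i c y.1)).trans ?_
    exact map_smul (tensorDegreeZero (D.G i) (D.z_mem i)) _ _

/-- The isomorphism between the localization of the module of compatible families and `T i` takes
`y` of degree `0` to `1 ⊗ degreeZeroMap y`. -/
theorem one_tmul_degreeZeroMap (i : I) (y : D.grMod.degreeZero (Submonoid.powers (D.z i))) :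
    (1 : Localization.Away (D.z i)) ⊗ₜ[Away 𝒜 (D.z i)] D.degreeZeroMap i y = D.evEquiv i y.1 :=
  (one_tmul_tensorDegreeZero (D.G i) (D.z_mem i) _).trans (D.proj_evEquiv i y.2)

/-- The module of compatible families has the given modules as components of degree zero of its
localizations. -/
theorem degreeZeroMap_bijective (i : I) : Function.Bijective (D.degreeZeroMap i) := by
  constructor
  · intro y y' h
    apply Subtype.ext
    apply (D.evEquiv i).injective
    rw [← one_tmul_degreeZeroMap, ← one_tmul_degreeZeroMap, h]
  · intro g
    let w : D.locSystem.T i := (1 : Localization.Away (D.z i)) ⊗ₜ[Away 𝒜 (D.z i)] g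
    have hw : (D.tProj i).p 0 w = w := by
      refine (one_tmul_tensorDegreeZero (D.G i) (D.z_mem i) w).symm.trans ?_
      rw [tensorDegreeZero_one_tmul]
    obtain ⟨n, x, hx⟩ := D.locSystem.families_exists_eq_smul i w
    have hz : D.z i ^ n ∈ 𝒜 (n • D.d i) := SetLike.pow_mem_graded n (D.z_mem i)
    -- The homogeneous component of the right degree of a family is a numerator, too.
    let x' : D.grMod.carrier := D.proj.p (n • D.d i) x
    have hx' : D.ev i x' = D.z i ^ n • w := by
      change (D.tProj i).p (n • D.d i) (x.1 i) = _
      rw [hx]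
      have h1 := D.tProj_smul i hz 0 w
      rwa [add_zero, hw] at h1
    let s : Submonoid.powers (D.z i) := ⟨D.z i ^ n, n, rfl⟩
    refine ⟨⟨LocalizedModule.mk x' s, n • D.d i, x', ⟨x, rfl⟩, s, hz, rfl⟩, ?_⟩
    have h2 : D.evEquiv i (LocalizedModule.mk x' s) = w := by
      apply D.smul_injective le_rfl s
      exact (D.smul_evEquiv_mk i x' s).trans hx'
    change tensorDegreeZero (D.G i) (D.z_mem i) (D.evEquiv i (LocalizedModule.mk x' s)) = g
    rw [h2]
    exact tensorDegreeZero_one_tmul (D.G i) (D.z_mem i) g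

theorem evEquiv_locModMap {j i : I} (h : j ≤ i)
    (y : LocalizedModule (Submonoid.powers (D.z i)) D.grMod.carrier) :
    D.evEquiv j (D.grMod.locModMap (D.dvd h) y) = D.locSystem.t h (D.evEquiv i y) := by
  induction y using LocalizedModule.induction_on with
  | h x s =>
    apply D.smul_injective h s
    simp only
    have h1 : (s : A) • (LocalizedModule.mk x s :
        LocalizedModule (Submonoid.powers (D.z i)) D.grMod.carrier) =
          LocalizedModule.mkLinearMap (Submonoid.powers (D.z i)) D.grMod.carrier x := by
      rw [LocalizedModule.smul'_mk]
      exact LocalizedModule.mk_cancel s x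
    rw [← map_smul, ← map_smul, h1, ← map_smul, smul_evEquiv_mk, GrMod.locModMap,
      ← LinearMap.comp_apply, LocalizedModule.lift_comp]
    have h2 := D.smul_evEquiv_mk j x 1
    rw [OneMemClass.coe_one, one_smul] at h2
    exact h2.trans (x.2 h).symm

/-- The maps `degreeZeroMap` are compatible with the transition maps. -/
theorem degreeZeroMap_transition {j i : I} (h : j ≤ i)
    (y : D.grMod.degreeZero (Submonoid.powers (D.z i)))
    (y' : D.grMod.degreeZero (Submonoid.powers (D.z j)))
    (hy : y'.1 = D.grMod.locModMap (D.dvd h) y.1) :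
    D.degreeZeroMap j y' = D.f h (D.degreeZeroMap i y) := by
  change tensorDegreeZero (D.G j) (D.z_mem j) (D.evEquiv j y'.1) = _
  rw [hy, evEquiv_locModMap, ← one_tmul_degreeZeroMap]
  change tensorDegreeZero (D.G j) (D.z_mem j) (tensorMap (D.dvd h) (D.val_ψ h) (D.f h) (1 ⊗ₜ _)) = _
  rw [tensorMap_tmul, map_one, tensorDegreeZero_one_tmul]

end GradedSystem

end GradedSystem

/-! ### Localization of components of degree zero -/

namespace GrMod

open HomogeneousLocalization

variable {ι A σ : Type*} [CommRing A] [SetLike σ A] [AddSubgroupClass σ A] [AddCommMonoid ι]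
  [DecidableEq ι] {𝒜 : ι → σ} [GradedRing 𝒜]

theorem locModMap_refl (M : GrMod.{w} 𝒜) {f : A} (h : f ∣ f)
    (y : LocalizedModule (Submonoid.powers f) M.carrier) : M.locModMap h y = y := by
  induction y using LocalizedModule.induction_on with
  | h m s =>
    obtain ⟨_, n, rfl⟩ := s
    refine (M.locModMap_mk (mul_one f).symm m n).trans ?_
    rw [one_pow, one_smul]

theorem locModMap_locModMap (M : GrMod.{w} 𝒜) {f x y : A} (h : f ∣ x) (h' : x ∣ y) (h'' : f ∣ y)
    (w : LocalizedModule (Submonoid.powers f) M.carrier) :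
    M.locModMap h' (M.locModMap h w) = M.locModMap h'' w := by
  obtain ⟨g, hx⟩ := id h
  obtain ⟨g', hy⟩ := id h'
  induction w using LocalizedModule.induction_on with
  | h m s =>
    obtain ⟨_, n, rfl⟩ := s
    refine (congrArg (M.locModMap h') (M.locModMap_mk hx m n)).trans ?_
    refine (M.locModMap_mk hy _ n).trans ?_
    refine Eq.trans ?_ (M.locModMap_mk (hy.trans (by rw [hx, mul_assoc])) m n).symm
    rw [smul_smul, ← mul_pow, mul_comm g']

/-- An element of degree `0` of `M_f` is a fraction `m / f ^ n` with `m` of degree `n d`. A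
denominator `f ^ n = 0` has all degrees, but then the fraction is `0 / f ^ n`. -/
theorem exists_eq_mk_of_mem_degreeZero (M : GrMod.{w} 𝒜) {f : A} {d : ι} (hf : f ∈ 𝒜 d)
    {y : LocalizedModule (Submonoid.powers f) M.carrier}
    (hy : y ∈ M.degreeZero (Submonoid.powers f)) :
    ∃ (n : ℕ) (m : M.carrier), m ∈ M.piece (n • d) ∧
      y = LocalizedModule.mk m (⟨f ^ n, n, rfl⟩ : Submonoid.powers f) := by
  obtain ⟨i, m, hm, ⟨_, n, rfl⟩, hs, rfl⟩ := hy
  by_cases h : f ^ n = 0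
  · refine ⟨n, 0, zero_mem _, ?_⟩
    rw [LocalizedModule.mk_eq]
    refine ⟨⟨f ^ n, n, rfl⟩, ?_⟩
    change f ^ n • f ^ n • m = f ^ n • f ^ n • (0 : M.carrier)
    rw [h, zero_smul, zero_smul]
  · obtain rfl := DirectSum.degree_eq_of_mem_mem 𝒜 hs (SetLike.pow_mem_graded n hf) h
    exact ⟨n, m, hm, rfl⟩

theorem away_mk_pow_smul_mk (M : GrMod.{w} 𝒜) {f a : A} {d : ι} (hf : f ∈ 𝒜 d) (n : ℕ)
    (ha : a ∈ 𝒜 (n • d)) (k p : ℕ) (m : M.carrier) :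
    Away.mk 𝒜 hf n a ha ^ k •
      (LocalizedModule.mk m (⟨f ^ p, p, rfl⟩ : Submonoid.powers f)) =
      LocalizedModule.mk (a ^ k • m) (⟨f ^ (n * k + p), n * k + p, rfl⟩ : Submonoid.powers f) := by
  rw [smul_eq_val_smul, val_pow, Away.val_mk, Localization.mk_pow, LocalizedModule.mk_smul_mk]
  congr 1
  exact Subtype.ext (by simp [pow_add, pow_mul])

/-- An element of `M_(f)` that vanishes in `M_(f g)` is annihilated by a power of `a / f ^ n`, where
`a` is a multiple of `g`. -/
theorem exists_pow_smul_eq_zero (M : GrMod.{w} 𝒜) {d : ι} {f g x a c : A} (hf : f ∈ 𝒜 d)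
    (hx : x = f * g) (n : ℕ) (ha : a ∈ 𝒜 (n • d)) (hgc : g * c = a)
    (y : M.degreeZero (Submonoid.powers f)) (hy : M.locModMap ⟨g, hx⟩ y.1 = 0) :
    ∃ k : ℕ, Away.mk 𝒜 hf n a ha ^ k • y = 0 := by
  obtain ⟨p, m, hm, hp⟩ := M.exists_eq_mk_of_mem_degreeZero hf y.2
  rw [hp, locModMap_mk M hx, ← LocalizedModule.zero_mk (1 : Submonoid.powers x),
    LocalizedModule.mk_eq] at hy
  obtain ⟨⟨_, j, rfl⟩, hj⟩ := hy
  refine ⟨j + p, Subtype.ext ?_⟩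
  rw [Submodule.coe_smul, hp, away_mk_pow_smul_mk, Submodule.coe_zero,
    ← LocalizedModule.zero_mk (1 : Submonoid.powers f), LocalizedModule.mk_eq]
  refine ⟨⟨f ^ j, j, rfl⟩, ?_⟩
  rw [one_smul, smul_zero, smul_zero] at hj ⊢
  change x ^ j • g ^ p • m = 0 at hj
  change f ^ j • a ^ (j + p) • m = 0
  have h3 : f ^ j • a ^ (j + p) • m = c ^ (j + p) • x ^ j • g ^ p • m := by
    rw [← mul_smul, ← mul_smul, ← mul_smul, hx, ← hgc]
    congr 1
    ring
  rw [h3, hj, smul_zero]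

/-- Up to a power of `a / f ^ n`, where `a` is a multiple of `g`, every element of `M_(f g)` comes
from `M_(f)`. -/
theorem exists_eq_pow_smul (M : GrMod.{w} 𝒜) {d e dc : ι} {f g x a c : A} (hf : f ∈ 𝒜 d)
    (hg : g ∈ 𝒜 e) (hx : x = f * g) (n : ℕ) (ha : a ∈ 𝒜 (n • d)) (hc : c ∈ 𝒜 dc)
    (hdc : e + dc = n • d) (hgc : g * c = a) (y' : M.degreeZero (Submonoid.powers x)) :
    ∃ (k : ℕ) (y : M.degreeZero (Submonoid.powers f)),
      M.locModMap ⟨g, hx⟩ y.1 = awayMap 𝒜 hg hx (Away.mk 𝒜 hf n a ha) ^ k • y'.1 := by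
  have hxd : x ∈ 𝒜 (d + e) := hx ▸ SetLike.mul_mem_graded hf hg
  obtain ⟨N, m, hm, hy'⟩ := M.exists_eq_mk_of_mem_degreeZero hxd y'.2
  refine ⟨N, ⟨LocalizedModule.mk (c ^ N • m)
    (⟨f ^ (N * (1 + n)), N * (1 + n), rfl⟩ : Submonoid.powers f),
    (N * (1 + n)) • d, c ^ N • m, ?_, _, SetLike.pow_mem_graded _ hf, rfl⟩, ?_⟩
  · have h1 : (N * (1 + n)) • d = N • dc + N • (d + e) := by
      rw [← smul_add, add_comm dc, add_assoc, hdc, mul_smul, add_smul, one_smul]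
    rw [h1]
    exact M.smul_mem (SetLike.pow_mem_graded N hc) hm
  · simp only
    rw [locModMap_mk M hx, hy', awayMap_mk, away_mk_pow_smul_mk, ← hgc, smul_smul]
    congr 1
    · congr 1
      ring
    · refine Subtype.ext ?_
      simp only
      congr 1
      ring

/-- Under the hypotheses of `isLocalization_awayMap`, the component of degree `0` of `M_x` is the
localization of the component of degree `0` of `M_f` at `a / f ^ n`. -/
theorem isLocalizedModule_degreeZeroTransition {d e dc db : ι} {f g x a b c : A} (hf : f ∈ 𝒜 d)
    (hg : g ∈ 𝒜 e) (hx : x = f * g) (n : ℕ) (ha : a ∈ 𝒜 (n • d)) (hc : c ∈ 𝒜 dc)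
    (hdc : e + dc = n • d) (hgc : g * c = a) (l : ℕ) (hb : b ∈ 𝒜 db)
    (hdb : n • d + db = l • (d + e)) (hab : a * b = x ^ l) (M : GrMod.{w} 𝒜) :
    IsLocalizedModule (.powers (Away.mk 𝒜 hf n a ha))
      ((degreeZeroTransition hg hx).app M).hom := by
  have hloc := isLocalization_awayMap hf hg hx n ha hc hdc hgc l hb hdb hab
  let := (awayMap 𝒜 hg hx).toAlgebra
  have hu : IsUnit (awayMap 𝒜 hg hx (Away.mk 𝒜 hf n a ha)) :=
    IsLocalization.Away.algebraMap_isUnit (Away.mk 𝒜 hf n a ha)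
  constructor
  · rintro ⟨_, k, rfl⟩
    rw [Module.End.isUnit_iff]
    have h1 : IsUnit (awayMap 𝒜 hg hx (Away.mk 𝒜 hf n a ha ^ k)) := by
      rw [map_pow]
      exact hu.pow k
    have h2 := (Module.End.isUnit_iff _).1 (h1.map
      (algebraMap (Away 𝒜 x) (Module.End (Away 𝒜 x) (M.degreeZero (Submonoid.powers x)))))
    exact h2
  · intro y'
    obtain ⟨k, y, hy⟩ := M.exists_eq_pow_smul hf hg hx n ha hc hdc hgc y'
    refine ⟨⟨y, ⟨_, k, rfl⟩⟩, Subtype.ext ?_⟩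
    rw [← map_pow] at hy
    exact hy.symm
  · intro y₁ y₂ h
    have h1 : M.locModMap ⟨g, hx⟩ (show M.degreeZero (Submonoid.powers f) from y₁).1 =
        M.locModMap ⟨g, hx⟩ (show M.degreeZero (Submonoid.powers f) from y₂).1 :=
      congrArg Subtype.val h
    obtain ⟨k, hk⟩ := M.exists_pow_smul_eq_zero hf hx n ha hgc
      (show M.degreeZero (Submonoid.powers f) from y₁ - y₂)
      ((map_sub (M.locModMap ⟨g, hx⟩) _ _).trans (sub_eq_zero.2 h1))
    exact ⟨⟨_, k, rfl⟩, sub_eq_zero.1 ((smul_sub (Away.mk 𝒜 hf n a ha ^ k) y₁ y₂).symm.trans hk)⟩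

end GrMod

namespace Fan

variable {V : Type v} [AddCommGroup V] [Module ℝ V] {N : AddSubgroup V} {F : Fan N}
variable [FiniteDimensional ℝ V] [IsZStructure N] (R : Type u) [CommRing R] {B : AddSubgroup F.A}
  {σ : F.Cone} {u : dualStructure N} {K : ℕ}

theorem c_eq_zero {τ : F.Cone} (hker : ∀ x, x ∈ τ.1 ↔ x ∈ σ.1 ∧ u.1 x = 0) {ρ : F.Ray}
    (hρ : ρ.1 ≤ τ) : F.c u ρ = 0 := by
  have := ((hker _).1 ((ray_le_iff ρ τ).1 hρ)).2
  rw [← c_apply] at this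
  exact_mod_cast this

theorem IsBounded.one_le_c (H : IsBounded σ u K) {τ : F.Cone}
    (hker : ∀ x, x ∈ τ.1 ↔ x ∈ σ.1 ∧ u.1 x = 0) {ρ : F.Ray} (hρ : ρ.1 ≤ σ) (hρ' : ¬ ρ.1 ≤ τ) :
    1 ≤ F.c u ρ := by
  have h0 : F.c u ρ ≠ 0 := by
    intro h0
    apply hρ'
    rw [ray_le_iff, hker, ← c_apply, h0]
    exact ⟨(ray_le_iff ρ σ).1 hρ, by simp⟩
  have := H.c_nonneg hρ
  omega

theorem IsBounded.qExp_le_faceExp (H : IsBounded σ u K) {τ : F.Cone}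
    (hker : ∀ x, x ∈ τ.1 ↔ x ∈ σ.1 ∧ u.1 x = 0) : F.qExp τ σ ≤ faceExp σ u K := by
  intro ρ
  by_cases h1 : ρ.1 ≤ σ ∧ ¬ ρ.1 ≤ τ
  · have h2 := H.faceExp_eq ρ
    simp only [zExp, h1.1, if_true] at h2
    have := H.one_le_c hker h1.1 h1.2
    simp only [qExp, if_pos h1]
    push_cast at *
    omega
  · simp [qExp, h1]

theorem IsBounded.faceExp_le (H : IsBounded σ u K) {τ : F.Cone} (h : τ ≤ σ)
    (hker : ∀ x, x ∈ τ.1 ↔ x ∈ σ.1 ∧ u.1 x = 0) : faceExp σ u K ≤ (2 * K) • F.zExp τ := by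
  intro ρ
  have h1 := H.faceExp_eq ρ
  have h2 := H.2 ρ
  have h3 := le_abs_self (F.c u ρ)
  by_cases hρ : ρ.1 ≤ τ
  · have hρ' := hρ.trans h
    simp only [zExp, hρ', if_true] at h1
    have := c_eq_zero hker hρ
    push_cast at h1
    simp only [Pi.smul_apply]
    omega
  · by_cases hρ' : ρ.1 ≤ σ <;>
      simp only [zExp, hρ', if_true, if_false, Pi.smul_apply, hρ, smul_eq_mul, mul_one] at h1 ⊢ <;>
      push_cast at h1 <;> omega

/-- If `τ = σ ∩ ker u` with `u ∈ σ^∨ ∩ M`, then `G_(τ)` is the localization of `G_(σ)` at the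
`m`-th power of `∏ ρ, Z_ρ ^ u(ρ_N)`. -/
theorem isLocalizedModule_coneModuleMap (H : IsBounded σ u K) {τ : F.Cone} (h : τ ≤ σ)
    (hker : ∀ x, x ∈ τ.1 ↔ x ∈ σ.1 ∧ u.1 x = 0) (G : GrMod.{max u v} (F.coxPiece R B)) :
    IsLocalizedModule (.powers (faceElem R B H)) ((coneModuleMap R B h).app G).hom := by
  obtain ⟨eC, heC⟩ := exists_add_of_le (H.qExp_le_faceExp hker)
  obtain ⟨eB, heB⟩ := exists_add_of_le (H.faceExp_le h hker)
  refine GrMod.isLocalizedModule_degreeZeroTransition (d := F.zDeg B σ) (e := F.qDeg B τ σ)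
    (F.zPow_mem R B σ) (F.qPow_mem R B τ σ) (zPow_eq_mul R B h)
    K _ (monoB_mem R (B.index • eC) (F.index_nsmul_mem B _)) ?_ ?_ (2 * K)
    (monoB_mem R (B.index • eB) (F.index_nsmul_mem B _)) ?_ ?_ G
  · rw [← H.deg_eq]
    apply Subtype.ext
    simp only [qDeg, AddSubgroup.coe_add]
    rw [← monoDeg_add, ← smul_add, heC]
  · apply Subtype.ext
    simp only [qPow, monoB, MulMemClass.mk_mul_mk]
    rw [← mono_add, ← smul_add, heC]
  · rw [← H.deg_eq]
    apply Subtype.ext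
    simp only [qDeg, zDeg, AddSubgroup.coe_add, AddSubgroup.coe_nsmul]
    rw [← monoDeg_add, ← monoDeg_add, ← smul_add, ← smul_add, zExp_add_qExp h, ← heB,
      ← monoDeg_nsmul, smul_comm]
  · rw [zPow_eq]
    apply Subtype.ext
    simp only [monoB, MulMemClass.mk_mul_mk, SubmonoidClass.mk_pow]
    rw [← mono_add, ← mono_nsmul, ← smul_add, ← heB, smul_comm]

end Fan

/-! ### The affine cover of a Cox scheme -/

namespace Fan

variable {V : Type v} [AddCommGroup V] [Module ℝ V] {N : AddSubgroup V} (F : Fan N)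

/-- The meet of two cones is their intersection. -/
instance : SemilatticeInf F.Cone where
  __ := (inferInstance : PartialOrder F.Cone)
  inf := inter
  inf_le_left σ τ := (F.inf_isFace σ.1 σ.2 τ.1 τ.2).1
  inf_le_right σ τ := (F.inf_isFace σ.1 σ.2 τ.1 τ.2).2
  le_inf _ _ _ h h' := isFace_of_le (_root_.le_inf h.le h'.le)

variable {F} in
/-- A ray outside `σ ∩ τ` is outside `σ` or outside `τ`. -/
theorem zExp_inf_le (σ τ : F.Cone) : F.zExp (σ ⊓ τ) ≤ F.zExp σ + F.zExp τ := by
  intro ρ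
  by_cases h1 : ρ.1 ≤ σ
  · by_cases h2 : ρ.1 ≤ τ
    · simp [zExp, h1, h2]
    · simp [zExp, h1, h2]
  · simp only [zExp, h1, if_false, Pi.add_apply]
    split_ifs <;> simp

variable [FiniteDimensional ℝ V] [IsZStructure N] (R : Type u) [CommRing R] (B : AddSubgroup F.A)

variable {F} in
theorem zPow_inf_dvd (σ τ : F.Cone) : F.zPow R B (σ ⊓ τ) ∣ F.zPow R B σ * F.zPow R B τ := by
  obtain ⟨e, he⟩ := exists_add_of_le (zExp_inf_le σ τ)
  refine ⟨monoB R (B.index • e) (F.index_nsmul_mem B _), ?_⟩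
  rw [zPow_eq, zPow_eq, zPow_eq]
  apply Subtype.ext
  simp only [monoB, MulMemClass.mk_mul_mk]
  rw [← mono_add, ← mono_add, ← smul_add, ← smul_add, he]

theorem exists_mem_opensRange_coxι (x : F.coxScheme R B) : ∃ σ, x ∈ (F.coxι R B σ).opensRange := by
  obtain ⟨σ, y, hy⟩ := Scheme.IsLocallyDirected.ι_jointly_surjective (F.coxDiagram R B) x
  exact ⟨σ, y, hy⟩

variable {F} in
theorem opensRange_coxι_inf_le (σ τ : F.Cone) :
    (F.coxι R B σ).opensRange ⊓ (F.coxι R B τ).opensRange ≤ (F.coxι R B (σ ⊓ τ)).opensRange := by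
  rintro _ ⟨⟨y, rfl⟩, ⟨y', hy'⟩⟩
  obtain ⟨κ, h, h', x, hx, -⟩ :=
    (Scheme.IsLocallyDirected.ι_eq_ι_iff (F.coxDiagram R B)).1 hy'.symm
  have hκ : κ ≤ σ ⊓ τ := _root_.le_inf h.le h'.le
  refine ⟨(F.coxDiagram R B).map (homOfLE hκ) x, ?_⟩
  have h1 : (F.coxDiagram R B).map (homOfLE hκ) ≫ F.coxι R B (σ ⊓ τ) =
      (F.coxDiagram R B).map h ≫ F.coxι R B σ :=
    (map_coxι F R B hκ).trans (map_coxι F R B h.le).symm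
  rw [← hx]
  exact congrArg (fun k => k x) h1

variable {F} in
/-- For a face `τ` of `σ`, an element of `S_(σ)` at which `S_(τ)` is a localization. -/
noncomputable def faceFun {τ σ : F.Cone} (h : τ ≤ σ) : F.coneRing R B σ :=
  faceElem R B (exists_isBounded_of_le h).choose_spec.choose_spec.1

/-- The cover of the Cox scheme by the affine schemes `Y_σ(R)`. -/
noncomputable def coxSystem : AffineSystem (F.coxScheme R B) F.Cone where
  A σ := CommRingCat.of (F.coneRing R B σ)
  ι := F.coxι R B
  φ h := CommRingCat.ofHom (coneRingMap R B h)
  comp_eq h := F.map_coxι R B h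
  exists_mem := F.exists_mem_opensRange_coxι R B
  inf_le := opensRange_coxι_inf_le R B
  r h := faceFun R B h
  range_eq h := range_coxDiagram_map R B (homOfLE h) _
    (exists_isBounded_of_le h).choose_spec.choose_spec.2

variable {B} in
/-- The modules `G_(σ)` on the affine schemes `Y_σ(R)`. -/
noncomputable def coxModuleSystem (G : GrMod.{max u v} (F.coxPiece R B)) :
    (F.coxSystem R B).ModuleSystem where
  M σ := (F.coneModule R B σ).obj G
  f h := (coneModuleMap R B h).app G
  f_refl σ _ := Subtype.ext (G.locModMap_refl (zPow_dvd R B (le_refl σ)) _)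
  f_comp h h' _ := Subtype.ext
    (G.locModMap_locModMap (zPow_dvd R B h') (zPow_dvd R B h) (zPow_dvd R B (h.trans h')) _)
  isLocalizedModule h := isLocalizedModule_coneModuleMap R
    (exists_isBounded_of_le h).choose_spec.choose_spec.1 h
    (exists_isBounded_of_le h).choose_spec.choose_spec.2 G

/-- The projection from `𝒮_B` to the direct image of the sheaves associated with the `G_(σ)`. -/
noncomputable def sheafProj (σ : F.Cone) : F.sheafFunctor R B ⟶ F.pushSheaf R B σ :=
  Limits.equalizer.ι
    (Limits.Pi.lift fun p : {p : F.Cone × F.Cone // p.1 ≤ p.2} =>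
      Limits.Pi.π (F.pushSheaf R B) p.1.2 ≫ pushSheafMap R B p.2)
    (Limits.Pi.lift fun p : {p : F.Cone × F.Cone // p.1 ≤ p.2} =>
      Limits.Pi.π (F.pushSheaf R B) p.1.1) ≫ Limits.Pi.π (F.pushSheaf R B) σ

end Fan

/-! ### The sheaf of a graded module as a glueing -/

section

variable {C : Type*} [Category* C] {X : Scheme.{u}} {R S : CommRingCat.{u}} {φ : R ⟶ S}
  {ι : Spec R ⟶ X} {ι' : Spec S ⟶ X} {K : C ⥤ ModuleCat.{u} R} {K' : C ⥤ ModuleCat.{u} S}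

/-- The morphism of functors with the components `semiTilde`. -/
noncomputable def semiTildeNat (m : K ⟶ K' ⋙ ModuleCat.restrictScalars φ.hom) :
    K ⋙ tilde.functor R ⟶
      (K' ⋙ tilde.functor S) ⋙ Scheme.Modules.pushforward (Spec.map φ) :=
  Functor.whiskerRight m (tilde.functor R) ≫ (Functor.associator _ _ _).hom ≫
    Functor.whiskerLeft _ (tildeRestrictScalars φ) ≫ (Functor.associator K' (tilde.functor S) _).inv

theorem semiTildeNat_app (m : K ⟶ K' ⋙ ModuleCat.restrictScalars φ.hom) (G : C) :
    (semiTildeNat m).app G = semiTilde (m.app G) := by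
  have h1 : 𝟙 _ ≫ (tildeRestrictScalars φ).app (K'.obj G) ≫ 𝟙 _ =
    (tildeRestrictScalars φ).app (K'.obj G) := by rw [Category.id_comp, Category.comp_id]
  exact congrArg (fun k => (tilde.functor R).map (m.app G) ≫ k) h1

/-- The morphism of functors with the components `pushTilde`. -/
noncomputable def pushTildeNat (h : Spec.map φ ≫ ι = ι')
    (m : K ⟶ K' ⋙ ModuleCat.restrictScalars φ.hom) :
    (K ⋙ tilde.functor R) ⋙ Scheme.Modules.pushforward ι ⟶
      (K' ⋙ tilde.functor S) ⋙ Scheme.Modules.pushforward ι' :=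
  Functor.whiskerRight (semiTildeNat m) (Scheme.Modules.pushforward ι) ≫
    (Functor.associator _ _ _).hom ≫
    Functor.whiskerLeft _ ((Scheme.Modules.pushforwardComp _ _).hom ≫
      (Scheme.Modules.pushforwardCongr h).hom)

theorem pushTildeNat_app (h : Spec.map φ ≫ ι = ι')
    (m : K ⟶ K' ⋙ ModuleCat.restrictScalars φ.hom) (G : C) :
    (pushTildeNat h m).app G = pushTilde h (m.app G) := by
  have h1 := Category.id_comp (pushComp h (tilde (K'.obj G))).hom
  exact (congrArg (fun k => (Scheme.Modules.pushforward ι).map ((semiTildeNat m).app G) ≫ k)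
    h1).trans (congrArg (fun k => (Scheme.Modules.pushforward ι).map k ≫
      (pushComp h (tilde (K'.obj G))).hom) (semiTildeNat_app m G))

end

namespace Fan

variable {V : Type v} [AddCommGroup V] [Module ℝ V] {N : AddSubgroup V} (F : Fan N)
variable [FiniteDimensional ℝ V] [IsZStructure N] (R : Type u) [CommRing R] (B : AddSubgroup F.A)

variable {F} in
theorem coneSheafMap_eq {τ σ : F.Cone} (h : τ ≤ σ) :
    coneSheafMap R B h = semiTildeNat (R := .of (F.coneRing R B σ)) (S := .of (F.coneRing R B τ))
      (φ := CommRingCat.ofHom (coneRingMap R B h)) (K := F.coneModule R B σ)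
      (K' := F.coneModule R B τ) (coneModuleMap R B h) :=
  rfl

variable {F} in
theorem pushSheafMap_eq {τ σ : F.Cone} (h : τ ≤ σ) :
    pushSheafMap R B h = pushTildeNat (R := .of (F.coneRing R B σ)) (S := .of (F.coneRing R B τ))
      (φ := CommRingCat.ofHom (coneRingMap R B h)) (K := F.coneModule R B σ)
      (K' := F.coneModule R B τ) (F.map_coxι R B h) (coneModuleMap R B h) := by
  rw [pushSheafMap, pushTildeNat, coneSheafMap_eq]
  rfl

variable {F} in
/-- The transition morphism between direct images on `Y_Σ(R)` at a graded module `G` is the one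
defined by the map `G_(σ) → G_(τ)`. -/
theorem pushSheafMap_app {τ σ : F.Cone} (h : τ ≤ σ) (G : GrMod.{max u v} (F.coxPiece R B)) :
    (pushSheafMap R B h).app G =
      pushTilde (R := .of (F.coneRing R B σ)) (S := .of (F.coneRing R B τ))
        (φ := CommRingCat.ofHom (coneRingMap R B h)) (F.map_coxι R B h)
        (M := (F.coneModule R B σ).obj G) (M' := (F.coneModule R B τ).obj G)
        ((coneModuleMap R B h).app G) :=
  (congrArg (fun k => k.app G) (pushSheafMap_eq R B h)).trans
    (pushTildeNat_app (R := .of (F.coneRing R B σ)) (S := .of (F.coneRing R B τ))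
      (φ := CommRingCat.ofHom (coneRingMap R B h)) (K := F.coneModule R B σ)
      (K' := F.coneModule R B τ) (F.map_coxι R B h) (coneModuleMap R B h) G)

theorem sheafProj_pushSheafMap {τ σ : F.Cone} (h : τ ≤ σ) :
    F.sheafProj R B σ ≫ pushSheafMap R B h = F.sheafProj R B τ := by
  have h1 := congrArg (fun k => k ≫ Limits.Pi.π
      (fun p : {p : F.Cone × F.Cone // p.1 ≤ p.2} => F.pushSheaf R B p.1.1) ⟨(τ, σ), h⟩)
    (Limits.equalizer.condition
      (Limits.Pi.lift fun p : {p : F.Cone × F.Cone // p.1 ≤ p.2} =>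
        Limits.Pi.π (F.pushSheaf R B) p.1.2 ≫ pushSheafMap R B p.2)
      (Limits.Pi.lift fun p : {p : F.Cone × F.Cone // p.1 ≤ p.2} =>
        Limits.Pi.π (F.pushSheaf R B) p.1.1))
  simp only [Category.assoc, Limits.Pi.lift_π] at h1
  exact (Category.assoc _ _ _).trans h1

/-- A functor to sets that preserves limits takes `𝒮_B` to the sets of compatible families. -/
theorem existsUnique_sheafProj
    {E : (GrMod.{max u v} (F.coxPiece R B) ⥤ (F.coxScheme R B).Modules) ⥤
      Type (max u v)}
    [Limits.PreservesLimitsOfSize.{max u v, max u v} E]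
    (x : ∀ σ, E.obj (F.pushSheaf R B σ))
    (hx : ∀ {τ σ : F.Cone} (h : τ ≤ σ), E.map (pushSheafMap R B h) (x σ) = x τ) :
    ∃! z : E.obj (F.sheafFunctor R B), ∀ σ, E.map (F.sheafProj R B σ) z = x σ :=
  have := Limits.preservesLimitsOfSize_shrink.{v, max u v, v, max u v} E
  have := Limits.preservesLimitsOfSize_shrink.{0, max u v, 0, max u v} E
  existsUnique_equalizer (X := F.pushSheaf R B)
    (s := fun p : {p : F.Cone × F.Cone // p.1 ≤ p.2} => p.1.2) (t := fun p => p.1.1)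
    (fun p => pushSheafMap R B p.2) E x fun p => hx p.2

variable {B} in
/-- The sheaf `𝒮_B(G)`, an equalizer of products in a category of functors, is the glueing of the
sheaves associated with the `G_(σ)`: equalizers of products of functors are formed pointwise, and
both sections over an open set and morphisms out of a fixed module preserve limits. -/
theorem isGlueing_sheafFunctor (G : GrMod.{max u v} (F.coxPiece R B)) :
    (F.coxModuleSystem R G).IsGlueing ((F.sheafFunctor R B).obj G)
      fun σ => (F.sheafProj R B σ).app G := by
  have hp : ∀ {τ σ : F.Cone} (h : τ ≤ σ),
      (F.coxModuleSystem R G).p h = (pushSheafMap R B h).app G :=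
    fun h => (pushSheafMap_app R B h G).symm
  constructor
  · intro τ σ h
    rw [hp]
    exact congrArg (fun k => k.app G) (F.sheafProj_pushSheafMap R B h)
  · intro W x hx
    simp only [hp] at hx
    exact F.existsUnique_sheafProj R B (E := (evaluation _ _).obj G ⋙ sectionsFunctor _ W) x
      fun h => hx h
  · intro Q θ hθ
    simp only [hp] at hθ
    obtain ⟨t, ht, -⟩ := F.existsUnique_sheafProj R B
      (E := (evaluation _ _).obj G ⋙ coyoneda.obj (.op Q)) θ fun h => hθ h
    exact ⟨t, ht⟩

end Fan

/-! ### Essential surjectivity -/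

section Restriction

variable {X : Scheme.{u}} {R S : Type u} [CommRing R] [CommRing S] {φ : R →+* S}
  {ι : Spec (.of R) ⟶ X} {ι' : Spec (.of S) ⟶ X} [IsOpenImmersion ι] [IsOpenImmersion ι']
  [IsOpenImmersion (Spec.map (CommRingCat.ofHom φ))]

/-- The map `affineSectionsMap` as a semilinear map. -/
noncomputable def affineSectionsLinear (h : Spec.map (CommRingCat.ofHom φ) ≫ ι = ι')
    (Q : X.Modules) :
    affineSections ι Q →ₛₗ[φ] affineSections ι' Q where
  toFun x := (affineSectionsMap h Q).hom x
  map_add' x y := map_add (affineSectionsMap h Q).hom x y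
  map_smul' c x := map_smul (affineSectionsMap h Q).hom c x

theorem affineSectionsLinear_smul_eq_zero (h : Spec.map (CommRingCat.ofHom φ) ≫ ι = ι')
    {Q : X.Modules} (hQ : isQuasicoherent X Q) (r : R)
    (hr : (Spec.map (CommRingCat.ofHom φ)).opensRange = PrimeSpectrum.basicOpen r)
    (x : affineSections ι Q) (hx : affineSectionsLinear h Q x = 0) : ∃ n : ℕ, r ^ n • x = 0 := by
  have := isLocalizedModule_affineSectionsMap h Q hQ r hr
  obtain ⟨⟨_, n, rfl⟩, hn⟩ := (IsLocalizedModule.eq_zero_iff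
    (.powers r) (affineSectionsMap h Q).hom).1 hx
  exact ⟨n, hn⟩

theorem affineSectionsLinear_eq_smul (h : Spec.map (CommRingCat.ofHom φ) ≫ ι = ι')
    {Q : X.Modules} (hQ : isQuasicoherent X Q) (r : R)
    (hr : (Spec.map (CommRingCat.ofHom φ)).opensRange = PrimeSpectrum.basicOpen r)
    (x' : affineSections ι' Q) :
    ∃ (n : ℕ) (x : affineSections ι Q), affineSectionsLinear h Q x = φ r ^ n • x' := by
  have := isLocalizedModule_affineSectionsMap h Q hQ r hr
  obtain ⟨⟨x, _, n, rfl⟩, hn⟩ := IsLocalizedModule.surj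
    (.powers r) (affineSectionsMap h Q).hom x'
  refine ⟨n, x, hn.symm.trans ?_⟩
  exact congrArg (fun c : (CommRingCat.of S : CommRingCat.{u}) => c • x') (map_pow φ r n)

end Restriction

namespace Fan

variable {V : Type v} [AddCommGroup V] [Module ℝ V] {N : AddSubgroup V} (F : Fan N)
variable [FiniteDimensional ℝ V] [IsZStructure N] (R : Type u) [CommRing R] (B : AddSubgroup F.A)

variable {F} in
instance isOpenImmersion_coneRingMap {τ σ : F.Cone} (h : τ ≤ σ) :
    IsOpenImmersion (Spec.map (CommRingCat.ofHom (coneRingMap R B h))) :=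
  inferInstanceAs (IsOpenImmersion ((F.coxDiagram R B).map (homOfLE h)))

variable {F} in
theorem isLocalization_faceFun {τ σ : F.Cone} (h : τ ≤ σ) :
    letI := (coneRingMap R B h).toAlgebra
    IsLocalization.Away (faceFun R B h) (F.coneRing R B τ) :=
  isLocalization_faceElem R B (exists_isBounded_of_le h).choose_spec.choose_spec.1 h
    (exists_isBounded_of_le h).choose_spec.choose_spec.2

variable {F} in
theorem opensRange_coneRingMap {τ σ : F.Cone} (h : τ ≤ σ) :
    (Spec.map (CommRingCat.ofHom (coneRingMap R B h))).opensRange =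
      PrimeSpectrum.basicOpen (faceFun R B h) :=
  (F.coxSystem R B).opensRange_eq h

variable {B} (Q : (F.coxScheme R B).Modules)

/-- Restriction of sections of a module from `Y_σ(R)` to `Y_τ(R)` for a face `τ` of `σ`. -/
noncomputable def sectionsMap {τ σ : F.Cone} (h : τ ≤ σ) :
    affineSections (F.coxι R B σ) Q →ₛₗ[coneRingMap R B h] affineSections (F.coxι R B τ) Q :=
  affineSectionsLinear (F.map_coxι R B h) Q

theorem sectionsMap_refl (σ : F.Cone) (x : affineSections (F.coxι R B σ) Q) :
    F.sectionsMap R Q (le_refl σ) x = x :=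
  affineSectionsMap_refl (F.map_coxι R B (le_refl σ)) Q x

theorem sectionsMap_sectionsMap {υ τ σ : F.Cone} (h : υ ≤ τ) (h' : τ ≤ σ)
    (x : affineSections (F.coxι R B σ) Q) :
    F.sectionsMap R Q h (F.sectionsMap R Q h' x) = F.sectionsMap R Q (h.trans h') x :=
  affineSectionsMap_comp (F.map_coxι R B h') (F.map_coxι R B h) (F.map_coxι R B (h.trans h')) Q x

variable {Q}

theorem sectionsMap_smul_eq_zero (hQ : isQuasicoherent (F.coxScheme R B) Q) {τ σ : F.Cone}
    (h : τ ≤ σ) (x : affineSections (F.coxι R B σ) Q) (hx : F.sectionsMap R Q h x = 0) :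
    ∃ n : ℕ, faceFun R B h ^ n • x = 0 :=
  affineSectionsLinear_smul_eq_zero (F.map_coxι R B h) hQ (faceFun R B h)
    (opensRange_coneRingMap R B h) x hx

theorem sectionsMap_eq_smul (hQ : isQuasicoherent (F.coxScheme R B) Q) {τ σ : F.Cone} (h : τ ≤ σ)
    (x' : affineSections (F.coxι R B τ) Q) :
    ∃ (n : ℕ) (x : affineSections (F.coxι R B σ) Q),
      F.sectionsMap R Q h x = coneRingMap R B h (faceFun R B h) ^ n • x' :=
  affineSectionsLinear_eq_smul (F.map_coxι R B h) hQ (faceFun R B h)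
    (opensRange_coneRingMap R B h) x'

variable (Q)

/-- The modules of sections of a quasicoherent module on the affine schemes `Y_σ(R)`. -/
noncomputable def sectionsSystem (hQ : isQuasicoherent (F.coxScheme R B) Q) :
    GradedSystem.{max u v} (F.coxPiece R B) F.Cone where
  z := F.zPow R B
  d := F.zDeg B
  z_mem := F.zPow_mem R B
  dvd := zPow_dvd R B
  inf_dvd := zPow_inf_dvd R B
  ψ h := coneRingMap R B h
  val_ψ h := val_coneRingMap R B h
  G σ := affineSections (F.coxι R B σ) Q
  f h := F.sectionsMap R Q h
  f_refl σ x := F.sectionsMap_refl R Q σ x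
  f_f h h' x := F.sectionsMap_sectionsMap R Q h h' x
  r h := faceFun R B h
  isLocalization h := isLocalization_faceFun R B h
  exists_smul_eq_zero h := F.sectionsMap_smul_eq_zero R hQ h
  exists_eq_smul h := F.sectionsMap_eq_smul R hQ h

/-- A quasicoherent module `Q` is isomorphic to `𝒮_B(G)`, where `G` is the graded module of
compatible families of elements of the modules `S_{Ẑ_σ^m} ⊗_{S_(σ)} Γ(Y_σ(R), Q)`. -/
theorem nonempty_sheafFunctor_iso (hQ : isQuasicoherent (F.coxScheme R B) Q) :
    Nonempty ((F.sheafFunctor R B).obj (F.sectionsSystem R Q hQ).grMod ≅ Q) := by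
  let D := F.sectionsSystem R Q hQ
  exact (F.isGlueing_sheafFunctor R D.grMod).nonempty_iso Q hQ
    (fun σ => (LinearEquiv.ofBijective (D.degreeZeroMap σ)
      (D.degreeZeroMap_bijective σ)).toModuleIso)
    fun h m => D.degreeZeroMap_transition h m _ rfl

end Fan

end CoxScheme

theorem mainTheorem2 {V : Type v} [AddCommGroup V] [Module ℝ V] [FiniteDimensional ℝ V]
    (N : AddSubgroup V) [CoxScheme.IsZStructure N] (F : CoxScheme.Fan N)
    (R : Type u) [CommRing R] (B : AddSubgroup F.A) [B.FiniteIndex] :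
    ∃ h : ∀ G, CoxScheme.isQuasicoherent (F.coxScheme R B) ((F.sheafFunctor R B).obj G),
      ((CoxScheme.isQuasicoherent (F.coxScheme R B)).lift (F.sheafFunctor R B) h).EssSurj := by
  refine ⟨fun G => (F.isGlueing_sheafFunctor R G).isQuasicoherent, ⟨fun Q => ?_⟩⟩
  obtain ⟨e⟩ := F.nonempty_sheafFunctor_iso R Q.obj Q.property
  exact ⟨_, ⟨CategoryTheory.ObjectProperty.isoMk _ e⟩⟩
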